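/- Let $M$ be a smooth $n$-manifold (Hausdorff, second countable, without boundary), let $k\ge 1$, and let $Z\subset M$ be a coorientable hypersurface (embedded, codimension one, closed as a subset). Let $I_Z\subset C^\infty(M)$ be the ideal of functions vanishing on $Z$, and fix a jet $j\in J_Z^{k-1}=C^\infty(M)/I_Z^k$ with vanishing zero-jet and, if $k\ge 2$, nowhere vanishing first jet along $Z$ (for $k=1$ this means $j=0$). Then there is a Lie algebroid $\mathcal A_Z^k\to M$, the $b^k$-tangent bundle, whose anchor $\rho$ identifies its space of smooth sections with $$\{X\in\mathfrak X(M) : \mathcal L_X f\in I_Z^k \text{ for all } f\in j\},$$ and there is a codimension-one foliation $\mathcal F$ of $M\times\mathbb S^1$ with the following properties. 1. $\mathcal F$ is invariant under the translations of the $\mathbb S^1$-factor. 2. There are an open neighbourhood $U$ of $Z$, a smooth function $z$ on $M$ with jet $j$ along $Z$, such that $\{x\in U: z(x)=0\}=Z$ and $dz\neq 0$ along $Z$, and a smooth function $\chi:\mathbb R\to\mathbb R$, equal to $1$ near $0$, such that the closure in $M$ of $\{x\in U:\chi(z(x))\ne0\}$ is contained in $U$, for which $$T\mathcal F=\ker\big(\chi(z)\,dz+z^k\,ds\big)\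 \text{ on } U\times\mathbb S^1,\qquad T\mathcal F=\ker(ds)\ \text{ elsewhere},$$ where $ds$ is the standard angular form on $\mathbb S^1$. 3. The leaves that meet $Z\times\mathbb S^1$ (the central leaves) are exactly the connected components of $Z\times\mathbb S^1$. 4. Away from $Z\times\mathbb S^1$ the foliation is transverse to the $\mathbb S^1$-direction, and every leaf other than the central ones is the graph of a smooth map $C\to\mathbb S^1$ on a connected component $C$ of $M\setminus Z$. 5. For every Lie algebroid $\mathcal A_Z^k$ as above, there is a Lie algebroid morphism $\Psi:T\mathcal F\to\mathcal A_Z^k$ covering the projection $\pi:M\times\mathbb S^1\to M$, so that $\rho\circ\Psi=d\pi|_{T\mathcal F}$, and $\Psi$ is a fibrewise isomorphism (in particular a Lie algebroid submersion). -/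

import Mathlib

open Set Filter Topology Bundle Manifold
open scoped ContDiff

universe u w₁ w₂ uE uH uM

noncomputable section

namespace BkRegularisation

/-! ### Smooth functions, vector fields and Lie derivatives -/

section General

variable {E : Type*} [NormedAddCommGroup E] [NormedSpace ℝ E]
  {H : Type*} [TopologicalSpace H] (I : ModelWithCorners ℝ E H)
  (M : Type*) [TopologicalSpace M] [ChartedSpace H M]

/-- The ring of smooth real functions on `M`. -/
abbrev SmoothFn : Type _ := C^∞⟮I, M; 𝓘(ℝ, ℝ), ℝ⟯

/-- The space of smooth vector fields on `M`. -/
abbrev SmoothVF [IsManifold I ∞ M] : Type _ :=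
  ContMDiffSection I E ∞ (fun x : M => TangentSpace I x)

variable {I M}

/-- The Lie derivative `L_X f = df(X)` of a smooth function along a smooth vector field. -/
def lieDeriv [IsManifold I ∞ M] (X : SmoothVF I M) (f : SmoothFn I M) : SmoothFn I M :=
  ⟨fun x => mvfderiv I f x (X x), by
    have h1 : ContMDiff I.tangent 𝓘(ℝ, ℝ).tangent ∞ (tangentMap I 𝓘(ℝ, ℝ) f) :=
      f.contMDiff.contMDiff_tangentMap (by simp)
    have h2 : ContMDiff I 𝓘(ℝ, ℝ).tangent ∞
        (fun x => tangentMap I 𝓘(ℝ, ℝ) f ⟨x, X x⟩) := h1.comp X.contMDiff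
    exact ((contMDiff_snd_tangentBundle_modelSpace ℝ 𝓘(ℝ, ℝ)).comp h2)⟩

/-- The product `f • a` of a smooth function and a smooth section of a smooth vector bundle. -/
def smulSection {F : Type*} [NormedAddCommGroup F] [NormedSpace ℝ F]
    {V : M → Type*} [TopologicalSpace (TotalSpace F V)] [∀ x, AddCommGroup (V x)]
    [∀ x, Module ℝ (V x)] [∀ x, TopologicalSpace (V x)] [FiberBundle F V] [VectorBundle ℝ F V]
    (f : SmoothFn I M) (a : ContMDiffSection I F ∞ V) : ContMDiffSection I F ∞ V :=
  ⟨fun x => f x • a x, f.contMDiff.smul_section a.contMDiff⟩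

end General

/-! ### Lie algebroids -/

set_option linter.checkUnivs false in
/-- A (smooth, real) Lie algebroid on `M`: a smooth vector bundle `V → M` of finite rank with a
Lie bracket on its smooth sections and an anchor `V → TM` (a smooth vector bundle morphism over
the identity), satisfying the Leibniz rule. That the anchor preserves brackets, which is
a consequence of the other axioms, is included as is customary. -/
structure LieAlgebroid {E : Type uE} [NormedAddCommGroup E] [NormedSpace ℝ E]
    {H : Type uH} [TopologicalSpace H] (I : ModelWithCorners ℝ E H)
    (M : Type uM) [TopologicalSpace M] [ChartedSpace H M] [IsManifold I ∞ M] where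
  /-- The model fibre. -/
  Fib : Type w₁
  [normedAddCommGroup : NormedAddCommGroup Fib]
  [normedSpace : NormedSpace ℝ Fib]
  [finiteDimensional : FiniteDimensional ℝ Fib]
  /-- The fibres of the vector bundle. -/
  V : M → Type w₂
  [topologicalSpaceTotal : TopologicalSpace (TotalSpace Fib V)]
  [addCommGroup : ∀ x, AddCommGroup (V x)]
  [module : ∀ x, Module ℝ (V x)]
  [topologicalSpace : ∀ x, TopologicalSpace (V x)]
  [fiberBundle : FiberBundle Fib V]
  [vectorBundle : VectorBundle ℝ Fib V]
  [contMDiffVectorBundle : ContMDiffVectorBundle ∞ Fib V I]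
  /-- The anchor. -/
  anchor : ∀ x, V x →ₗ[ℝ] TangentSpace I x
  contMDiff_anchor : ContMDiff (I.prod 𝓘(ℝ, Fib)) I.tangent ∞
    (fun v : TotalSpace Fib V => (⟨v.1, anchor v.1 v.2⟩ : TangentBundle I M))
  /-- The bracket on smooth sections. -/
  bracket : ContMDiffSection I Fib ∞ V →ₗ[ℝ] ContMDiffSection I Fib ∞ V →ₗ[ℝ]
    ContMDiffSection I Fib ∞ V
  bracket_self : ∀ a, bracket a a = 0
  jacobi : ∀ a b c,
    bracket a (bracket b c) = bracket (bracket a b) c + bracket b (bracket a c)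
  leibniz : ∀ (a b : ContMDiffSection I Fib ∞ V) (f : SmoothFn I M) (x : M),
    bracket a (smulSection f b) x =
      f x • bracket a b x + (mvfderiv I f x (anchor x (a x))) • b x
  anchor_bracket : ∀ (a b : ContMDiffSection I Fib ∞ V) (x : M),
    anchor x (bracket a b x) =
      VectorField.mlieBracket I (fun y => anchor y (a y)) (fun y => anchor y (b y)) x

attribute [instance] LieAlgebroid.normedAddCommGroup LieAlgebroid.normedSpace
  LieAlgebroid.finiteDimensional LieAlgebroid.topologicalSpaceTotal LieAlgebroid.addCommGroup
  LieAlgebroid.module LieAlgebroid.topologicalSpace LieAlgebroid.fiberBundle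
  LieAlgebroid.vectorBundle LieAlgebroid.contMDiffVectorBundle

namespace LieAlgebroid

variable {E : Type*} [NormedAddCommGroup E] [NormedSpace ℝ E]
  {H : Type*} [TopologicalSpace H] {I : ModelWithCorners ℝ E H}
  {M : Type*} [TopologicalSpace M] [ChartedSpace H M] [IsManifold I ∞ M]

/-- The smooth sections of a Lie algebroid. -/
abbrev Sec (A : LieAlgebroid I M) : Type _ := ContMDiffSection I A.Fib ∞ A.V

/-- The anchor on sections, `Γ(A) → 𝔛(M)`. -/
def anchorSec (A : LieAlgebroid I M) (a : A.Sec) : SmoothVF I M :=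
  ⟨fun x => A.anchor x (a x), A.contMDiff_anchor.comp a.contMDiff⟩

end LieAlgebroid

/-! ### Codimension-one foliations, their leaves, and morphisms out of them -/

section Foliations

variable {E : Type*} [NormedAddCommGroup E] [NormedSpace ℝ E]
  {H : Type*} [TopologicalSpace H] (I : ModelWithCorners ℝ E H)
  (N : Type*) [TopologicalSpace N] [ChartedSpace H N]

/-- A smooth codimension-one foliation of `N`, given by its tangent hyperplanes: locally they are
the kernels of the differential of a smooth submersion to `ℝ` (whose level sets are
the plaques). That they are closed under the bracket of vector fields is a consequence, and
recorded as a field. -/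
structure CodimOneFoliation [IsManifold I ∞ N] where
  /-- The tangent space of the foliation. -/
  tangent : ∀ q : N, Submodule ℝ (TangentSpace I q)
  exists_submersion : ∀ q₀ : N, ∃ U : Set N, IsOpen U ∧ q₀ ∈ U ∧ ∃ h : N → ℝ,
    ContMDiffOn I 𝓘(ℝ, ℝ) ∞ h U ∧
    ∀ q ∈ U, mvfderiv I h q ≠ 0 ∧ tangent q = LinearMap.ker (mvfderiv I h q).toLinearMap
  involutive : ∀ X Y : SmoothVF I N, (∀ q, X q ∈ tangent q) → (∀ q, Y q ∈ tangent q) →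
    ∀ q, VectorField.mlieBracket I X Y q ∈ tangent q

variable {I N}
variable [IsManifold I ∞ N]

/-- The smooth sections of the tangent bundle of a foliation. -/
def CodimOneFoliation.Sec (F : CodimOneFoliation I N) : Type _ :=
  {X : SmoothVF I N // ∀ q, X q ∈ F.tangent q}

/-- The value at a point of a section of the tangent bundle of a foliation. -/
def CodimOneFoliation.Sec.val {F : CodimOneFoliation I N} (X : F.Sec) (q : N) : F.tangent q :=
  ⟨X.1 q, X.2 q⟩

/-- The Lie algebroid bracket of a foliation (the Lie bracket of vector fields), pointwise. -/
def CodimOneFoliation.bracket (F : CodimOneFoliation I N) (X Y : F.Sec) (q : N) : F.tangent q :=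
  ⟨VectorField.mlieBracket I X.1 Y.1 q, F.involutive X.1 Y.1 X.2 Y.2 q⟩

/-- The leaf through `q`: all points that can be reached from `q` by a
concatenation of finitely many smooth curves tangent to the foliation. -/
def CodimOneFoliation.leaf (F : CodimOneFoliation I N) (q : N) : Set N :=
  {q' | Relation.ReflTransGen (fun a b : N => ∃ γ : ℝ → N, ContMDiff 𝓘(ℝ, ℝ) I ∞ γ ∧
    γ 0 = a ∧ γ 1 = b ∧ ∀ t : ℝ, mfderiv 𝓘(ℝ, ℝ) I γ t (1 : ℝ) ∈ F.tangent (γ t)) q q'}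

variable {E' : Type*} [NormedAddCommGroup E'] [NormedSpace ℝ E']
  {H' : Type*} [TopologicalSpace H'] {J : ModelWithCorners ℝ E' H'}
  {M : Type*} [TopologicalSpace M] [ChartedSpace H' M] [IsManifold J ∞ M]

/-- `Ψ` is a Lie algebroid morphism, covering `φ : N → M`, from the tangent Lie algebroid of the
foliation `F` of `N` (anchor: the inclusion; bracket: the Lie bracket of vector fields) to the Lie
algebroid `A` on `M`: a smooth bundle map commuting with the anchors and with
the brackets. As is usual for morphisms over different bases, the latter is expressed through
decompositions `Ψ ∘ X = ∑ fᵢ (aᵢ ∘ φ)` of images of sections, with `fᵢ ∈ C^∞(N)`, `aᵢ ∈ Γ(A)`. -/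
structure IsLieAlgebroidMorphism (F : CodimOneFoliation I N) (A : LieAlgebroid J M) (φ : N → M)
    (Ψ : ∀ q : N, F.tangent q →ₗ[ℝ] A.V (φ q)) : Prop where
  contMDiff_base : ContMDiff I J ∞ φ
  contMDiff : ∀ X : F.Sec, ContMDiff I (J.prod 𝓘(ℝ, A.Fib)) ∞
    (fun q => (⟨φ q, Ψ q (X.val q)⟩ : TotalSpace A.Fib A.V))
  anchor : ∀ (q : N) (v : F.tangent q),
    A.anchor (φ q) (Ψ q v) = mfderiv I J φ q (v : TangentSpace I q)
  bracket : ∀ (X Y : F.Sec) (r s : ℕ) (f : Fin r → SmoothFn I N) (g : Fin s → SmoothFn I N)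
    (a : Fin r → A.Sec) (b : Fin s → A.Sec),
    (∀ q, Ψ q (X.val q) = ∑ i, f i q • a i (φ q)) →
    (∀ q, Ψ q (Y.val q) = ∑ j, g j q • b j (φ q)) →
    ∀ q, Ψ q (F.bracket X Y q) =
      ∑ i, ∑ j, (f i q * g j q) • A.bracket (a i) (b j) (φ q)
      + ∑ j, lieDeriv X.1 (g j) q • b j (φ q)
      - ∑ i, lieDeriv Y.1 (f i) q • a i (φ q)

end Foliations

/-! ### Hypersurfaces, jets and `b^k`-tangent bundles -/

section Hypersurfaces

variable {E : Type*} [NormedAddCommGroup E] [NormedSpace ℝ E]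
  {H : Type*} [TopologicalSpace H] (I : ModelWithCorners ℝ E H)
  {M : Type*} [TopologicalSpace M] [ChartedSpace H M]

/-- `Z` is a (closed, embedded) hypersurface: near each of its points it is a
regular level set of a smooth function. -/
def IsHypersurface (Z : Set M) : Prop :=
  IsClosed Z ∧ ∀ p ∈ Z, ∃ U ∈ 𝓝 p, ∃ f : SmoothFn I M,
    mvfderiv I f p ≠ 0 ∧ ∀ x ∈ U, x ∈ Z ↔ f x = 0

/-- The ideal `I_Z` of smooth functions vanishing on `Z`. -/
def vanishingIdeal (Z : Set M) : Ideal (SmoothFn I M) where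
  carrier := {f | ∀ x ∈ Z, f x = 0}
  add_mem' := fun {f g} hf hg x hx => by
    change f x + g x = 0
    rw [hf x hx, hg x hx, add_zero]
  zero_mem' := fun _ _ => rfl
  smul_mem' := fun c f hf x hx => by
    change c x * f x = 0
    rw [hf x hx, mul_zero]

/-- The tangent space at `p ∈ Z` of a closed hypersurface `Z`: the tangent vectors that kill all
smooth functions vanishing on `Z`. -/
def tangentSpaceOf (Z : Set M) (p : M) : Set (TangentSpace I p) :=
  {v | ∀ f ∈ vanishingIdeal I Z, mvfderiv I f p v = 0}

/-- `Z` is coorientable: there is a smooth vector field that is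
nowhere tangent to `Z` along `Z`, i.e. the normal line bundle of `Z` is trivial. -/
def IsCoorientable [IsManifold I ∞ M] (Z : Set M) : Prop :=
  ∃ Y : SmoothVF I M, ∀ p ∈ Z, Y p ∉ tangentSpaceOf I Z p

/-- The space `J_Z^{k-1} = C^∞ / I_Z^k` of `(k-1)`-jets along `Z` (as `Z` is closed, each jet
is represented by a globally defined function). -/
abbrev JetAlong (Z : Set M) (k : ℕ) : Type _ := SmoothFn I M ⧸ (vanishingIdeal I Z) ^ k

/-- The `(k-1)`-jet along `Z` of a smooth function. -/
abbrev jetOf (Z : Set M) (k : ℕ) (f : SmoothFn I M) : JetAlong I Z k :=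
  Ideal.Quotient.mk ((vanishingIdeal I Z) ^ k) f

variable {I}

/-- The jet `j ∈ J_Z^{k-1}` has vanishing zero-jet and, if `k ≥ 2`, nowhere vanishing first jet.
For `k = 1` this says `j = 0`, so that `j` carries no information. -/
def IsAdmissibleJet {Z : Set M} {k : ℕ} (j : JetAlong I Z k) : Prop :=
  ∀ f : SmoothFn I M, jetOf I Z k f = j →
    f ∈ vanishingIdeal I Z ∧ (2 ≤ k → ∀ p ∈ Z, mvfderiv I f p ≠ 0)

variable [IsManifold I ∞ M]

/-- The vector fields `X` with `L_X f ∈ I_Z^k` for all `f` in the jet `j`. -/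
def bkVectorFields {Z : Set M} {k : ℕ} (j : JetAlong I Z k) : Set (SmoothVF I M) :=
  {X | ∀ f : SmoothFn I M, jetOf I Z k f = j → lieDeriv X f ∈ (vanishingIdeal I Z) ^ k}

/-- `A` is the `b^k`-tangent bundle determined by `Z` and `j`: the Lie algebroid whose sections are,
via the anchor, the vector fields `X` with `L_X f ∈ I_Z^k` for all `f ∈ j`. This determines
`A` up to unique isomorphism. -/
def IsBkTangentBundle {Z : Set M} {k : ℕ} (j : JetAlong I Z k) (A : LieAlgebroid I M) : Prop :=
  Function.Injective A.anchorSec ∧ range A.anchorSec = bkVectorFields j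

end Hypersurfaces

/-! ### Regularisations on `M × S¹` -/

/-- The invariant one-form `ds` on the unit circle: `ds_w(v) = Im (w̄ v)`, that is, the differential
of the angle `s` in `w = e^{is}`. -/
def circleForm (w : Circle) : TangentSpace (𝓡 1) w →L[ℝ] ℝ :=
  Complex.imCLM ∘L (ContinuousLinearMap.mul ℝ ℂ (starRingEnd ℂ (w : ℂ))) ∘L
    mvfderiv (𝓡 1) (fun u : Circle => (u : ℂ)) w

section Regularisation

variable {E : Type*} [NormedAddCommGroup E] [NormedSpace ℝ E]
  {H : Type*} [TopologicalSpace H] {I : ModelWithCorners ℝ E H}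
  {M : Type*} [TopologicalSpace M] [ChartedSpace H M]

/-- The pullback of `ds` to `M × S¹`. -/
def dsForm (I : ModelWithCorners ℝ E H) (q : M × Circle) :
    TangentSpace (I.prod (𝓡 1)) q →L[ℝ] ℝ :=
  circleForm q.2 ∘L mfderiv (I.prod (𝓡 1)) (𝓡 1) (Prod.snd : M × Circle → Circle) q

/-- The one-form `χ(z) dz + z^k ds` on `M × S¹`. -/
def bkForm (z : SmoothFn I M) (χ : ℝ → ℝ) (k : ℕ) (q : M × Circle) :
    TangentSpace (I.prod (𝓡 1)) q →L[ℝ] ℝ :=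
  χ (z q.1) • (mvfderiv I z q.1 ∘L
    mfderiv (I.prod (𝓡 1)) I (Prod.fst : M × Circle → M) q) + (z q.1) ^ k • dsForm I q

/-- The translation of `M × S¹` by `w ∈ S¹`. -/
def translate (w : Circle) (q : M × Circle) : M × Circle := (q.1, w * q.2)

variable [IsManifold I ∞ M]

/-- The foliation is invariant under the translations in the `S¹`-factor. -/
def IsCircleInvariant (F : CodimOneFoliation (I.prod (𝓡 1)) (M × Circle)) : Prop :=
  ∀ (w : Circle) (q : M × Circle),
    (F.tangent q).map (mfderiv (I.prod (𝓡 1)) (I.prod (𝓡 1)) (translate w) q).toLinearMap =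
      F.tangent (translate w q)

/-- The foliation is built from `χ(z) dz + z^k ds`: on `U × S¹`, with `U` an open
neighbourhood of `Z` on which `z` is a defining function of `Z` with jet `j`, it is the kernel of
this form, where `χ` is a cut-off function with `χ = 1` near `0` such that `χ(z)` vanishes
near the boundary of `U`; elsewhere it is the kernel of `ds`. -/
def IsBuiltFromForm {Z : Set M} {k : ℕ} (j : JetAlong I Z k)
    (F : CodimOneFoliation (I.prod (𝓡 1)) (M × Circle)) : Prop :=
  ∃ (U : Set M) (z : SmoothFn I M) (χ : ℝ → ℝ),
    IsOpen U ∧ Z ⊆ U ∧ (∀ x ∈ U, x ∈ Z ↔ z x = 0) ∧ (∀ p ∈ Z, mvfderiv I z p ≠ 0) ∧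
    jetOf I Z k z = j ∧
    ContDiff ℝ ∞ χ ∧ (∀ᶠ t in 𝓝 0, χ t = 1) ∧ closure {x ∈ U | χ (z x) ≠ 0} ⊆ U ∧
    ∀ q : M × Circle,
      (q.1 ∈ U → F.tangent q = LinearMap.ker (bkForm z χ k q).toLinearMap) ∧
      (q.1 ∉ U → F.tangent q = LinearMap.ker (dsForm I q).toLinearMap)

/-- The leaves meeting `Z × S¹` are exactly the connected components of `Z × S¹`. -/
def HasCentralLeaves (Z : Set M) (F : CodimOneFoliation (I.prod (𝓡 1)) (M × Circle)) : Prop :=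
  ∀ q : M × Circle, q.1 ∈ Z → F.leaf q = connectedComponentIn (Z ×ˢ univ) q

/-- Outside `Z × S¹` the foliation is transverse to the `S¹`-direction, and each leaf is the
graph of a smooth map `C → S¹` defined on a connected component `C` of `M ∖ Z`. -/
def HasGraphicalLeaves (Z : Set M) (F : CodimOneFoliation (I.prod (𝓡 1)) (M × Circle)) : Prop :=
  ∀ q : M × Circle, q.1 ∉ Z →
    F.tangent q ⊓ LinearMap.ker
      (mfderiv (I.prod (𝓡 1)) I (Prod.fst : M × Circle → M) q).toLinearMap = ⊥ ∧
    ∃ g : M → Circle, ContMDiffOn I (𝓡 1) ∞ g (connectedComponentIn Zᶜ q.1) ∧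
      F.leaf q = {q' | q'.1 ∈ connectedComponentIn Zᶜ q.1 ∧ q'.2 = g q'.1}

end Regularisation

end BkRegularisation

end

noncomputable section

namespace BkRegularisation

set_option linter.unusedSectionVars false

section Calculus

variable {E : Type*} [NormedAddCommGroup E] [NormedSpace ℝ E]
  {H : Type*} [TopologicalSpace H] {I : ModelWithCorners ℝ E H}
  {M : Type*} [TopologicalSpace M] [ChartedSpace H M]

theorem SmoothFn.mdifferentiableAt (f : SmoothFn I M) (x : M) :
    MDifferentiableAt I 𝓘(ℝ, ℝ) f x :=
  f.contMDiff.mdifferentiableAt (by simp)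

theorem mvfderiv_congr {E₀ : Type*} [NormedAddCommGroup E₀] [NormedSpace ℝ E₀] {f g : M → E₀}
    {x : M} (h : f =ᶠ[𝓝 x] g) :
    mvfderiv I f x = mvfderiv I g x := by
  ext v
  exact congrArg (fun L : TangentSpace I x →L[ℝ] E₀ => L v) h.mfderiv_eq

variable [IsManifold I ∞ M]

theorem SmoothVF.mdifferentiableAt (X : SmoothVF I M) (x : M) :
    MDiffAt (fun y => (X y : TangentBundle I M)) x :=
  X.contMDiff.mdifferentiableAt (by simp)

theorem lieDeriv_apply (X : SmoothVF I M) (f : SmoothFn I M) (x : M) :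
    lieDeriv X f x = mvfderiv I f x (X x) := rfl

theorem smulSection_apply (f : SmoothFn I M) (X : SmoothVF I M) (x : M) :
    smulSection f X x = f x • X x := rfl

theorem lieDeriv_add (X : SmoothVF I M) (f g : SmoothFn I M) :
    lieDeriv X (f + g) = lieDeriv X f + lieDeriv X g := by
  ext x
  simp [lieDeriv_apply, mvfderiv_add (f.mdifferentiableAt x) (g.mdifferentiableAt x)]

theorem lieDeriv_sub (X : SmoothVF I M) (f g : SmoothFn I M) :
    lieDeriv X (f - g) = lieDeriv X f - lieDeriv X g := by
  ext x
  simp [lieDeriv_apply, mvfderiv_sub (f.mdifferentiableAt x) (g.mdifferentiableAt x)]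

theorem lieDeriv_mul (X : SmoothVF I M) (f g : SmoothFn I M) :
    lieDeriv X (f * g) = f * lieDeriv X g + g * lieDeriv X f := by
  ext x
  simp [lieDeriv_apply, mvfderiv_mul (f.mdifferentiableAt x) (g.mdifferentiableAt x)]

theorem lieDeriv_smulSection (h : SmoothFn I M) (X : SmoothVF I M) (f : SmoothFn I M) :
    lieDeriv (smulSection h X) f = h * lieDeriv X f := by
  ext x
  simp [lieDeriv_apply, smulSection_apply]

theorem lieDeriv_add_left (X Y : SmoothVF I M) (f : SmoothFn I M) :
    lieDeriv (X + Y) f = lieDeriv X f + lieDeriv Y f := by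
  ext x
  simp [lieDeriv_apply]

instance isManifold_minSmoothness_three : IsManifold I (minSmoothness ℝ 3) M := by
  rw [minSmoothness_of_isRCLikeNormedField]
  exact IsManifold.of_le (n := ∞) ENat.LEInfty.out

instance isManifold_minSmoothness_two : IsManifold I (minSmoothness ℝ 2) M := by
  rw [minSmoothness_of_isRCLikeNormedField]
  exact IsManifold.of_le (n := ∞) ENat.LEInfty.out

/-- The Lie bracket of smooth vector fields, as a smooth vector field. -/
def bracketVF [CompleteSpace E] (X Y : SmoothVF I M) : SmoothVF I M :=
  ⟨VectorField.mlieBracket I X Y,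
    haveI : IsManifold I (((⊤ : ℕ∞) : ℕ∞ω) + 1) M := by simpa using ‹IsManifold I ∞ M›
    ContDiff.mlieBracket_vectorField (n := ⊤) (m := ⊤) X.contMDiff Y.contMDiff (by simp)⟩

theorem bracketVF_apply [CompleteSpace E] (X Y : SmoothVF I M) (x : M) :
    bracketVF X Y x = VectorField.mlieBracket I X Y x := rfl

open VectorField in
theorem mvfderiv_eq_fderiv_mpullback [I.Boundaryless] {x : M} {y : E}
    (hy : y ∈ (extChartAt I x).target) {f : M → ℝ}
    (hf : MDifferentiableAt I 𝓘(ℝ, ℝ) f ((extChartAt I x).symm y))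
    (X : ∀ x : M, TangentSpace I x) :
    mvfderiv I f ((extChartAt I x).symm y) (X ((extChartAt I x).symm y)) =
      fderiv ℝ (f ∘ (extChartAt I x).symm) y
        (mpullbackWithin 𝓘(ℝ, E) I (extChartAt I x).symm X (range I) y) := by
  have hinv := isInvertible_mfderivWithin_extChartAt_symm (I := I) hy
  have hd := mdifferentiableWithinAt_extChartAt_symm (I := I) hy
  rw [I.range_eq_univ] at *
  rw [mfderivWithin_univ] at hinv
  rw [mdifferentiableWithinAt_univ] at hd
  rw [mpullbackWithin_apply, mfderivWithin_univ]
  have h := mvfderiv_comp_apply (I := I) (I' := 𝓘(ℝ, E)) y hf hd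
    ((mfderiv 𝓘(ℝ, E) I (extChartAt I x).symm y).inverse (X ((extChartAt I x).symm y)))
  rw [hinv.self_apply_inverse] at h
  rw [← h]
  simp only [mvfderiv, mfderiv_eq_fderiv]
  rfl

theorem mvfderiv_eq_fderiv_comp_mfderiv_extChartAt [I.Boundaryless] (f : SmoothFn I M) (x : M)
    (v : TangentSpace I x) :
    mvfderiv I f x v = fderiv ℝ (f ∘ (extChartAt I x).symm) (extChartAt I x x)
      (mfderiv I 𝓘(ℝ, E) (extChartAt I x) x v) := by
  have hd := mdifferentiableWithinAt_extChartAt_symm (I := I) (mem_extChartAt_target x)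
  rw [I.range_eq_univ, mdifferentiableWithinAt_univ] at hd
  have hc : MDifferentiableAt 𝓘(ℝ, E) 𝓘(ℝ, ℝ) (f ∘ (extChartAt I x).symm) (extChartAt I x x) :=
    (f.mdifferentiableAt _).comp _ hd
  have h := mvfderiv_comp_apply (I := 𝓘(ℝ, E)) (I' := I) x hc
    (mdifferentiableAt_extChartAt (mem_chart_source H x)) v
  have h2 : (f ∘ (extChartAt I x).symm) ∘ extChartAt I x =ᶠ[𝓝 x] f := by
    filter_upwards [extChartAt_source_mem_nhds (I := I) x] with y hy
    exact congrArg f ((extChartAt I x).left_inv hy)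
  rw [mvfderiv_congr h2] at h
  rw [h]
  simp only [mvfderiv, mfderiv_eq_fderiv]
  rfl

theorem contDiffAt_comp_extChartAt_symm [I.Boundaryless] (f : SmoothFn I M) {x : M} {y : E}
    (hy : y ∈ (extChartAt I x).target) : ContDiffAt ℝ ∞ (f ∘ (extChartAt I x).symm) y := by
  have h := contMDiffWithinAt_extChartAt_symm_range (I := I) (n := ∞) x hy
  rw [I.range_eq_univ, contMDiffWithinAt_univ] at h
  exact (f.contMDiff.contMDiffAt.comp y h).contDiffAt

open VectorField in
theorem lieDeriv_bracketVF [I.Boundaryless] [CompleteSpace E] (X Y : SmoothVF I M)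
    (f : SmoothFn I M) :
    lieDeriv (bracketVF X Y) f = lieDeriv X (lieDeriv Y f) - lieDeriv Y (lieDeriv X f) := by
  ext x
  set φ := extChartAt I x with hφ
  set a := φ x with ha
  have hat : a ∈ φ.target := mem_extChartAt_target x
  have hxa : φ.symm a = x := extChartAt_to_inv x
  set V : E → E := mpullbackWithin 𝓘(ℝ, E) I φ.symm X (range I) with hV
  set W : E → E := mpullbackWithin 𝓘(ℝ, E) I φ.symm Y (range I) with hW
  have hVd : DifferentiableAt ℝ V a := by
    have : DifferentiableWithinAt ℝ V (φ.symm ⁻¹' univ ∩ range I) a := (mdifferentiableWithinAt_univ.2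
      (X.mdifferentiableAt x)).differentiableWithinAt_mpullbackWithin_vectorField
    rwa [preimage_univ, univ_inter, I.range_eq_univ, differentiableWithinAt_univ] at this
  have hWd : DifferentiableAt ℝ W a := by
    have : DifferentiableWithinAt ℝ W (φ.symm ⁻¹' univ ∩ range I) a := (mdifferentiableWithinAt_univ.2
      (Y.mdifferentiableAt x)).differentiableWithinAt_mpullbackWithin_vectorField
    rwa [preimage_univ, univ_inter, I.range_eq_univ, differentiableWithinAt_univ] at this
  set F : E → ℝ := f ∘ φ.symm with hF
  have hFs : ContDiffAt ℝ ∞ F a := contDiffAt_comp_extChartAt_symm f hat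
  have hFd : DifferentiableAt ℝ (fderiv ℝ F) a :=
    (hFs.fderiv_right (m := 1) (by rw [one_add_one_eq_two]; exact ENat.LEInfty.out)).differentiableAt one_ne_zero
  have hsymm : IsSymmSndFDerivAt ℝ F a :=
    hFs.isSymmSndFDerivAt (by
      rw [minSmoothness_of_isRCLikeNormedField]; exact ENat.LEInfty.out)
  have key : ∀ (g : SmoothFn I M) (X : SmoothVF I M) {y : E}, y ∈ φ.target →
      lieDeriv X g (φ.symm y) = fderiv ℝ (g ∘ φ.symm) y
        (mpullbackWithin 𝓘(ℝ, E) I φ.symm X (range I) y) :=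
    fun g X y hy => mvfderiv_eq_fderiv_mpullback hy (g.mdifferentiableAt _) X
  have ht : φ.target ∈ 𝓝 a := extChartAt_target_mem_nhds x
  have second : ∀ (X Y : SmoothVF I M) {V W : E → E},
      mpullbackWithin 𝓘(ℝ, E) I φ.symm X (range I) = V →
      mpullbackWithin 𝓘(ℝ, E) I φ.symm Y (range I) = W → DifferentiableAt ℝ W a →
      lieDeriv X (lieDeriv Y f) x =
        fderiv ℝ (fderiv ℝ F) a (V a) (W a) + fderiv ℝ F a (fderiv ℝ W a (V a)) := by
    rintro X Y V W rfl hW hWd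
    have h1 : (lieDeriv Y f) ∘ φ.symm =ᶠ[𝓝 a] fun y => fderiv ℝ F y (W y) := by
      filter_upwards [ht] with y hy
      rw [← hW]
      exact key f Y hy
    have h2 := key (lieDeriv Y f) X hat
    rw [hxa, h1.fderiv_eq, (hFd.hasFDerivAt.clm_apply hWd.hasFDerivAt).fderiv] at h2
    rw [h2]
    exact add_comm _ _
  have first : lieDeriv (bracketVF X Y) f x = fderiv ℝ F a (lieBracket ℝ V W a) := by
    set w : E := lieBracket ℝ V W a with hw
    have e := (isInvertible_mfderiv_extChartAt (I := I)
      (mem_extChartAt_source x)).self_apply_inverse w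
    have e2 : bracketVF X Y x =
        (mfderiv I 𝓘(ℝ, E) (extChartAt I x) x).inverse w := by
      rw [bracketVF_apply, ← mlieBracketWithin_univ, mlieBracketWithin_apply, ← hφ,
        preimage_univ, univ_inter, hw, hV, hW, I.range_eq_univ]
      exact congrArg _ (congrFun lieBracketWithin_univ _)
    rw [lieDeriv_apply, mvfderiv_eq_fderiv_comp_mfderiv_extChartAt, e2]
    exact congrArg (fderiv ℝ F a) e
  change lieDeriv (bracketVF X Y) f x = lieDeriv X (lieDeriv Y f) x - lieDeriv Y (lieDeriv X f) x
  rw [first, second X Y hV.symm hW.symm hWd, second Y X hW.symm hV.symm hVd, lieBracket_eq,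
    hsymm.eq (V a) (W a), map_sub]
  ring

end Calculus

section Extension

variable {E : Type*} [NormedAddCommGroup E] [NormedSpace ℝ E] [FiniteDimensional ℝ E]
  {H : Type*} [TopologicalSpace H] {I : ModelWithCorners ℝ E H}
  {M : Type*} [TopologicalSpace M] [ChartedSpace H M] [IsManifold I ∞ M]
  [T2Space M] [SigmaCompactSpace M]

/-- A local smooth section agrees near each point with a global one. -/
theorem exists_section_eventuallyEq {F : Type*} [NormedAddCommGroup F] [NormedSpace ℝ F]
    {V : M → Type*} [TopologicalSpace (TotalSpace F V)] [∀ x, AddCommGroup (V x)]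
    [∀ x, Module ℝ (V x)] [∀ x, TopologicalSpace (V x)] [FiberBundle F V] [VectorBundle ℝ F V]
    {x : M} {U : Set M} (hU : U ∈ 𝓝 x) {s : ∀ y, V y}
    (hs : ContMDiffOn I (I.prod 𝓘(ℝ, F)) ∞ (fun y => TotalSpace.mk' F y (s y)) U) :
    ∃ t : ContMDiffSection I F ∞ V, ∀ᶠ y in 𝓝 x, t y = s y := by
  have : LocallyCompactSpace M := Manifold.locallyCompact_of_finiteDimensional I
  obtain ⟨K, hK, hKc, hKU⟩ := exists_mem_nhds_isClosed_subset (interior_mem_nhds.2 hU)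
  obtain ⟨t, ht⟩ := exists_contMDiffSection_forall_mem_convex_of_local (n := ⊤) I V
    (fun y => {v | y ∈ K → v = s y}) (fun y => by
      by_cases hy : y ∈ K
      · simp [hy]
      · simp [hy, convex_univ]) (fun y => by
      by_cases hy : y ∈ K
      · exact ⟨interior U, isOpen_interior.mem_nhds (hKU hy), s, hs.mono interior_subset,
          fun z _ _ => rfl⟩
      · refine ⟨Kᶜ, hKc.isOpen_compl.mem_nhds hy, fun _ => 0, ?_, fun z hz hz' => absurd hz' hz⟩
        exact (contMDiff_zeroSection ℝ V).contMDiffOn)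
  exact ⟨t, by filter_upwards [hK] with y hy using ht y hy⟩

/-- A local smooth function agrees near each point with a global one. -/
theorem exists_smoothFn_eventuallyEq {x : M} {U : Set M} (hU : U ∈ 𝓝 x) {f : M → ℝ}
    (hf : ContMDiffOn I 𝓘(ℝ, ℝ) ∞ f U) : ∃ g : SmoothFn I M, g =ᶠ[𝓝 x] f := by
  have : LocallyCompactSpace M := Manifold.locallyCompact_of_finiteDimensional I
  obtain ⟨K, hK, hKc, hKU⟩ := exists_mem_nhds_isClosed_subset (interior_mem_nhds.2 hU)
  obtain ⟨g, hg⟩ := exists_contMDiffMap_forall_mem_convex_of_local (n := ⊤) I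
    (t := fun y => {v | y ∈ K → v = f y}) (fun y => by
      by_cases hy : y ∈ K
      · simp [hy]
      · simp [hy, convex_univ]) (fun y => by
      by_cases hy : y ∈ K
      · exact ⟨interior U, isOpen_interior.mem_nhds (hKU hy), f, hf.mono interior_subset,
          fun z _ _ => rfl⟩
      · exact ⟨Kᶜ, hKc.isOpen_compl.mem_nhds hy, fun _ => 0, contMDiffOn_const,
          fun z hz hz' => absurd hz' hz⟩)
  exact ⟨g, by filter_upwards [hK] with y hy using hg y hy⟩

/-- A smooth function equal to one near `x` and supported in a given neighbourhood. -/
theorem exists_bump {x : M} {U : Set M} (hU : U ∈ 𝓝 x) :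
    ∃ φ : SmoothFn I M, (∀ᶠ y in 𝓝 x, φ y = 1) ∧ ∀ y, y ∉ U → φ y = 0 := by
  have : LocallyCompactSpace M := Manifold.locallyCompact_of_finiteDimensional I
  obtain ⟨K, hK, hKc, hKU⟩ := exists_mem_nhds_isClosed_subset (interior_mem_nhds.2 hU)
  obtain ⟨φ, h0, h1, -⟩ := exists_contMDiffMap_zero_one_of_isClosed (n := ⊤) I
    (isOpen_interior (s := U)).isClosed_compl hKc (disjoint_compl_left_iff_subset.2 hKU)
  refine ⟨φ, by filter_upwards [hK] with y hy using h1 hy, fun y hy => h0 fun h => ?_⟩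
  exact hy (interior_subset h)

/-- Smooth functions and vector fields that are coordinates, and their frame, near a point. -/
theorem exists_coordinates [I.Boundaryless] (x : M) :
    ∃ (c : Fin (Module.finrank ℝ E) → SmoothFn I M)
      (e : Fin (Module.finrank ℝ E) → SmoothVF I M),
      ∀ᶠ y in 𝓝 x, ∀ v : TangentSpace I y, v = ∑ i, mvfderiv I (c i) y v • e i y := by
  set b := Module.finBasis ℝ E
  set τ := trivializationAt E (TangentSpace I : M → Type _) x
  have hx : x ∈ τ.baseSet := mem_baseSet_trivializationAt _ _ _
  have hτ : τ.baseSet = (chartAt H x).source := rfl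
  have hc : ∀ i, ∃ g : SmoothFn I M, g =ᶠ[𝓝 x] fun y => b.coord i (extChartAt I x y) := fun i =>
    exists_smoothFn_eventuallyEq (extChartAt_source_mem_nhds (I := I) x) (by
      have h := contMDiffOn_extChartAt (I := I) (n := ∞) (x := x)
      rw [← extChartAt_source I] at h
      exact ((LinearMap.toContinuousLinearMap (b.coord i)).contMDiff).comp_contMDiffOn h)
  have he : ∀ i, ∃ X : SmoothVF I M, ∀ᶠ y in 𝓝 x, X y = τ.localFrame b i y := fun i =>
    exists_section_eventuallyEq (τ.open_baseSet.mem_nhds hx)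
      (τ.contMDiffOn_localFrame_baseSet (I := I) ∞ b i)
  choose c hc using hc
  choose e he using he
  refine ⟨c, e, ?_⟩
  filter_upwards [eventually_all.2 fun i => (hc i).eventually_nhds, eventually_all.2 he,
    τ.open_baseSet.mem_nhds hx] with y hcy hey hy v
  refine ((τ.basisAt b hy).sum_repr v).symm.trans (Finset.sum_congr rfl fun i _ => ?_)
  rw [hey i, τ.localFrame_apply_of_mem_baseSet b hy, mvfderiv_congr (hcy i)]
  congr 1
  have h1 : (τ.basisAt b hy).repr v i = b.coord i (τ.continuousLinearMapAt ℝ y v) := by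
    rw [Trivialization.basisAt, Module.Basis.map_repr]
    simp [Trivialization.continuousLinearMapAt_apply, Trivialization.linearMapAt_apply, hy]
  rw [h1, TangentBundle.continuousLinearMapAt_trivializationAt (hτ ▸ hy)]
  have hL := ((LinearMap.toContinuousLinearMap (b.coord i)).mdifferentiableAt
    (x := extChartAt I x y))
  have h2 := mvfderiv_comp_apply (I := 𝓘(ℝ, E)) (I' := I) y hL
    (mdifferentiableAt_extChartAt (I := I) (hτ ▸ hy)) v
  refine Eq.trans ?_ h2.symm
  simp only [mvfderiv, mfderiv_eq_fderiv, ContinuousLinearMap.fderiv]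
  rfl

theorem eq_of_forall_mvfderiv_eq [I.Boundaryless] {x : M} {v w : TangentSpace I x}
    (h : ∀ f : SmoothFn I M, mvfderiv I f x v = mvfderiv I f x w) : v = w := by
  obtain ⟨c, e, hce⟩ := exists_coordinates (I := I) x
  rw [hce.self_of_nhds v, hce.self_of_nhds w]
  simp [h]

end Extension

section ParametricIntegral

variable {E F : Type} [NormedAddCommGroup E] [NormedSpace ℝ E] [FiniteDimensional ℝ E]
  [NormedAddCommGroup F] [NormedSpace ℝ F]

theorem hasFDerivAt_parametric_integral [CompleteSpace F] {φ : E × ℝ → F} (hφ : ContDiff ℝ 1 φ)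
    (y : E) : HasFDerivAt (fun y => ∫ t in (0 : ℝ)..1, φ (y, t))
      (∫ t in (0 : ℝ)..1, (fderiv ℝ φ (y, t)).comp (ContinuousLinearMap.inl ℝ E ℝ)) y := by
  have : ProperSpace E := FiniteDimensional.proper ℝ E
  have hcont : Continuous fun p : E × ℝ =>
      (fderiv ℝ φ p).comp (ContinuousLinearMap.inl ℝ E ℝ) :=
    (hφ.continuous_fderiv one_ne_zero).clm_comp continuous_const
  obtain ⟨C, hC⟩ := ((isCompact_closedBall y 1).prod (isCompact_Icc (a := (0 : ℝ)) (b := 1))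
    ).exists_bound_of_continuousOn hcont.continuousOn
  refine intervalIntegral.hasFDerivAt_integral_of_dominated_of_fderiv_le (s := Metric.ball y 1)
    (F := fun y t => φ (y, t)) (bound := fun _ => C)
    (F' := fun y t => (fderiv ℝ φ (y, t)).comp (ContinuousLinearMap.inl ℝ E ℝ))
    (Metric.ball_mem_nhds y one_pos) ?_ ?_ ?_ ?_ ?_ ?_
  · exact Eventually.of_forall fun z =>
      (hφ.continuous.comp (Continuous.prodMk_right z)).aestronglyMeasurable
  · exact (hφ.continuous.comp (Continuous.prodMk_right y)).intervalIntegrable _ _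
  · exact (hcont.comp (Continuous.prodMk_right y)).aestronglyMeasurable
  · refine Eventually.of_forall fun t ht z hz => hC (z, t) ⟨Metric.ball_subset_closedBall hz, ?_⟩
    rw [uIoc_of_le zero_le_one] at ht
    exact Ioc_subset_Icc_self ht
  · exact intervalIntegrable_const
  · refine Eventually.of_forall fun t _ z _ => ?_
    have h1 : HasFDerivAt φ (fderiv ℝ φ (z, t)) (z, t) :=
      (hφ.differentiable one_ne_zero _).hasFDerivAt
    exact h1.comp z (hasFDerivAt_prodMk_left z t)

theorem contDiff_parametric_integral [CompleteSpace F] {φ : E × ℝ → F} (hφ : ContDiff ℝ ∞ φ) :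
    ContDiff ℝ ∞ fun y => ∫ t in (0 : ℝ)..1, φ (y, t) := by
  rw [contDiff_infty]
  intro n
  induction n generalizing F with
  | zero =>
    rw [Nat.cast_zero, contDiff_zero, continuous_iff_continuousAt]
    exact fun y => (hasFDerivAt_parametric_integral (hφ.of_le (by simp)) y).continuousAt
  | succ n ih =>
    have hd := hasFDerivAt_parametric_integral (hφ.of_le (m := 1) (by simp))
    rw [Nat.cast_succ, contDiff_succ_iff_fderiv]
    refine ⟨fun y => (hd y).differentiableAt, by simp, ?_⟩
    rw [funext fun y => (hd y).fderiv]
    exact ih (φ := fun p => (fderiv ℝ φ p).comp (ContinuousLinearMap.inl ℝ E ℝ))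
      ((hφ.fderiv_right (by simp)).clm_comp contDiff_const)

/-- Hadamard's lemma: a smooth function vanishing on a hyperplane near one of its points is
divisible, near that point, by the linear form defining the hyperplane. -/
theorem exists_eq_linear_mul {f : E → ℝ} (hf : ContDiff ℝ ∞ f) {l : E →L[ℝ] ℝ} (hl : l ≠ 0)
    {b : E} (hb : l b = 0) (h0 : ∀ᶠ y in 𝓝 b, l y = 0 → f y = 0) :
    ∃ g : E → ℝ, ContDiff ℝ ∞ g ∧ ∀ᶠ y in 𝓝 b, f y = l y * g y := by
  obtain ⟨e, he⟩ : ∃ e, l e = 1 := by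
    obtain ⟨v, hv⟩ := DFunLike.ne_iff.1 hl
    exact ⟨(l v)⁻¹ • v, by simpa using inv_mul_cancel₀ hv⟩
  refine ⟨fun y => ∫ t in (0 : ℝ)..1, fderiv ℝ f (y - ((1 - t) * l y) • e) e, ?_, ?_⟩
  · refine contDiff_parametric_integral
      (φ := fun p : E × ℝ => fderiv ℝ f (p.1 - ((1 - p.2) * l p.1) • e) e) ?_
    have h1 : ContDiff ℝ ∞ (fderiv ℝ f) := hf.fderiv_right (by simp)
    exact (h1.comp (by fun_prop)).clm_apply contDiff_const
  · have hpt : Tendsto (fun y => y - l y • e) (𝓝 b) (𝓝 b) := by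
      have : Continuous fun y => y - l y • e := by fun_prop
      simpa [hb] using this.tendsto b
    filter_upwards [hpt.eventually h0] with y hy
    have hd : ∀ t ∈ uIcc (0 : ℝ) 1, HasDerivAt (fun t => f (y - ((1 - t) * l y) • e))
        (l y * fderiv ℝ f (y - ((1 - t) * l y) • e) e) t := by
      intro t _
      have h1 : HasDerivAt (fun t : ℝ => y - ((1 - t) * l y) • e) (l y • e) t := by
        have := (((hasDerivAt_id t).const_sub 1).mul_const (l y)).smul_const e |>.const_sub y
        simpa using this
      have h2 := (hf.differentiable (by simp)
        (y - ((1 - t) * l y) • e)).hasFDerivAt.comp_hasDerivAt t h1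
      rw [map_smul, smul_eq_mul] at h2
      exact h2
    have hi := intervalIntegral.integral_eq_sub_of_hasDerivAt hd
      (Continuous.intervalIntegrable (by
        have := hf.continuous_fderiv (by simp)
        fun_prop) _ _)
    have h3 : f (y - l y • e) = 0 := hy (by simp [he])
    simp only [sub_self, zero_mul, zero_smul, sub_zero, one_mul, h3,
      intervalIntegral.integral_const_mul] at hi
    exact hi.symm

end ParametricIntegral

section Straightening

variable {E : Type} [NormedAddCommGroup E] [NormedSpace ℝ E] [FiniteDimensional ℝ E]
  {H : Type*} [TopologicalSpace H] {I : ModelWithCorners ℝ E H} [I.Boundaryless]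
  {M : Type*} [TopologicalSpace M] [ChartedSpace H M] [IsManifold I ∞ M]

/-- Near a regular point, a smooth function is linear in suitable coordinates `θ`, with inverse
`σ`. -/
theorem exists_straightening (z : SmoothFn I M) {p : M} (hz : mvfderiv I z p ≠ 0) {W : Set M}
    (hW : W ∈ 𝓝 p) :
    ∃ (l : E →L[ℝ] ℝ) (θ : M → E) (σ : E → M) (r : ℝ) (O : Set M), l ≠ 0 ∧ 0 < r ∧
      IsOpen O ∧ p ∈ O ∧ ContMDiffOn I 𝓘(ℝ, E) ∞ θ O ∧
      ContMDiffOn 𝓘(ℝ, E) I ∞ σ (Metric.ball (θ p) r) ∧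
      (∀ x ∈ O, θ x ∈ Metric.ball (θ p) r ∧ σ (θ x) = x) ∧
      ∀ y ∈ Metric.ball (θ p) r, σ y ∈ W ∧ z (σ y) = l y := by
  have : CompleteSpace E := FiniteDimensional.complete ℝ E
  set φ := extChartAt I p with hφ
  set a := φ p with ha
  have hφt : IsOpen φ.target := isOpen_extChartAt_target p
  have hat : a ∈ φ.target := mem_extChartAt_target p
  have hsymm : ContMDiffOn 𝓘(ℝ, E) I ∞ φ.symm φ.target := contMDiffOn_extChartAt_symm p
  obtain ⟨zh, hzh⟩ := exists_smoothFn_eventuallyEq (I := 𝓘(ℝ, E)) (hφt.mem_nhds hat)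
    (f := z ∘ φ.symm) (z.contMDiff.comp_contMDiffOn hsymm)
  have hzs : ContDiff ℝ ∞ zh := zh.contMDiff.contDiff
  set l := fderiv ℝ zh a with hl
  have hl0 : l ≠ 0 := by
    intro h
    apply hz
    ext v
    rw [mvfderiv_eq_fderiv_comp_mfderiv_extChartAt, ← hφ, ← ha, ← hzh.fderiv_eq, ← hl, h]
    rfl
  obtain ⟨e, he⟩ : ∃ e, l e = 1 := by
    obtain ⟨v, hv⟩ := DFunLike.ne_iff.1 hl0
    exact ⟨(l v)⁻¹ • v, by simpa using inv_mul_cancel₀ hv⟩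
  set Φ : E → E := fun y => y + (zh y - l y) • e with hΦ
  have hΦs : ContDiff ℝ ∞ Φ := by fun_prop
  have hΦd : HasFDerivAt Φ ((ContinuousLinearEquiv.refl ℝ E : E ≃L[ℝ] E) : E →L[ℝ] E) a := by
    have h1 : HasFDerivAt zh l a := (hzs.differentiable (by simp) a).hasFDerivAt
    have h2 := (hasFDerivAt_id (𝕜 := ℝ) a).add ((h1.sub l.hasFDerivAt).smul_const e)
    refine h2.congr_fderiv ?_
    ext v
    simp
  have hlΦ : ∀ y, l (Φ y) = zh y := fun y => by simp [hΦ, he]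
  set Θ := hΦs.contDiffAt.toOpenPartialHomeomorph Φ hΦd (by simp) with hΘ
  have hΘa : a ∈ Θ.source := hΦs.contDiffAt.mem_toOpenPartialHomeomorph_source hΦd (by simp)
  have hΘc : ∀ y, Θ y = Φ y := fun y => rfl
  obtain ⟨V₁, hV₁, hV₁o, haV₁⟩ := eventually_nhds_iff.1 hzh
  set S := {y | fderiv ℝ Φ y ∈ range ((↑) : (E ≃L[ℝ] E) → E →L[ℝ] E)} with hS
  have hSo : IsOpen S := (ContinuousLinearEquiv.isOpen (𝕜 := ℝ) (E := E) (F := E)).preimage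
    (hΦs.continuous_fderiv (by simp))
  have haS : a ∈ S := ⟨_, hΦd.fderiv.symm⟩
  obtain ⟨W', hW'W, hW'o, hpW'⟩ := mem_nhds_iff.1 hW
  have hVo : IsOpen (φ.target ∩ φ.symm ⁻¹' W') :=
    hsymm.continuousOn.isOpen_inter_preimage hφt hW'o
  set V := Θ.source ∩ S ∩ V₁ ∩ (φ.target ∩ φ.symm ⁻¹' W') with hV
  have hVopen : IsOpen V := ((Θ.open_source.inter hSo).inter hV₁o).inter hVo
  have hpa : φ.symm a = p := extChartAt_to_inv p
  have haV : a ∈ V := ⟨⟨⟨hΘa, haS⟩, haV₁⟩, hat, by simpa [hpa] using hpW'⟩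
  have hT : IsOpen (Θ.target ∩ Θ.symm ⁻¹' V) :=
    Θ.symm.continuousOn.isOpen_inter_preimage Θ.open_target hVopen
  have hbT : Θ a ∈ Θ.target ∩ Θ.symm ⁻¹' V := ⟨Θ.map_source hΘa, by simpa [Θ.left_inv hΘa] using haV⟩
  obtain ⟨r, hr, hball⟩ := Metric.isOpen_iff.1 hT _ hbT
  have hO : IsOpen (φ.source ∩ φ ⁻¹' (V ∩ Φ ⁻¹' Metric.ball (Φ a) r)) :=
    (continuousOn_extChartAt p).isOpen_inter_preimage (isOpen_extChartAt_source p)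
      (hVopen.inter (Metric.isOpen_ball.preimage hΦs.continuous))
  refine ⟨l, Φ ∘ φ, φ.symm ∘ Θ.symm, r, _, hl0, hr, hO,
    ⟨mem_extChartAt_source p, haV, Metric.mem_ball_self hr⟩, ?_, ?_, ?_, ?_⟩
  · have h := contMDiffOn_extChartAt (I := I) (n := ∞) (x := p)
    rw [← extChartAt_source I] at h
    exact hΦs.contMDiff.comp_contMDiffOn (h.mono inter_subset_left)
  · refine hsymm.comp (ContDiffOn.contMDiffOn fun y hy => ?_) fun y hy => ((hball hy).2.2).1
    obtain ⟨hyt, hyV⟩ := hball hy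
    obtain ⟨⟨⟨h1, ⟨A, hA⟩⟩, h3⟩, h4⟩ := hyV
    refine (Θ.contDiffAt_symm (f₀' := A) hyt ?_ hΦs.contDiffAt).contDiffWithinAt
    rw [hA]
    exact (hΦs.differentiable (by simp) _).hasFDerivAt
  · rintro x ⟨hx1, hx2, hx3⟩
    refine ⟨hx3, ?_⟩
    have h1 : Θ.symm (Φ (φ x)) = φ x := Θ.left_inv hx2.1.1.1
    simp only [Function.comp, h1]
    exact φ.left_inv hx1
  · intro y hy
    obtain ⟨hyt, hyV⟩ := hball hy
    refine ⟨hW'W hyV.2.2, ?_⟩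
    have h1 : Φ (Θ.symm y) = y := Θ.right_inv hyt
    have h2 := hV₁ _ hyV.1.2
    rw [← h1, hlΦ, h2, h1]
    rfl

/-- Hadamard's lemma: a smooth function vanishing on a regular level set is locally divisible. -/
theorem exists_eventually_eq_mul [T2Space M] [SigmaCompactSpace M] (z f : SmoothFn I M) {p : M}
    (hz : mvfderiv I z p ≠ 0) (hzp : z p = 0) (hf : ∀ᶠ x in 𝓝 p, z x = 0 → f x = 0) :
    ∃ g : SmoothFn I M, ∀ᶠ x in 𝓝 p, f x = z x * g x := by
  obtain ⟨l, θ, σ, r, O, hl, hr, hO, hpO, hθ, hσ, hinv, hzσ⟩ := exists_straightening z hz hf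
  have hb : Metric.ball (θ p) r ∈ 𝓝 (θ p) := Metric.ball_mem_nhds _ hr
  obtain ⟨F, hF⟩ := exists_smoothFn_eventuallyEq (I := 𝓘(ℝ, E)) hb
    (f := f ∘ σ) (f.contMDiff.comp_contMDiffOn hσ)
  have hlb : l (θ p) = 0 := by
    rw [← (hzσ _ (Metric.mem_ball_self hr)).2, (hinv p hpO).2, hzp]
  obtain ⟨g, hg, hFg⟩ := exists_eq_linear_mul F.contMDiff.contDiff hl hlb (by
    filter_upwards [hF, hb] with y hy hyb hly
    rw [hy]
    exact (hzσ y hyb).1 ((hzσ y hyb).2.trans hly))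
  obtain ⟨G, hG⟩ := exists_smoothFn_eventuallyEq (hO.mem_nhds hpO)
    (f := g ∘ θ) (hg.contMDiff.comp_contMDiffOn hθ)
  have hθc : Tendsto θ (𝓝 p) (𝓝 (θ p)) := (hθ.continuousOn.continuousAt (hO.mem_nhds hpO))
  refine ⟨G, ?_⟩
  filter_upwards [hG, hO.mem_nhds hpO, hθc.eventually hF, hθc.eventually hFg] with x h1 h2 h3 h4
  obtain ⟨h5, h6⟩ := hinv x h2
  have h7 := (hzσ _ h5).2
  rw [h6] at h7
  rw [h1, h7]
  simp only [Function.comp] at h3 ⊢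
  rw [← h4, h3, h6]

end Straightening

section DefiningFunctions

variable {E : Type} [NormedAddCommGroup E] [NormedSpace ℝ E] [FiniteDimensional ℝ E]
  {H : Type*} [TopologicalSpace H] {I : ModelWithCorners ℝ E H} [I.Boundaryless]
  {M : Type*} [TopologicalSpace M] [ChartedSpace H M] [IsManifold I ∞ M]
  [T2Space M] [SigmaCompactSpace M] {Z : Set M}

theorem SmoothFn.sum_apply {ι : Type*} (s : Finset ι) (f : ι → SmoothFn I M) (x : M) :
    (∑ i ∈ s, f i) x = ∑ i ∈ s, f i x := by
  induction s using Finset.cons_induction with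
  | empty => rfl
  | cons i s hi ih => rw [Finset.sum_cons, Finset.sum_cons, ← ih]; rfl

theorem mvfderiv_eq_of_eventuallyEq_mul {f z g : SmoothFn I M} {p : M}
    (h : ∀ᶠ x in 𝓝 p, f x = z x * g x) (hz : z p = 0) (v : TangentSpace I p) :
    mvfderiv I f p v = g p * mvfderiv I z p v := by
  have h1 : mvfderiv I f p = mvfderiv I ((⇑z) * (⇑g)) p := mvfderiv_congr h
  rw [h1, mvfderiv_mul (z.mdifferentiableAt p) (g.mdifferentiableAt p)]
  simp [hz]

theorem IsHypersurface.eventually_mem_iff (hZ : IsHypersurface I Z) {f : SmoothFn I M}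
    (hf : f ∈ vanishingIdeal I Z) {p : M} (hp : p ∈ Z) (hd : mvfderiv I f p ≠ 0) :
    ∀ᶠ x in 𝓝 p, x ∈ Z ↔ f x = 0 := by
  obtain ⟨U, hU, f₀, hf₀, hf₀Z⟩ := hZ.2 p hp
  have hf₀p : f₀ p = 0 := (hf₀Z p (mem_of_mem_nhds hU)).1 hp
  obtain ⟨g, hg⟩ := exists_eventually_eq_mul f₀ f hf₀ hf₀p (by
    filter_upwards [hU] with x hx h using hf x ((hf₀Z x hx).2 h))
  have hgp : g p ≠ 0 := by
    intro h
    apply hd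
    ext v
    simp [mvfderiv_eq_of_eventuallyEq_mul hg hf₀p v, h]
  filter_upwards [hU, hg, g.contMDiff.continuous.continuousAt.eventually_ne hgp] with x h1 h2 h3
  rw [hf₀Z x h1, h2]
  simp [h3]

theorem exists_eventually_eq_mul_of_mem (hZ : IsHypersurface I Z) {z f : SmoothFn I M}
    (hz : z ∈ vanishingIdeal I Z) (hf : f ∈ vanishingIdeal I Z) {p : M} (hp : p ∈ Z)
    (hd : mvfderiv I z p ≠ 0) : ∃ g : SmoothFn I M, ∀ᶠ x in 𝓝 p, f x = z x * g x :=
  exists_eventually_eq_mul z f hd (hz p hp) (by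
    filter_upwards [hZ.eventually_mem_iff hz hp hd] with x hx h using hf x (hx.2 h))

theorem lieDeriv_ne_zero_of_transverse (hZ : IsHypersurface I Z) {Y : SmoothVF I M}
    (hY : ∀ p ∈ Z, Y p ∉ tangentSpaceOf I Z p) {z : SmoothFn I M}
    (hz : z ∈ vanishingIdeal I Z) {p : M} (hp : p ∈ Z) (hd : mvfderiv I z p ≠ 0) :
    lieDeriv Y z p ≠ 0 := by
  intro h
  refine hY p hp fun f hf => ?_
  obtain ⟨g, hg⟩ := exists_eventually_eq_mul_of_mem hZ hz hf hp hd
  rw [mvfderiv_eq_of_eventuallyEq_mul hg (hz p hp), ← lieDeriv_apply, h, mul_zero]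

/-- A smooth function vanishing on a cooriented hypersurface, with positive transverse
derivative. -/
theorem exists_mem_vanishingIdeal_lieDeriv_pos (hZ : IsHypersurface I Z) {Y : SmoothVF I M}
    (hY : ∀ p ∈ Z, Y p ∉ tangentSpaceOf I Z p) :
    ∃ z ∈ vanishingIdeal I Z, ∀ p ∈ Z, 0 < lieDeriv Y z p := by
  have hloc : ∀ p : Z, ∃ f ∈ vanishingIdeal I Z, 0 < lieDeriv Y f p := by
    rintro ⟨p, hp⟩
    obtain ⟨f, hf, hne⟩ : ∃ f ∈ vanishingIdeal I Z, mvfderiv I f p (Y p) ≠ 0 := by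
      by_contra! h
      exact hY p hp h
    rcases lt_or_gt_of_ne hne with h | h
    · refine ⟨-f, neg_mem hf, ?_⟩
      have h1 : lieDeriv Y (-f) p = - lieDeriv Y f p := by
        have := lieDeriv_sub Y 0 f
        have h0 := lieDeriv_sub Y f f
        rw [sub_self, sub_self] at h0
        rw [zero_sub, h0, zero_sub] at this
        rw [this]
        rfl
      rw [h1]
      exact neg_pos.2 h
    · exact ⟨f, hf, h⟩
  choose f hf hpos using hloc
  obtain ⟨ρ, hρ⟩ := SmoothPartitionOfUnity.exists_isSubordinate I hZ.1
    (fun p : Z => {x | 0 < lieDeriv Y (f p) x})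
    (fun p => isOpen_lt continuous_const (lieDeriv Y (f p)).contMDiff.continuous)
    (fun p hp => mem_iUnion.2 ⟨⟨p, hp⟩, hpos ⟨p, hp⟩⟩)
  let z : SmoothFn I M := ⟨fun x => ∑ᶠ i, ρ i x • f i x,
    ρ.contMDiff_finsum_smul fun i x _ => (f i).contMDiff.contMDiffAt⟩
  refine ⟨z, fun x hx => ?_, fun p hp => ?_⟩
  · exact finsum_eq_zero_of_forall_eq_zero fun i => by rw [hf i x hx, smul_zero]
  · have hsum : ∀ᶠ x in 𝓝 p, z x = (∑ i ∈ ρ.fintsupport p, ρ i * f i : SmoothFn I M) x := by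
      filter_upwards [ρ.eventually_fintsupport_subset p] with x hx
      have h1 : z x = ∑ i ∈ ρ.fintsupport p, ρ i x • f i x := by
        refine finsum_eq_sum_of_support_subset _ fun i hi => ?_
        have : ρ i x ≠ 0 := fun h => hi (by simp [h])
        refine hx ((ρ.mem_fintsupport_iff x i).2 (subset_closure this))
      rw [h1, SmoothFn.sum_apply]
      rfl
    have hder : lieDeriv Y z p = ∑ i ∈ ρ.fintsupport p, ρ i p * lieDeriv Y (f i) p := by
      have h1 : lieDeriv Y z p = lieDeriv Y (∑ i ∈ ρ.fintsupport p, ρ i * f i) p := by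
        rw [lieDeriv_apply, lieDeriv_apply, mvfderiv_congr hsum]
      have h2 : ∀ s : Finset Z, lieDeriv Y (∑ i ∈ s, ρ i * f i) p =
          ∑ i ∈ s, ρ i p * lieDeriv Y (f i) p := by
        intro s
        induction s using Finset.cons_induction with
        | empty => simp [lieDeriv_apply]
        | cons i s hi ih =>
          rw [Finset.sum_cons, Finset.sum_cons, lieDeriv_add, lieDeriv_mul, ← ih]
          simp [hf i p hp]
      rw [h1, h2]
    rw [hder]
    obtain ⟨i, hi⟩ := ρ.exists_pos_of_mem hp
    have hsub : ∀ i, ρ i p ≠ 0 → 0 < lieDeriv Y (f i) p := fun i hi => hρ i (subset_closure hi)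
    refine Finset.sum_pos' (fun i _ => ?_) ⟨i, ?_, mul_pos hi (hsub i hi.ne')⟩
    · by_cases h : ρ i p = 0
      · simp [h]
      · exact mul_nonneg (ρ.nonneg i p) (hsub i h).le
    · exact (ρ.mem_fintsupport_iff p i).2 (subset_closure hi.ne')

/-- Every admissible jet is represented by a function with nonvanishing differential on `Z`. -/
theorem exists_representative {k : ℕ} (hk : 1 ≤ k) (hZ : IsHypersurface I Z)
    (hco : IsCoorientable I Z) {j : JetAlong I Z k} (hj : IsAdmissibleJet j) :
    ∃ z : SmoothFn I M, jetOf I Z k z = j ∧ z ∈ vanishingIdeal I Z ∧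
      ∀ p ∈ Z, mvfderiv I z p ≠ 0 := by
  obtain ⟨f, hf⟩ := Ideal.Quotient.mk_surjective j
  rcases hk.eq_or_lt with rfl | hk
  · obtain ⟨Y, hY⟩ := hco
    obtain ⟨z, hz, hpos⟩ := exists_mem_vanishingIdeal_lieDeriv_pos hZ hY
    refine ⟨z, ?_, hz, fun p hp h => ?_⟩
    · rw [← hf]
      refine Ideal.Quotient.eq.2 ?_
      rw [pow_one]
      exact sub_mem hz (hj f hf).1
    · have := hpos p hp
      rw [lieDeriv_apply, h] at this
      exact lt_irrefl _ this
  · exact ⟨f, hf, (hj f hf).1, (hj f hf).2 hk⟩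

end DefiningFunctions

section DefiningData

/-- A defining function `z` of `Z` on a neighbourhood `U`, bounded away from zero near the boundary
of `U`, with a vector field `Y` such that `dz(Y) = 1` on a smaller neighbourhood `U₁`. -/
structure DefiningData {E : Type} [NormedAddCommGroup E] [NormedSpace ℝ E]
    {H : Type*} [TopologicalSpace H] (I : ModelWithCorners ℝ E H)
    {M : Type*} [TopologicalSpace M] [ChartedSpace H M] [IsManifold I ∞ M] (Z : Set M) where
  /-- The defining function. -/
  z : SmoothFn I M
  /-- The transverse vector field. -/
  Y : SmoothVF I M
  /-- The neighbourhood on which `Z` is the zero set of `z`. -/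
  U : Set M
  /-- The neighbourhood on which `dz(Y) = 1`. -/
  U₁ : Set M
  isClosed : IsClosed Z
  isOpen_U : IsOpen U
  isOpen_U₁ : IsOpen U₁
  subset_U₁ : Z ⊆ U₁
  U₁_subset : U₁ ⊆ U
  mem_iff : ∀ x ∈ closure U, x ∈ Z ↔ z x = 0
  closure_subset : closure {x ∈ U | |z x| < 1} ⊆ U
  abs_lt : ∀ x ∈ U₁, |z x| < 1 / 2
  lieDeriv_Y : ∀ x ∈ U₁, lieDeriv Y z x = 1

section DefiningFunction

variable {E : Type} [NormedAddCommGroup E] [NormedSpace ℝ E]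
  {H : Type*} [TopologicalSpace H] {I : ModelWithCorners ℝ E H}
  {M : Type*} [TopologicalSpace M] [ChartedSpace H M] [IsManifold I ∞ M] {Z : Set M}
  (D : DefiningData I Z)

theorem DefiningData.mem_iff' {x : M} (hx : x ∈ D.U) : x ∈ Z ↔ D.z x = 0 :=
  D.mem_iff x (subset_closure hx)

theorem DefiningData.z_ne_zero {x : M} (hx : x ∈ D.U) (hxZ : x ∉ Z) : D.z x ≠ 0 :=
  fun h => hxZ ((D.mem_iff' hx).2 h)

end DefiningFunction

variable {E : Type} [NormedAddCommGroup E] [NormedSpace ℝ E] [FiniteDimensional ℝ E]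
  {H : Type*} [TopologicalSpace H] {I : ModelWithCorners ℝ E H} [I.Boundaryless]
  {M : Type*} [TopologicalSpace M] [ChartedSpace H M] [IsManifold I ∞ M]
  [T2Space M] [SigmaCompactSpace M] {Z : Set M}

theorem normalSpace_of_manifold {E : Type} [NormedAddCommGroup E] [NormedSpace ℝ E]
    [FiniteDimensional ℝ E] {H : Type*} [TopologicalSpace H] (I : ModelWithCorners ℝ E H)
    (M : Type*) [TopologicalSpace M] [ChartedSpace H M] [T2Space M] [SigmaCompactSpace M] :
    NormalSpace M := by
  have : LocallyCompactSpace M := Manifold.locallyCompact_of_finiteDimensional I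
  infer_instance

/-- A function can be changed to high order along `Z` so that it is bounded away from zero on
a closed set on which it does not vanish. -/
theorem exists_jet_eq_one_le_abs (k : ℕ) (hk : 1 ≤ k) {z : SmoothFn I M}
    (hz : z ∈ vanishingIdeal I Z) {A : Set M} (hA : IsClosed A) (hzA : ∀ x ∈ A, z x ≠ 0) :
    ∃ z' : SmoothFn I M, jetOf I Z k z' = jetOf I Z k z ∧ (∀ x, z' x = 0 ↔ z x = 0) ∧
      (∀ p ∈ Z, mvfderiv I z' p = mvfderiv I z p) ∧ ∀ x ∈ A, 1 ≤ |z' x| := by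
  obtain ⟨g, hg⟩ := exists_contMDiffMap_forall_mem_convex_of_local_const (n := ⊤) I
    (t := fun y => {s : ℝ | 0 ≤ s ∧ (y ∈ A → 1 ≤ |z y| ^ (2 * k + 1) * s)}) (fun y => by
      refine Convex.inter (t := {s : ℝ | y ∈ A → 1 ≤ |z y| ^ (2 * k + 1) * s}) (convex_Ici 0) ?_
      by_cases hy : y ∈ A
      · simp only [hy, true_imp_iff]
        exact (convex_Ici (1 : ℝ)).is_linear_preimage
          (IsLinearMap.isLinearMap_smul (|z y| ^ (2 * k + 1)))
      · simp [hy, convex_univ]) (fun y => by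
      by_cases hy : y ∈ A
      · have hpos : 0 < |z y| ^ (2 * k + 1) := pow_pos (abs_pos.2 (hzA y hy)) _
        refine ⟨2 / |z y| ^ (2 * k + 1), ?_⟩
        have hc : Continuous fun x => |z x| ^ (2 * k + 1) * (2 / |z y| ^ (2 * k + 1)) :=
          ((z.contMDiff.continuous.abs).pow _).mul continuous_const
        have h1 : 1 < |z y| ^ (2 * k + 1) * (2 / |z y| ^ (2 * k + 1)) := by
          rw [mul_div_cancel₀ _ hpos.ne']; norm_num
        filter_upwards [hc.continuousAt.eventually_const_lt h1] with x hx
        exact ⟨by positivity, fun _ => hx.le⟩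
      · exact ⟨0, by filter_upwards [hA.isOpen_compl.mem_nhds hy] with x hx
          using ⟨le_rfl, fun h => absurd h hx⟩⟩)
  have hpos : ∀ x, 0 < 1 + z x ^ (2 * k) * g x := fun x => by
    have := (hg x).1
    have h2 : 0 ≤ z x ^ (2 * k) := (even_two_mul k).pow_nonneg _
    positivity
  have hval : ∀ x, (z + z ^ (2 * k + 1) * g) x = z x * (1 + z x ^ (2 * k) * g x) := fun x => by
    change z x + z x ^ (2 * k + 1) * g x = _
    ring
  refine ⟨z + z ^ (2 * k + 1) * g, ?_, fun x => ?_, fun p hp => ?_, fun x hx => ?_⟩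
  · refine Ideal.Quotient.eq.2 ?_
    rw [add_sub_cancel_left]
    exact Ideal.mul_mem_right _ _
      (Ideal.pow_le_pow_right (by omega) (Ideal.pow_mem_pow hz (2 * k + 1)))
  · rw [hval, mul_eq_zero, or_iff_left (hpos x).ne']
  · ext v
    have h1 : ∀ᶠ x in 𝓝 p, (z + z ^ (2 * k + 1) * g) x = z x * (1 + z ^ (2 * k) * g : SmoothFn I M) x :=
      Eventually.of_forall hval
    rw [mvfderiv_eq_of_eventuallyEq_mul h1 (hz p hp)]
    have h2 : (1 + z ^ (2 * k) * g : SmoothFn I M) p = 1 := by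
      change 1 + z p ^ (2 * k) * g p = 1
      rw [hz p hp, zero_pow (by omega)]
      simp
    rw [h2, one_mul]
  · rw [hval, abs_mul, abs_of_pos (hpos x)]
    have := (hg x).2 hx
    have h2 : z x ^ (2 * k) = |z x| ^ (2 * k) := ((even_two_mul k).pow_abs _).symm
    rw [h2]
    have h3 := abs_nonneg (z x)
    calc 1 ≤ |z x| ^ (2 * k + 1) * g x := this
      _ ≤ |z x| * (1 + |z x| ^ (2 * k) * g x) := by
        rw [mul_add, mul_one, ← mul_assoc, ← pow_succ']
        linarith

/-- Rescaling a vector field so that the derivative of `z` becomes one near `Z`. -/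
theorem exists_lieDeriv_eq_one {z : SmoothFn I M} {Y : SmoothVF I M} {A : Set M}
    (hA : IsClosed A) (h : ∀ x ∈ A, lieDeriv Y z x ≠ 0) :
    ∃ Y' : SmoothVF I M, ∀ x ∈ A, lieDeriv Y' z x = 1 := by
  obtain ⟨g, hg⟩ := exists_contMDiffMap_forall_mem_convex_of_local (n := ⊤) I
    (t := fun y => {s : ℝ | y ∈ A → s = (lieDeriv Y z y)⁻¹}) (fun y => by
      by_cases hy : y ∈ A
      · simp [hy]
      · simp [hy, convex_univ]) (fun y => by
      by_cases hy : y ∈ A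
      · refine ⟨{x | lieDeriv Y z x ≠ 0}, ?_, fun x => (lieDeriv Y z x)⁻¹, ?_, fun x hx _ => rfl⟩
        · exact (lieDeriv Y z).contMDiff.continuous.continuousAt.eventually_ne (h y hy)
        · exact (lieDeriv Y z).contMDiff.contMDiffOn.inv₀ fun x hx => hx
      · exact ⟨Aᶜ, hA.isOpen_compl.mem_nhds hy, fun _ => 0, contMDiffOn_const,
          fun x hx hx' => absurd hx' hx⟩)
  refine ⟨smulSection g Y, fun x hx => ?_⟩
  rw [lieDeriv_smulSection]
  change g x * lieDeriv Y z x = 1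
  rw [hg x hx, inv_mul_cancel₀ (h x hx)]

theorem exists_definingData {k : ℕ} (hk : 1 ≤ k) (hZ : IsHypersurface I Z)
    (hco : IsCoorientable I Z) {j : JetAlong I Z k} (hj : IsAdmissibleJet j) :
    ∃ D : DefiningData I Z, jetOf I Z k D.z = j := by
  have := normalSpace_of_manifold I M
  obtain ⟨z₀, hjet, hz₀, hd₀⟩ := exists_representative hk hZ hco hj
  set W := interior {x | x ∈ Z ↔ z₀ x = 0} with hW
  have hZW : Z ⊆ W := fun p hp => mem_interior_iff_mem_nhds.2
    (hZ.eventually_mem_iff hz₀ hp (hd₀ p hp))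
  obtain ⟨U, hUo, hZU, hUW⟩ := normal_exists_closure_subset hZ.1 isOpen_interior hZW
  obtain ⟨V, hVo, hZV, hVU⟩ := normal_exists_closure_subset hZ.1 hUo hZU
  have hzU : ∀ x ∈ closure U, x ∈ Z ↔ z₀ x = 0 := fun x hx => by
    have h : x ∈ {x | x ∈ Z ↔ z₀ x = 0} := interior_subset (hUW hx)
    exact h
  obtain ⟨z, hzj, hz0, hzd, hzA⟩ := exists_jet_eq_one_le_abs k hk hz₀
    (A := closure U \ V) (isClosed_closure.sdiff hVo)
    (fun x hx h => hx.2 (hZV ((hzU x hx.1).2 h)))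
  have hz : z ∈ vanishingIdeal I Z := fun x hx => (hz0 x).2 (hz₀ x hx)
  obtain ⟨Y, hY⟩ := hco
  have hzY : ∀ p ∈ Z, lieDeriv Y z p ≠ 0 := fun p hp =>
    lieDeriv_ne_zero_of_transverse hZ hY hz hp (by rw [hzd p hp]; exact hd₀ p hp)
  have hopen : IsOpen (U ∩ {x | |z x| < 1 / 2} ∩ {x | lieDeriv Y z x ≠ 0}) :=
    (hUo.inter (isOpen_lt z.contMDiff.continuous.abs continuous_const)).inter
      (isOpen_ne_fun (lieDeriv Y z).contMDiff.continuous continuous_const)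
  obtain ⟨U₁, hU₁o, hZU₁, hU₁⟩ := normal_exists_closure_subset hZ.1 hopen
    (fun p hp => ⟨⟨hZU hp, by simp [hz p hp]⟩, hzY p hp⟩)
  obtain ⟨Y', hY'⟩ := exists_lieDeriv_eq_one (z := z) (Y := Y) isClosed_closure
    (fun x hx => (hU₁ hx).2)
  refine ⟨{ z := z, Y := Y', U := U, U₁ := U₁, isClosed := hZ.1, isOpen_U := hUo
            isOpen_U₁ := hU₁o, subset_U₁ := hZU₁
            U₁_subset := fun x hx => (hU₁ (subset_closure hx)).1.1
            mem_iff := fun x hx => (hzU x hx).trans (hz0 x).symm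
            closure_subset := ?_
            abs_lt := fun x hx => (hU₁ (subset_closure hx)).1.2
            lieDeriv_Y := fun x hx => hY' x (subset_closure hx) }, hzj.trans hjet⟩
  refine (closure_mono fun x hx => ?_).trans hVU
  by_contra h
  exact absurd hx.2 (not_lt.2 (hzA x ⟨subset_closure hx.1, h⟩))

end DefiningData

section DefiningData

variable {E : Type} [NormedAddCommGroup E] [NormedSpace ℝ E] [FiniteDimensional ℝ E]
  {H : Type*} [TopologicalSpace H] {I : ModelWithCorners ℝ E H} [I.Boundaryless]
  {M : Type*} [TopologicalSpace M] [ChartedSpace H M] [IsManifold I ∞ M]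
  [T2Space M] [SigmaCompactSpace M] {Z : Set M}

theorem SmoothFn.continuous (f : SmoothFn I M) : Continuous f := f.contMDiff.continuous

namespace DefiningData

variable (D : DefiningData I Z)

theorem subset_U : Z ⊆ D.U := D.subset_U₁.trans D.U₁_subset

theorem U_mem_nhds {p : M} (hp : p ∈ Z) : D.U ∈ 𝓝 p := D.isOpen_U.mem_nhds (D.subset_U hp)

theorem U₁_mem_nhds {p : M} (hp : p ∈ Z) : D.U₁ ∈ 𝓝 p := D.isOpen_U₁.mem_nhds (D.subset_U₁ hp)

theorem z_eq_zero {x : M} (hx : x ∈ Z) : D.z x = 0 := (D.mem_iff' (D.subset_U hx)).1 hx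

theorem z_mem : D.z ∈ vanishingIdeal I Z := fun _ hx => D.z_eq_zero hx

theorem mvfderiv_z_ne_zero {x : M} (hx : x ∈ D.U₁) : mvfderiv I D.z x ≠ 0 := fun h => by
  have := D.lieDeriv_Y x hx
  rw [lieDeriv_apply, h] at this
  exact zero_ne_one this

theorem dense_compl (D : DefiningData I Z) : Dense Zᶜ := by
  intro p
  by_contra h
  rw [closure_compl, mem_compl_iff, not_not, mem_interior_iff_mem_nhds] at h
  have hp : p ∈ Z := mem_of_mem_nhds h
  have h1 : D.z =ᶠ[𝓝 p] fun _ => (0 : ℝ) := by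
    filter_upwards [h] with x hx using D.z_eq_zero hx
  exact D.mvfderiv_z_ne_zero (D.subset_U₁ hp) (by rw [mvfderiv_congr h1, mvfderiv_const])

/-- Local divisibility by `z ^ k` along `Z` implies divisibility on `U`. -/
theorem exists_eq_pow_mul_of_local (k : ℕ) {f : SmoothFn I M}
    (hf : ∀ p ∈ Z, ∃ g : M → ℝ, ∃ W ∈ 𝓝 p, ContMDiffOn I 𝓘(ℝ, ℝ) ∞ g W ∧
      ∀ x ∈ W, f x = D.z x ^ k * g x) :
    ∃ g : SmoothFn I M, ∀ x ∈ D.U, f x = D.z x ^ k * g x := by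
  obtain ⟨g, hg⟩ := exists_contMDiffMap_forall_mem_convex_of_local (n := ⊤) I
    (t := fun y => {s : ℝ | y ∈ D.U → f y = D.z y ^ k * s}) (fun y => by
      by_cases hy : y ∈ D.U
      · simp only [hy, true_imp_iff]
        intro a ha b hb s t _ _ hst
        simp only [mem_ofPred_eq, smul_eq_mul] at ha hb ⊢
        linear_combination s * ha + t * hb - f y * hst
      · simp [hy, convex_univ]) (fun y => by
      by_cases hyZ : y ∈ Z
      · obtain ⟨g, W, hW, hgW, h⟩ := hf y hyZ
        exact ⟨W, hW, g, hgW, fun x hx _ => h x hx⟩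
      by_cases hy : y ∈ closure D.U
      · have hz : D.z y ≠ 0 := fun h => hyZ ((D.mem_iff y hy).2 h)
        refine ⟨{x | D.z x ≠ 0}, D.z.continuous.continuousAt.eventually_ne hz,
          fun x => f x * (D.z x ^ k)⁻¹, ?_, fun x hx _ => ?_⟩
        · refine f.contMDiff.contMDiffOn.mul ((D.z.contMDiff.pow k).contMDiffOn.inv₀ fun x hx => ?_)
          exact pow_ne_zero k hx
        · change f x = D.z x ^ k * (f x * (D.z x ^ k)⁻¹)
          rw [mul_comm (f x), mul_inv_cancel_left₀ (pow_ne_zero k hx)]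
      · exact ⟨(closure D.U)ᶜ, isClosed_closure.isOpen_compl.mem_nhds hy, fun _ => 0,
          contMDiffOn_const, fun x hx hx' => absurd (subset_closure hx') hx⟩)
  exact ⟨g, hg⟩

theorem exists_eq_mul_of_mem {f : SmoothFn I M} (hf : f ∈ vanishingIdeal I Z) :
    ∃ g : SmoothFn I M, ∀ x ∈ D.U, f x = D.z x * g x := by
  have h := D.exists_eq_pow_mul_of_local 1 (f := f) fun p hp => by
    obtain ⟨g, hg⟩ := exists_eventually_eq_mul D.z f (D.mvfderiv_z_ne_zero (D.subset_U₁ hp))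
      (D.z_eq_zero hp) (by
        filter_upwards [D.U_mem_nhds hp] with x hx h using hf x ((D.mem_iff' hx).2 h))
    exact ⟨g, _, hg, g.contMDiff.contMDiffOn, fun x hx => by rw [pow_one]; exact hx⟩
  simpa using h

theorem mem_vanishingIdeal_pow_of_eq {k : ℕ} {f g : SmoothFn I M}
    (h : ∀ x ∈ D.U, f x = D.z x ^ k * g x) : f ∈ (vanishingIdeal I Z) ^ k := by
  obtain ⟨ψ, h0, h1, -⟩ := by
    have := normalSpace_of_manifold I M
    exact exists_contMDiffMap_zero_one_of_isClosed (n := ⊤) I D.isClosed D.isOpen_U.isClosed_compl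
      (disjoint_compl_right_iff_subset.2 D.subset_U)
  have hψ : ψ ∈ vanishingIdeal I Z := fun x hx => h0 hx
  have hf : f = f * ψ ^ k + D.z ^ k * (g * (1 - ψ ^ k)) := by
    ext x
    change f x = f x * ψ x ^ k + D.z x ^ k * (g x * (1 - ψ x ^ k))
    by_cases hx : x ∈ D.U
    · rw [h x hx]; ring
    · have : ψ x = 1 := h1 hx
      rw [this]; simp
  rw [hf]
  exact add_mem (Ideal.mul_mem_left _ _ (Ideal.pow_mem_pow hψ k))
    (Ideal.mul_mem_right _ _ (Ideal.pow_mem_pow D.z_mem k))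

theorem mem_vanishingIdeal_pow_iff {k : ℕ} {f : SmoothFn I M} :
    f ∈ (vanishingIdeal I Z) ^ k ↔ ∃ g : SmoothFn I M, ∀ x ∈ D.U, f x = D.z x ^ k * g x := by
  refine ⟨fun hf => ?_, fun ⟨g, hg⟩ => D.mem_vanishingIdeal_pow_of_eq hg⟩
  induction k generalizing f with
  | zero => exact ⟨f, by simp⟩
  | succ k ih =>
    rw [pow_succ] at hf
    refine Submodule.mul_induction_on hf (fun a ha b hb => ?_) ?_
    · obtain ⟨g, hg⟩ := ih ha
      obtain ⟨g', hg'⟩ := D.exists_eq_mul_of_mem hb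
      refine ⟨g * g', fun x hx => ?_⟩
      change a x * b x = D.z x ^ (k + 1) * (g x * g' x)
      rw [hg x hx, hg' x hx]
      ring
    · rintro a b ⟨g, hg⟩ ⟨g', hg'⟩
      refine ⟨g + g', fun x hx => ?_⟩
      change a x + b x = D.z x ^ (k + 1) * (g x + g' x)
      rw [hg x hx, hg' x hx]
      ring

/-- Uniqueness of the quotient by `z ^ k`, also at points of `Z`. -/
theorem eq_of_pow_mul_eq {k : ℕ} {g g' : SmoothFn I M} {x : M} (hx : x ∈ D.U)
    (h : ∀ᶠ y in 𝓝 x, D.z y ^ k * g y = D.z y ^ k * g' y) : g x = g' x := by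
  have hcl : ∃ᶠ y in 𝓝 x, y ∈ Zᶜ := mem_closure_iff_frequently.1 (D.dense_compl x)
  by_contra hne
  have hev : ∀ᶠ y in 𝓝 x, g y ≠ g' y :=
    (g.continuous.continuousAt.prodMk g'.continuous.continuousAt).eventually
      ((isClosed_diagonal.isOpen_compl).mem_nhds hne)
  obtain ⟨y, hyZ, ⟨h1, h2⟩, h3⟩ :=
    (hcl.and_eventually ((h.and hev).and (D.isOpen_U.mem_nhds hx))).exists
  exact h2 (mul_left_cancel₀ (pow_ne_zero k (D.z_ne_zero h3 hyZ)) h1)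

end DefiningData

/-- The smooth vector fields `X` with `X z ∈ I_Z ^ k`. -/
def DefiningData.fields (D : DefiningData I Z) (k : ℕ) : Set (SmoothVF I M) :=
  {X | lieDeriv X D.z ∈ (vanishingIdeal I Z) ^ k}

namespace DefiningData

variable (D : DefiningData I Z)

theorem lieDeriv_mem_vanishingIdeal {X : SmoothVF I M}
    (hX : lieDeriv X D.z ∈ vanishingIdeal I Z) {f : SmoothFn I M} (hf : f ∈ vanishingIdeal I Z) :
    lieDeriv X f ∈ vanishingIdeal I Z := by
  intro p hp
  obtain ⟨g, hg⟩ := D.exists_eq_mul_of_mem hf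
  have h := mvfderiv_eq_of_eventuallyEq_mul (f := f) (z := D.z) (g := g) (p := p)
    (by filter_upwards [D.U_mem_nhds hp] with x hx using hg x hx) (D.z_eq_zero hp) (X p)
  rw [lieDeriv_apply, h, ← lieDeriv_apply, hX p hp, mul_zero]

theorem lieDeriv_mem_pow {X : SmoothVF I M} (hX : lieDeriv X D.z ∈ vanishingIdeal I Z) (k : ℕ)
    {f : SmoothFn I M} (hf : f ∈ (vanishingIdeal I Z) ^ k) :
    lieDeriv X f ∈ (vanishingIdeal I Z) ^ k := by
  induction k generalizing f with
  | zero => simp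
  | succ k ih =>
    rw [pow_succ] at hf ⊢
    refine Submodule.mul_induction_on hf (fun a ha b hb => ?_) fun a b ha hb => ?_
    · rw [lieDeriv_mul]
      refine add_mem (Submodule.mul_mem_mul ha (D.lieDeriv_mem_vanishingIdeal hX hb)) ?_
      rw [mul_comm b]
      exact Submodule.mul_mem_mul (ih ha) hb
    · rw [lieDeriv_add]
      exact add_mem ha hb

theorem lieDeriv_mem_of_mem_fields {k : ℕ} (hk : 1 ≤ k) {X : SmoothVF I M}
    (hX : X ∈ D.fields k) : lieDeriv X D.z ∈ vanishingIdeal I Z := by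
  have := Ideal.pow_le_pow_right (I := vanishingIdeal I Z) hk hX
  rwa [pow_one] at this

theorem bkVectorFields_eq {k : ℕ} (hk : 1 ≤ k) :
    bkVectorFields (jetOf I Z k D.z) = D.fields k := by
  ext X
  refine ⟨fun h => h D.z rfl, fun h f hf => ?_⟩
  have h1 : f - D.z ∈ (vanishingIdeal I Z) ^ k := Ideal.Quotient.eq.1 hf
  have h2 := D.lieDeriv_mem_pow (D.lieDeriv_mem_of_mem_fields hk h) k h1
  rw [lieDeriv_sub] at h2
  exact (Submodule.sub_mem_iff_left _ h).1 h2

theorem bracketVF_mem_fields {k : ℕ} (hk : 1 ≤ k) [CompleteSpace E] {X Y : SmoothVF I M}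
    (hX : X ∈ D.fields k) (hY : Y ∈ D.fields k) : bracketVF X Y ∈ D.fields k := by
  change lieDeriv (bracketVF X Y) D.z ∈ (vanishingIdeal I Z) ^ k
  rw [lieDeriv_bracketVF]
  exact sub_mem (D.lieDeriv_mem_pow (D.lieDeriv_mem_of_mem_fields hk hX) k hY)
    (D.lieDeriv_mem_pow (D.lieDeriv_mem_of_mem_fields hk hY) k hX)

open Classical in
/-- The quotient `(X z) / z ^ k`, as a smooth function on `M` (meaningful on `U`). -/
def coeff (k : ℕ) (X : SmoothVF I M) : SmoothFn I M :=
  if h : ∃ g : SmoothFn I M, ∀ x ∈ D.U, lieDeriv X D.z x = D.z x ^ k * g x then h.choose else 0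

theorem lieDeriv_eq_coeff {k : ℕ} {X : SmoothVF I M} (hX : X ∈ D.fields k) {x : M}
    (hx : x ∈ D.U) : lieDeriv X D.z x = D.z x ^ k * D.coeff k X x := by
  have h := D.mem_vanishingIdeal_pow_iff.1 hX
  rw [coeff, dif_pos h]
  exact h.choose_spec x hx

theorem coeff_eq_of_eventually {k : ℕ} {X : SmoothVF I M} (hX : X ∈ D.fields k)
    {g : SmoothFn I M} {x : M} (hx : x ∈ D.U)
    (h : ∀ᶠ y in 𝓝 x, lieDeriv X D.z y = D.z y ^ k * g y) : D.coeff k X x = g x := by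
  refine D.eq_of_pow_mul_eq (k := k) hx ?_
  filter_upwards [h, D.isOpen_U.mem_nhds hx] with y h1 h2
  rw [← h1, D.lieDeriv_eq_coeff hX h2]

end DefiningData

end DefiningData

section Twist

variable {E : Type} [NormedAddCommGroup E] [NormedSpace ℝ E] [FiniteDimensional ℝ E]
  {H : Type*} [TopologicalSpace H] {I : ModelWithCorners ℝ E H}
  {M : Type*} [TopologicalSpace M] [ChartedSpace H M] [IsManifold I ∞ M]

/-- The endomorphism of the tangent space that multiplies by `μ` along `Y` and is the identity
on the kernel of `dz` (if `dz(Y) = 1`). -/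
def twist (z : SmoothFn I M) (Y : SmoothVF I M) (μ : ℝ) (x : M) :
    TangentSpace I x →L[ℝ] TangentSpace I x :=
  ContinuousLinearMap.id ℝ _ + (μ - 1) • (mvfderiv I z x).smulRight (Y x)

theorem twist_apply (z : SmoothFn I M) (Y : SmoothVF I M) (μ : ℝ) (x : M) (v : TangentSpace I x) :
    twist z Y μ x v = v + ((μ - 1) * mvfderiv I z x v) • Y x := by
  simp [twist, mul_smul]

theorem twist_one (z : SmoothFn I M) (Y : SmoothVF I M) (x : M) (v : TangentSpace I x) :
    twist z Y 1 x v = v := by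
  simp [twist_apply]

theorem twist_twist (z : SmoothFn I M) (Y : SmoothVF I M) {x : M} (h : mvfderiv I z x (Y x) = 1)
    (μ ν : ℝ) (v : TangentSpace I x) :
    twist z Y μ x (twist z Y ν x v) = twist z Y (μ * ν) x v := by
  rw [twist_apply, twist_apply, twist_apply, map_add, map_smul, h, add_assoc, ← add_smul,
    smul_eq_mul]
  congr 2
  ring

/-- The twist read in tangent bundle trivialisations. -/
def readTwist (z : SmoothFn I M) (Y : SmoothVF I M) (x₀ x₁ : M) (μ : ℝ) (x : M) : E →L[ℝ] E :=
  (trivializationAt E (TangentSpace I : M → Type) x₁).continuousLinearMapAt ℝ x ∘L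
    twist z Y μ x ∘L (trivializationAt E (TangentSpace I : M → Type) x₀).symmL ℝ x

theorem contMDiffOn_mvfderiv_apply (z : SmoothFn I M) {s : ∀ x : M, TangentSpace I x} {U : Set M}
    (hs : ContMDiffOn I I.tangent ∞ (fun x => (⟨x, s x⟩ : TangentBundle I M)) U) :
    ContMDiffOn I 𝓘(ℝ, ℝ) ∞ (fun x => mvfderiv I z x (s x)) U := by
  have h1 : ContMDiff I.tangent 𝓘(ℝ, ℝ).tangent ∞ (tangentMap I 𝓘(ℝ, ℝ) z) :=
    z.contMDiff.contMDiff_tangentMap (by simp)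
  have h2 : ContMDiffOn I 𝓘(ℝ, ℝ).tangent ∞ (fun x => tangentMap I 𝓘(ℝ, ℝ) z ⟨x, s x⟩) U :=
    h1.comp_contMDiffOn hs
  exact (contMDiff_snd_tangentBundle_modelSpace ℝ 𝓘(ℝ, ℝ)).comp_contMDiffOn h2

theorem contMDiffOn_readTwist (z : SmoothFn I M) (Y : SmoothVF I M) (x₀ x₁ : M) {μ : M → ℝ}
    {O : Set M} (hμ : ContMDiffOn I 𝓘(ℝ, ℝ) ∞ μ O) :
    ContMDiffOn I 𝓘(ℝ, E →L[ℝ] E) ∞ (fun x => readTwist z Y x₀ x₁ (μ x) x)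
      (O ∩ ((trivializationAt E (TangentSpace I : M → Type) x₀).baseSet ∩
        (trivializationAt E (TangentSpace I : M → Type) x₁).baseSet)) := by
  set e₀ := trivializationAt E (TangentSpace I : M → Type) x₀ with he₀
  set e₁ := trivializationAt E (TangentSpace I : M → Type) x₁ with he₁
  set b := Module.finBasis ℝ E
  have hY : ContMDiffOn I 𝓘(ℝ, E) ∞ (fun x => (e₁ ⟨x, Y x⟩).2) e₁.baseSet :=
    (e₁.contMDiffOn_section_baseSet_iff (IB := I) (n := ∞)).1 Y.contMDiff.contMDiffOn
  have hs : ∀ i, ContMDiffOn I 𝓘(ℝ, ℝ) ∞ (fun x => mvfderiv I z x (e₀.symm x (b i)))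
      e₀.baseSet := fun i => by
    refine contMDiffOn_mvfderiv_apply z ?_
    refine (e₀.contMDiffOn_section_baseSet_iff (IB := I) (n := ∞)).2 ?_
    refine (contMDiffOn_const (c := b i)).congr fun x hx => ?_
    rw [e₀.apply_mk_symm hx]
  have hmain : ContMDiffOn I 𝓘(ℝ, E →L[ℝ] E) ∞ (fun x =>
      (e₀.coordChangeL ℝ e₁ x : E →L[ℝ] E) + (μ x - 1) •
        ∑ i, mvfderiv I z x (e₀.symm x (b i)) •
          ContinuousLinearMap.smulRightL ℝ E E (LinearMap.toContinuousLinearMap (b.coord i))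
            (e₁ ⟨x, Y x⟩).2) (O ∩ (e₀.baseSet ∩ e₁.baseSet)) := by
    refine ((contMDiffOn_coordChangeL (IB := I) (n := ∞) e₀ e₁).mono inter_subset_right).add ?_
    refine ContMDiffOn.smul ((hμ.sub contMDiffOn_const).mono inter_subset_left) ?_
    refine contMDiffOn_finsetSum fun i _ => ?_
    refine ContMDiffOn.smul ((hs i).mono fun x hx => hx.2.1) ?_
    exact (ContinuousLinearMap.contMDiff _).comp_contMDiffOn (hY.mono fun x hx => hx.2.2)
  refine hmain.congr fun x hx => ?_
  ext v
  have h0 := hx.2.1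
  have h1 := hx.2.2
  have hv : e₀.symm x v = ∑ i, b.coord i v • e₀.symm x (b i) := by
    have : ∀ w, e₀.symm x w = e₀.symmL ℝ x w := fun w => (e₀.symmL_apply h0 w).symm
    conv_lhs => rw [← b.sum_repr v, this, map_sum]
    simp [this]
  have hlin : (e₁ ⟨x, twist z Y (μ x) x (e₀.symm x v)⟩).2 =
      (e₁ ⟨x, e₀.symm x v⟩).2 + ((μ x - 1) * mvfderiv I z x (e₀.symm x v)) • (e₁ ⟨x, Y x⟩).2 := by
    rw [twist_apply]
    have hl := e₁.linear ℝ h1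
    rw [hl.map_add, hl.map_smul]
  have h2 : readTwist z Y x₀ x₁ (μ x) x v = (e₁ ⟨x, twist z Y (μ x) x (e₀.symm x v)⟩).2 := by
    simp only [readTwist, ContinuousLinearMap.comp_apply]
    rw [Trivialization.continuousLinearMapAt_apply, Trivialization.coe_linearMapAt_of_mem _ h1,
      Trivialization.symmL_apply e₀ h0]
  have h3 : mvfderiv I z x (e₀.symm x v) = ∑ i, b.coord i v * mvfderiv I z x (e₀.symm x (b i)) := by
    rw [hv, map_sum]
    simp
  rw [h2, hlin, h3, add_apply, ContinuousLinearEquiv.coe_coe,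
    Trivialization.coordChangeL_apply e₀ e₁ ⟨h0, h1⟩]
  simp [Finset.mul_sum, Finset.sum_smul, Finset.smul_sum, smul_smul, mul_comm, mul_assoc]

end Twist

/-- Two continuous lifts of a map to a vector bundle that agree on a dense set agree. -/
theorem lift_eq_of_dense {N B F : Type*} [TopologicalSpace N] [TopologicalSpace B]
    [NormedAddCommGroup F] {V : B → Type*}
    [TopologicalSpace (TotalSpace F V)] [∀ x, TopologicalSpace (V x)] [FiberBundle F V]
    {φ : N → B} {s t : ∀ q, V (φ q)}
    (hs : Continuous fun q => (⟨φ q, s q⟩ : TotalSpace F V))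
    (ht : Continuous fun q => (⟨φ q, t q⟩ : TotalSpace F V))
    {S : Set N} (hS : Dense S) (h : ∀ q ∈ S, s q = t q) (q : N) : s q = t q := by
  have h1 := ((FiberBundle.continuousAt_totalSpace F _).1 (hs.continuousAt (x := q))).2
  have h2 := ((FiberBundle.continuousAt_totalSpace F _).1 (ht.continuousAt (x := q))).2
  set e := trivializationAt F V (φ q)
  have h3 : (e ⟨φ q, s q⟩).2 = (e ⟨φ q, t q⟩).2 := by
    by_contra hne
    have hev := (h1.prodMk h2).eventually ((isClosed_diagonal.isOpen_compl).mem_nhds hne)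
    obtain ⟨y, hyS, hy⟩ := ((mem_closure_iff_frequently.1 (hS q)).and_eventually hev).exists
    exact hy (by simp only [mem_diagonal_iff]; rw [h y hyS])
  have hb : φ q ∈ e.baseSet := FiberBundle.mem_baseSet_trivializationAt' _
  have h4 : e ⟨φ q, s q⟩ = e ⟨φ q, t q⟩ := by
    refine Prod.ext ?_ h3
    rw [e.coe_fst (e.mem_source.2 hb), e.coe_fst (e.mem_source.2 hb)]
  have h5 := e.injOn (e.mem_source.2 hb) (e.mem_source.2 hb) h4
  exact TotalSpace.mk_inj.1 h5

section Extensionality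

variable {E : Type} [NormedAddCommGroup E] [NormedSpace ℝ E] [FiniteDimensional ℝ E]
  {H : Type*} [TopologicalSpace H] {I : ModelWithCorners ℝ E H} [I.Boundaryless]
  {M : Type*} [TopologicalSpace M] [ChartedSpace H M] [IsManifold I ∞ M]
  [T2Space M] [SigmaCompactSpace M]

theorem SmoothVF.ext_lieDeriv {X Y : SmoothVF I M} (h : ∀ f, lieDeriv X f = lieDeriv Y f) :
    X = Y := by
  ext x
  refine eq_of_forall_mvfderiv_eq fun f => ?_
  exact congrArg (fun g : SmoothFn I M => g x) (h f)

theorem lieDeriv_smul_left (c : ℝ) (X : SmoothVF I M) (f : SmoothFn I M) :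
    lieDeriv (c • X) f = c • lieDeriv X f := by
  ext x
  simp [lieDeriv_apply]

theorem lieDeriv_smul (c : ℝ) (X : SmoothVF I M) (f : SmoothFn I M) :
    lieDeriv X (c • f) = c • lieDeriv X f := by
  ext x
  have h := mvfderiv_smul (I := I) (x := x) (a := fun _ : M => c) mdifferentiableAt_const
    (f.mdifferentiableAt x)
  have h' : mvfderiv I (c • f) x = mvfderiv I (fun y => (fun _ : M => c) y • f y) x := rfl
  simp only [lieDeriv_apply, ContMDiffMap.coe_smul, Pi.smul_apply] at h ⊢
  exact (congrArg (fun L : TangentSpace I x →L[ℝ] ℝ => L (X x)) h).trans (by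
    simp [mvfderiv_const])

variable [CompleteSpace E]

theorem bracketVF_self (X : SmoothVF I M) : bracketVF X X = 0 := by
  refine SmoothVF.ext_lieDeriv fun f => ?_
  rw [lieDeriv_bracketVF, sub_self]
  ext x
  simp [lieDeriv_apply]

theorem bracketVF_add_left (X X' Y : SmoothVF I M) :
    bracketVF (X + X') Y = bracketVF X Y + bracketVF X' Y := by
  refine SmoothVF.ext_lieDeriv fun f => ?_
  simp only [lieDeriv_bracketVF, lieDeriv_add_left, lieDeriv_add]
  abel

theorem bracketVF_add_right (X Y Y' : SmoothVF I M) :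
    bracketVF X (Y + Y') = bracketVF X Y + bracketVF X Y' := by
  refine SmoothVF.ext_lieDeriv fun f => ?_
  simp only [lieDeriv_bracketVF, lieDeriv_add_left, lieDeriv_add]
  abel

theorem bracketVF_smul_left (c : ℝ) (X Y : SmoothVF I M) :
    bracketVF (c • X) Y = c • bracketVF X Y := by
  refine SmoothVF.ext_lieDeriv fun f => ?_
  simp only [lieDeriv_bracketVF, lieDeriv_smul_left, lieDeriv_smul, smul_sub]

theorem bracketVF_smul_right (c : ℝ) (X Y : SmoothVF I M) :
    bracketVF X (c • Y) = c • bracketVF X Y := by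
  refine SmoothVF.ext_lieDeriv fun f => ?_
  simp only [lieDeriv_bracketVF, lieDeriv_smul_left, lieDeriv_smul, smul_sub]

theorem bracketVF_jacobi (X Y W : SmoothVF I M) :
    bracketVF X (bracketVF Y W) = bracketVF (bracketVF X Y) W + bracketVF Y (bracketVF X W) := by
  refine SmoothVF.ext_lieDeriv fun f => ?_
  simp only [lieDeriv_bracketVF, lieDeriv_add_left, lieDeriv_sub]
  abel

theorem bracketVF_smulSection (X Y : SmoothVF I M) (h : SmoothFn I M) :
    bracketVF X (smulSection h Y) = smulSection h (bracketVF X Y) +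
      smulSection (lieDeriv X h) Y := by
  refine SmoothVF.ext_lieDeriv fun f => ?_
  simp only [lieDeriv_bracketVF, lieDeriv_add_left, lieDeriv_smulSection, lieDeriv_mul]
  ring

end Extensionality

section OfInjectiveAnchor

variable {E : Type} [NormedAddCommGroup E] [NormedSpace ℝ E] [FiniteDimensional ℝ E]
  {H : Type*} [TopologicalSpace H] {I : ModelWithCorners ℝ E H} [I.Boundaryless]
  {M : Type*} [TopologicalSpace M] [ChartedSpace H M] [IsManifold I ∞ M]
  [T2Space M] [SigmaCompactSpace M] [CompleteSpace E]
  {Fib : Type w₁} [NormedAddCommGroup Fib] [NormedSpace ℝ Fib]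
  {V : M → Type w₂} [TopologicalSpace (TotalSpace Fib V)]
  [∀ x, AddCommGroup (V x)] [∀ x, Module ℝ (V x)] [∀ x, TopologicalSpace (V x)]
  [FiberBundle Fib V] [VectorBundle ℝ Fib V]

/-- The map on sections induced by a smooth bundle map to the tangent bundle. -/
def mapSection (ρ : ∀ x, V x →ₗ[ℝ] TangentSpace I x)
    (hρ : ContMDiff (I.prod 𝓘(ℝ, Fib)) I.tangent ∞
      (fun v : TotalSpace Fib V => (⟨v.1, ρ v.1 v.2⟩ : TangentBundle I M)))
    (a : ContMDiffSection I Fib ∞ V) : SmoothVF I M :=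
  ⟨fun x => ρ x (a x), hρ.comp a.contMDiff⟩

/-- A vector bundle with an anchor that is injective on sections and has involutive image is
a Lie algebroid. -/
def LieAlgebroid.ofInjectiveAnchor [FiniteDimensional ℝ Fib] [ContMDiffVectorBundle ∞ Fib V I]
    (ρ : ∀ x, V x →ₗ[ℝ] TangentSpace I x)
    (hρ : ContMDiff (I.prod 𝓘(ℝ, Fib)) I.tangent ∞
      (fun v : TotalSpace Fib V => (⟨v.1, ρ v.1 v.2⟩ : TangentBundle I M)))
    (hinj : Function.Injective (mapSection ρ hρ))
    (br : ContMDiffSection I Fib ∞ V → ContMDiffSection I Fib ∞ V → ContMDiffSection I Fib ∞ V)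
    (hch : ∀ a b, mapSection ρ hρ (br a b) = bracketVF (mapSection ρ hρ a) (mapSection ρ hρ b)) :
    LieAlgebroid.{w₁, w₂} I M :=
  have hadd : ∀ a b, mapSection ρ hρ (a + b) = mapSection ρ hρ a + mapSection ρ hρ b :=
    fun a b => by ext x; exact map_add (ρ x) _ _
  have hsmul : ∀ (c : ℝ) a, mapSection ρ hρ (c • a) = c • mapSection ρ hρ a :=
    fun c a => by ext x; exact map_smul (ρ x) _ _
  { Fib := Fib
    V := V
    anchor := ρ
    contMDiff_anchor := hρ
    bracket := LinearMap.mk₂ ℝ br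
      (fun a a' b => hinj (by simp only [hch, hadd, bracketVF_add_left]))
      (fun c a b => hinj (by simp only [hch, hsmul, bracketVF_smul_left]))
      (fun a b b' => hinj (by simp only [hch, hadd, bracketVF_add_right]))
      (fun c a b => hinj (by simp only [hch, hsmul, bracketVF_smul_right]))
    bracket_self := fun a => hinj (by
      have h0 : mapSection ρ hρ 0 = 0 := by ext x; exact map_zero (ρ x)
      rw [h0, LinearMap.mk₂_apply, hch, bracketVF_self])
    jacobi := fun a b c => hinj (by
      simp only [LinearMap.mk₂_apply, hch, hadd]; exact bracketVF_jacobi _ _ _)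
    leibniz := fun a b f x => by
      have h1 : br a (smulSection f b) = smulSection f (br a b) +
          smulSection (lieDeriv (mapSection ρ hρ a) f) b := by
        refine hinj ?_
        have h2 : ∀ (f : SmoothFn I M) c,
            mapSection ρ hρ (smulSection f c) = smulSection f (mapSection ρ hρ c) :=
          fun f c => by ext x; exact map_smul (ρ x) _ _
        rw [hadd, h2, h2, hch, hch, h2, bracketVF_smulSection]
      exact congrArg (fun c : ContMDiffSection I Fib ∞ V => c x) h1
    anchor_bracket := fun a b x => congrArg (fun c : SmoothVF I M => c x) (hch a b) }

end OfInjectiveAnchor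

section BkBundle

variable {E : Type} [NormedAddCommGroup E] [NormedSpace ℝ E] [FiniteDimensional ℝ E]
  {H : Type*} [TopologicalSpace H] {I : ModelWithCorners ℝ E H}
  {M : Type*} [TopologicalSpace M] [ChartedSpace H M] [IsManifold I ∞ M] {Z : Set M}

theorem contMDiffOn_trivializationAt_symm (p : M) {O : Set M} (hO : IsOpen O)
    (hOp : O ⊆ (trivializationAt E (TangentSpace I : M → Type) p).baseSet) {f : M → E}
    (hf : ContMDiffOn I 𝓘(ℝ, E) ∞ f O) :
    ContMDiffOn I I.tangent ∞ (fun x => (⟨x,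
      (trivializationAt E (TangentSpace I : M → Type) p).symm x (f x)⟩ : TangentBundle I M)) O := by
  refine ((trivializationAt E (TangentSpace I : M → Type) p).contMDiffOn_section_iff
    (IB := I) (n := ∞) hO hOp).2 ?_
  refine hf.congr fun x hx => ?_
  rw [Trivialization.apply_mk_symm _ (hOp hx)]

namespace DefiningData

variable (D : DefiningData I Z) (k : ℕ)

/-- The two kinds of charts of the `b^k`-tangent bundle: away from `Z` and near `Z`. -/
def chartDomain : Bool → Set M
  | false => Zᶜ
  | true => D.U₁

/-- The factor by which the anchor multiplies `Y`, in the two kinds of charts. -/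
def anchorFactor : Bool → M → ℝ
  | false, _ => 1
  | true, x => D.z x ^ k

/-- The quotients of anchor factors. -/
def factorRatio : Bool → Bool → M → ℝ
  | true, false, x => D.z x ^ k
  | false, true, x => (D.z x ^ k)⁻¹
  | _, _, _ => 1

theorem isOpen_chartDomain (b : Bool) : IsOpen (D.chartDomain b) := by
  cases b
  exacts [D.isClosed.isOpen_compl, D.isOpen_U₁]

theorem mvfderiv_z_Y {x : M} (hx : x ∈ D.U₁) : mvfderiv I D.z x (D.Y x) = 1 := D.lieDeriv_Y x hx

theorem pow_z_ne_zero {x : M} (hx : x ∈ D.U₁) (hxZ : x ∉ Z) : D.z x ^ k ≠ 0 :=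
  pow_ne_zero k fun h => hxZ ((D.mem_iff x (subset_closure (D.U₁_subset hx))).2 h)

theorem twist_factorRatio_comp {b b' b'' : Bool} {x : M} (h : x ∈ D.chartDomain b)
    (h' : x ∈ D.chartDomain b') (h'' : x ∈ D.chartDomain b'') (v : TangentSpace I x) :
    twist D.z D.Y (D.factorRatio k b' b'' x) x (twist D.z D.Y (D.factorRatio k b b' x) x v) =
      twist D.z D.Y (D.factorRatio k b b'' x) x v := by
  cases b <;> cases b' <;> cases b'' <;> simp only [factorRatio, twist_one]
  · rw [twist_twist _ _ (D.mvfderiv_z_Y h'), mul_inv_cancel₀ (D.pow_z_ne_zero k h' h), twist_one]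
  · rw [twist_twist _ _ (D.mvfderiv_z_Y h), inv_mul_cancel₀ (D.pow_z_ne_zero k h h'), twist_one]

theorem twist_anchorFactor {b b' : Bool} {x : M} (h : x ∈ D.chartDomain b)
    (h' : x ∈ D.chartDomain b') (v : TangentSpace I x) :
    twist D.z D.Y (D.anchorFactor k b' x) x (twist D.z D.Y (D.factorRatio k b b' x) x v) =
      twist D.z D.Y (D.anchorFactor k b x) x v := by
  cases b <;> cases b' <;> simp only [factorRatio, anchorFactor, twist_one]
  rw [twist_twist _ _ (D.mvfderiv_z_Y h'), mul_inv_cancel₀ (D.pow_z_ne_zero k h' h), twist_one]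

theorem contMDiffOn_anchorFactor (b : Bool) :
    ContMDiffOn I 𝓘(ℝ, ℝ) ∞ (D.anchorFactor k b) (D.chartDomain b) := by
  cases b
  exacts [contMDiffOn_const, (D.z.contMDiff.pow k).contMDiffOn]

theorem contMDiffOn_factorRatio (b b' : Bool) :
    ContMDiffOn I 𝓘(ℝ, ℝ) ∞ (D.factorRatio k b b') (D.chartDomain b ∩ D.chartDomain b') := by
  cases b <;> cases b'
  · exact contMDiffOn_const
  · exact (D.z.contMDiff.pow k).contMDiffOn.inv₀ fun x hx => D.pow_z_ne_zero k hx.2 hx.1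
  · exact (D.z.contMDiff.pow k).contMDiffOn
  · exact contMDiffOn_const

open Classical in
/-- The transition functions of the `b^k`-tangent bundle. -/
def bundleCore : VectorBundleCore ℝ M E (M × Bool) where
  baseSet i := D.chartDomain i.2 ∩ (trivializationAt E (TangentSpace I : M → Type) i.1).baseSet
  isOpen_baseSet i := (D.isOpen_chartDomain i.2).inter (Trivialization.open_baseSet _)
  indexAt x := (x, decide (x ∈ Z))
  mem_baseSet_at x := by
    refine ⟨?_, FiberBundle.mem_baseSet_trivializationAt' _⟩
    by_cases hx : x ∈ Z
    · simpa [hx, chartDomain] using D.subset_U₁ hx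
    · simp [hx, chartDomain]
  coordChange i j x := readTwist D.z D.Y i.1 j.1 (D.factorRatio k i.2 j.2 x) x
  coordChange_self i x hx v := by
    have : D.factorRatio k i.2 i.2 x = 1 := by cases i.2 <;> rfl
    rw [this]
    simp only [readTwist, ContinuousLinearMap.comp_apply, twist_one]
    exact Trivialization.continuousLinearMapAt_symmL _ hx.2 v
  continuousOn_coordChange i j := by
    refine (contMDiffOn_readTwist D.z D.Y i.1 j.1
      (D.contMDiffOn_factorRatio k i.2 j.2)).continuousOn.mono ?_
    exact fun x hx => ⟨⟨hx.1.1, hx.2.1⟩, hx.1.2, hx.2.2⟩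
  coordChange_comp i j l x hx v := by
    simp only [readTwist, ContinuousLinearMap.comp_apply]
    rw [Trivialization.symmL_continuousLinearMapAt _ hx.1.2.2,
      D.twist_factorRatio_comp k hx.1.1.1 hx.1.2.1 hx.2.1]

instance : (D.bundleCore k).IsContMDiff I ∞ where
  contMDiffOn_coordChange i j := by
    refine (contMDiffOn_readTwist D.z D.Y i.1 j.1 (D.contMDiffOn_factorRatio k i.2 j.2)).mono ?_
    exact fun x hx => ⟨⟨hx.1.1, hx.2.1⟩, hx.1.2, hx.2.2⟩

/-- The anchor in the chart `i`. -/
def chartAnchor (i : M × Bool) (x : M) : E →L[ℝ] TangentSpace I x :=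
  twist D.z D.Y (D.anchorFactor k i.2 x) x ∘L
    (trivializationAt E (TangentSpace I : M → Type) i.1).symmL ℝ x

/-- The anchor of the `b^k`-tangent bundle. -/
def anchor (x : M) : (D.bundleCore k).Fiber x →ₗ[ℝ] TangentSpace I x :=
  (D.chartAnchor k ((D.bundleCore k).indexAt x) x).toLinearMap

theorem chartAnchor_coordChange {i j : M × Bool} {x : M} (hi : x ∈ (D.bundleCore k).baseSet i)
    (hj : x ∈ (D.bundleCore k).baseSet j) (v : E) :
    D.chartAnchor k j x ((D.bundleCore k).coordChange i j x v) = D.chartAnchor k i x v := by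
  have h := (trivializationAt E (TangentSpace I : M → Type) j.1).symmL_continuousLinearMapAt
    (R := ℝ) hj.2 (twist D.z D.Y (D.factorRatio k i.2 j.2 x) x
      ((trivializationAt E (TangentSpace I : M → Type) i.1).symmL ℝ x v))
  refine (congrArg (twist D.z D.Y (D.anchorFactor k j.2 x) x) h).trans ?_
  exact D.twist_anchorFactor k hi.1 hj.1 _

theorem anchor_eq {i : M × Bool} {x : M} (hi : x ∈ (D.bundleCore k).baseSet i)
    (v : (D.bundleCore k).Fiber x) :
    D.anchor k x v = D.chartAnchor k i x (((D.bundleCore k).localTriv i) ⟨x, v⟩).2 := by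
  rw [VectorBundleCore.localTriv_apply]
  exact (D.chartAnchor_coordChange k ((D.bundleCore k).mem_baseSet_at x) hi v).symm

theorem contMDiff_anchor : ContMDiff (I.prod 𝓘(ℝ, E)) I.tangent ∞
    (fun v : TotalSpace E (D.bundleCore k).Fiber =>
      (⟨v.1, D.anchor k v.1 v.2⟩ : TangentBundle I M)) := by
  intro v₀
  rw [contMDiffAt_totalSpace]
  refine ⟨contMDiffAt_proj _, ?_⟩
  set x₀ := v₀.1
  set i := (D.bundleCore k).indexAt x₀
  have hi : x₀ ∈ (D.bundleCore k).baseSet i := (D.bundleCore k).mem_baseSet_at x₀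
  have hO : (D.bundleCore k).baseSet i ∈ 𝓝 x₀ := ((D.bundleCore k).isOpen_baseSet i).mem_nhds hi
  have h1 : ContMDiffAt I 𝓘(ℝ, E →L[ℝ] E) ∞
      (fun x => readTwist D.z D.Y x₀ x₀ (D.anchorFactor k i.2 x) x) x₀ :=
    (contMDiffOn_readTwist D.z D.Y x₀ x₀ (D.contMDiffOn_anchorFactor k i.2)).contMDiffAt
      (by filter_upwards [hO] with x hx using ⟨hx.1, hx.2, hx.2⟩)
  have h2 : ContMDiffAt (I.prod 𝓘(ℝ, E)) 𝓘(ℝ, E) ∞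
      (fun v : TotalSpace E (D.bundleCore k).Fiber => ((D.bundleCore k).localTriv i v).2) v₀ := by
    have := ((trivializationAt E (D.bundleCore k).Fiber x₀).contMDiffOn (IB := I) (n := ∞)
      ).contMDiffAt (x := v₀) ((trivializationAt E (D.bundleCore k).Fiber x₀).open_source.mem_nhds
        (Trivialization.mem_source _ |>.2 (FiberBundle.mem_baseSet_trivializationAt' _)))
    exact this.snd
  refine ((h1.comp v₀ (contMDiffAt_proj _)).clm_apply h2).congr_of_eventuallyEq ?_
  filter_upwards [(FiberBundle.continuous_proj E (D.bundleCore k).Fiber).continuousAt.preimage_mem_nhds hO] with v hv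
  rw [D.anchor_eq k hv]
  simp only [Function.comp, readTwist, ContinuousLinearMap.comp_apply]
  exact (Trivialization.continuousLinearMapAt_apply_of_mem ℝ _ hv.2 _).symm

/-- The vector field `X`, divided by the anchor factor in the direction of `Y`. -/
def chartLift (X : SmoothVF I M) (c : SmoothFn I M) : Bool → SmoothVF I M
  | false => X
  | true => X + smulSection (c - lieDeriv X D.z) D.Y

theorem twist_chartLift {X : SmoothVF I M} {c : SmoothFn I M}
    (h : ∀ x ∈ D.U, lieDeriv X D.z x = D.z x ^ k * c x) {b b' : Bool} {x : M}
    (hb : x ∈ D.chartDomain b) (hb' : x ∈ D.chartDomain b') :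
    twist D.z D.Y (D.factorRatio k b b' x) x (D.chartLift X c b x) = D.chartLift X c b' x := by
  have key : ∀ y ∈ D.U₁, D.chartLift X c true y =
      X y + (c y - mvfderiv I D.z y (X y)) • D.Y y := fun y _ => rfl
  cases b <;> cases b' <;> simp only [factorRatio, twist_one]
  · rw [key x hb', twist_apply]
    have h1 : mvfderiv I D.z x (X x) = D.z x ^ k * c x := h x (D.U₁_subset hb')
    change X x + _ = _
    have h2 : D.chartLift X c false x = X x := rfl
    rw [h2, h1, sub_mul, one_mul, inv_mul_cancel_left₀ (D.pow_z_ne_zero k hb' hb)]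
  · rw [key x hb, twist_apply, map_add, map_smul, D.mvfderiv_z_Y hb, add_assoc, ← add_smul]
    have h1 : mvfderiv I D.z x (X x) = D.z x ^ k * c x := h x (D.U₁_subset hb)
    have h2 : D.chartLift X c false x = X x := rfl
    rw [h2, h1]
    convert add_zero (X x)
    convert zero_smul ℝ (D.Y x)
    simp only [smul_eq_mul]
    ring

theorem twist_anchorFactor_chartLift {X : SmoothVF I M} {c : SmoothFn I M}
    (h : ∀ x ∈ D.U, lieDeriv X D.z x = D.z x ^ k * c x) {b : Bool} {x : M}
    (hb : x ∈ D.chartDomain b) :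
    twist D.z D.Y (D.anchorFactor k b x) x (D.chartLift X c b x) = X x := by
  cases b
  · exact twist_one _ _ _ _
  · have h1 : mvfderiv I D.z x (X x) = D.z x ^ k * c x := h x (D.U₁_subset hb)
    change twist D.z D.Y (D.z x ^ k) x (X x + (c x - mvfderiv I D.z x (X x)) • D.Y x) = X x
    rw [twist_apply, map_add, map_smul, D.mvfderiv_z_Y hb, add_assoc, ← add_smul, h1]
    convert add_zero (X x)
    convert zero_smul ℝ (D.Y x)
    simp only [smul_eq_mul]
    ring

theorem exists_section_anchor_eq {X : SmoothVF I M} {c : SmoothFn I M}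
    (h : ∀ x ∈ D.U, lieDeriv X D.z x = D.z x ^ k * c x) :
    ∃ a : ContMDiffSection I E ∞ (D.bundleCore k).Fiber, ∀ x, D.anchor k x (a x) = X x := by
  set B := D.bundleCore k
  set a : ∀ x, B.Fiber x := fun x =>
    ((trivializationAt E (TangentSpace I : M → Type) (B.indexAt x).1)
      ⟨x, D.chartLift X c (B.indexAt x).2 x⟩).2
  have hread : ∀ (i : M × Bool) (x : M), x ∈ B.baseSet i → (B.localTriv i ⟨x, a x⟩).2 =
      ((trivializationAt E (TangentSpace I : M → Type) i.1) ⟨x, D.chartLift X c i.2 x⟩).2 := by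
    intro i x hi
    have hj := B.mem_baseSet_at x
    rw [VectorBundleCore.localTriv_apply]
    have h1 : (trivializationAt E (TangentSpace I : M → Type) (B.indexAt x).1).symmL ℝ x (a x) =
        D.chartLift X c (B.indexAt x).2 x := by
      have := (trivializationAt E (TangentSpace I : M → Type) (B.indexAt x).1
        ).symmL_continuousLinearMapAt (R := ℝ) hj.2 (D.chartLift X c (B.indexAt x).2 x)
      rwa [Trivialization.continuousLinearMapAt_apply_of_mem ℝ _ hj.2] at this
    change readTwist D.z D.Y (B.indexAt x).1 i.1 _ x (a x) = _
    rw [readTwist, ContinuousLinearMap.comp_apply, ContinuousLinearMap.comp_apply, h1]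
    refine (congrArg _ (D.twist_chartLift k h hj.1 hi.1)).trans ?_
    exact Trivialization.continuousLinearMapAt_apply_of_mem ℝ _ hi.2 _
  refine ⟨⟨a, fun x₀ => ?_⟩, fun x => ?_⟩
  · rw [contMDiffAt_section]
    have hi := B.mem_baseSet_at x₀
    have h1 := (contMDiffAt_section x₀).1 (D.chartLift X c (B.indexAt x₀).2).contMDiff.contMDiffAt
    refine h1.congr_of_eventuallyEq ?_
    filter_upwards [(B.isOpen_baseSet _).mem_nhds hi] with x hx using hread _ x hx
  · have hi := B.mem_baseSet_at x
    change D.anchor k x (a x) = X x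
    rw [D.anchor_eq k hi, hread _ _ hi]
    have h1 := (trivializationAt E (TangentSpace I : M → Type) (B.indexAt x).1
        ).symmL_continuousLinearMapAt (R := ℝ) hi.2 (D.chartLift X c (B.indexAt x).2 x)
    rw [Trivialization.continuousLinearMapAt_apply_of_mem ℝ _ hi.2] at h1
    refine (congrArg (twist D.z D.Y (D.anchorFactor k (B.indexAt x).2 x) x) h1).trans ?_
    exact D.twist_anchorFactor_chartLift k h hi.1

theorem anchor_injective {x : M} (hx : x ∉ Z) : Function.Injective (D.anchor k x) := by
  have hi : x ∈ (D.bundleCore k).baseSet (x, false) :=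
    ⟨hx, FiberBundle.mem_baseSet_trivializationAt' _⟩
  intro v w h
  rw [D.anchor_eq k hi, D.anchor_eq k hi] at h
  have h1 : ∀ u, D.chartAnchor k (x, false) x u =
      (trivializationAt E (TangentSpace I : M → Type) x).symmL ℝ x u := fun u => twist_one _ _ _ _
  rw [h1, h1] at h
  have h2 := congrArg ((trivializationAt E (TangentSpace I : M → Type) x
    ).continuousLinearMapAt ℝ x) h
  rw [Trivialization.continuousLinearMapAt_symmL _ hi.2,
    Trivialization.continuousLinearMapAt_symmL _ hi.2] at h2
  have hs : ∀ u, (⟨x, u⟩ : TotalSpace E (D.bundleCore k).Fiber) ∈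
      ((D.bundleCore k).localTriv (x, false)).source := fun u =>
    (Trivialization.mem_source _).2 hi
  have h3 := ((D.bundleCore k).localTriv (x, false)).injOn (hs v) (hs w) (Prod.ext
    ((Trivialization.coe_fst _ (hs v)).trans (Trivialization.coe_fst _ (hs w)).symm) h2)
  exact TotalSpace.mk_inj.1 h3

variable [I.Boundaryless] [T2Space M] [SigmaCompactSpace M]

theorem mapSection_injective :
    Function.Injective (mapSection (D.anchor k) (D.contMDiff_anchor k)) := by
  intro a b h
  ext x
  refine lift_eq_of_dense a.contMDiff.continuous b.contMDiff.continuous D.dense_compl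
    (fun y hy => D.anchor_injective k hy ?_) x
  exact congrArg (fun X : SmoothVF I M => X y) h

theorem contMDiffOn_localTriv_snd (a : ContMDiffSection I E ∞ (D.bundleCore k).Fiber)
    (i : M × Bool) : ContMDiffOn I 𝓘(ℝ, E) ∞
      (fun x => (((D.bundleCore k).localTriv i) ⟨x, a x⟩).2) ((D.bundleCore k).baseSet i) := by
  have : MemTrivializationAtlas ((D.bundleCore k).localTriv i) := ⟨⟨_, rfl⟩⟩
  exact (((D.bundleCore k).localTriv i).contMDiffOn_section_baseSet_iff
    (IB := I) (n := ∞)).1 a.contMDiff.contMDiffOn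

theorem exists_local_section (a : ContMDiffSection I E ∞ (D.bundleCore k).Fiber) (p : M) :
    ∃ u : ∀ x : M, TangentSpace I x,
      ContMDiffOn I I.tangent ∞ (fun x => (⟨x, u x⟩ : TangentBundle I M))
        ((D.bundleCore k).baseSet (p, true)) ∧
      ∀ x ∈ (D.bundleCore k).baseSet (p, true),
        D.anchor k x (a x) = twist D.z D.Y (D.z x ^ k) x (u x) := by
  refine ⟨_, contMDiffOn_trivializationAt_symm p ((D.bundleCore k).isOpen_baseSet (p, true))
    inter_subset_right (D.contMDiffOn_localTriv_snd k a (p, true)), fun x hx => ?_⟩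
  rw [D.anchor_eq k hx]
  generalize (((D.bundleCore k).localTriv (p, true)) ⟨x, a x⟩).2 = w
  have h := (trivializationAt E (TangentSpace I : M → Type) p).symmL_apply (R := ℝ) hx.2 w
  exact congrArg (twist D.z D.Y (D.z x ^ k) x) h

theorem range_mapSection :
    range (mapSection (D.anchor k) (D.contMDiff_anchor k)) = D.fields k := by
  ext X
  constructor
  · rintro ⟨a, rfl⟩
    obtain ⟨g, hg⟩ := D.exists_eq_pow_mul_of_local k
      (f := lieDeriv (mapSection (D.anchor k) (D.contMDiff_anchor k) a) D.z) fun p hp => by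
        obtain ⟨u, hu, h⟩ := D.exists_local_section k a p
        refine ⟨fun x => mvfderiv I D.z x (u x), _, ((D.bundleCore k).isOpen_baseSet (p, true)).mem_nhds
          ⟨D.subset_U₁ hp, FiberBundle.mem_baseSet_trivializationAt' _⟩,
          contMDiffOn_mvfderiv_apply D.z hu, fun x hx => ?_⟩
        change mvfderiv I D.z x (D.anchor k x (a x)) = _
        rw [h x hx, twist_apply, map_add, map_smul, D.mvfderiv_z_Y hx.1, smul_eq_mul]
        ring
    exact D.mem_vanishingIdeal_pow_of_eq hg
  · intro hX
    obtain ⟨g, hg⟩ := D.mem_vanishingIdeal_pow_iff.1 hX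
    obtain ⟨a, ha⟩ := D.exists_section_anchor_eq k hg
    exact ⟨a, by ext x; exact ha x⟩

/-- The `b^k`-tangent bundle exists. -/
theorem exists_isBkTangentBundle [CompleteSpace E] (hk : 1 ≤ k) :
    ∃ A : LieAlgebroid.{0, 0} I M, IsBkTangentBundle (jetOf I Z k D.z) A := by
  have hbr : ∀ a b, ∃ c, mapSection (D.anchor k) (D.contMDiff_anchor k) c =
      bracketVF (mapSection (D.anchor k) (D.contMDiff_anchor k) a)
        (mapSection (D.anchor k) (D.contMDiff_anchor k) b) := fun a b => by
    have h := D.bracketVF_mem_fields hk (X := mapSection (D.anchor k) (D.contMDiff_anchor k) a)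
      (Y := mapSection (D.anchor k) (D.contMDiff_anchor k) b)
      (by rw [← D.range_mapSection k]; exact mem_range_self _)
      (by rw [← D.range_mapSection k]; exact mem_range_self _)
    rwa [← D.range_mapSection k] at h
  choose br hbr using hbr
  refine ⟨LieAlgebroid.ofInjectiveAnchor (D.anchor k) (D.contMDiff_anchor k)
    (D.mapSection_injective k) br hbr, D.mapSection_injective k, ?_⟩
  rw [D.bkVectorFields_eq hk, ← D.range_mapSection k]
  rfl

end DefiningData

end BkBundle

section CircleForm

variable {E : Type*} [NormedAddCommGroup E] [NormedSpace ℝ E]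
  {H : Type*} [TopologicalSpace H] {I : ModelWithCorners ℝ E H}
  {M : Type*} [TopologicalSpace M] [ChartedSpace H M]

theorem contMDiff_coe_circle : ContMDiff (𝓡 1) 𝓘(ℝ, ℂ) ∞ (fun u : Circle => (u : ℂ)) :=
  have : Fact (Module.finrank ℝ ℂ = 1 + 1) := ⟨Complex.finrank_real_complex⟩
  contMDiff_coe_sphere (n := 1)

theorem circleForm_congr {w w' : Circle} (h : w = w') (v : EuclideanSpace ℝ (Fin 1)) :
    circleForm w v = circleForm w' v := by
  subst h
  rfl

theorem mvfderiv_eq_fderiv {F G : Type*} [NormedAddCommGroup F] [NormedSpace ℝ F]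
    [NormedAddCommGroup G] [NormedSpace ℝ G] (f : F → G) (x : F) :
    mvfderiv 𝓘(ℝ, F) f x = fderiv ℝ f x := by
  ext v
  exact congrArg (fun L : F →L[ℝ] G => L v) mfderiv_eq_fderiv

theorem mvfderiv_comp_apply' {E' : Type*} [NormedAddCommGroup E'] [NormedSpace ℝ E']
    {H' : Type*} [TopologicalSpace H'] {J : ModelWithCorners ℝ E' H'}
    {N : Type*} [TopologicalSpace N] [ChartedSpace H' N]
    {F : Type*} [NormedAddCommGroup F] [NormedSpace ℝ F] {g : N → F} {f : M → N} (x : M)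
    (hg : MDifferentiableAt J 𝓘(ℝ, F) g (f x)) (hf : MDifferentiableAt I J f x)
    (v : TangentSpace I x) :
    mvfderiv I (g ∘ f) x v = mvfderiv J g (f x) (mfderiv I J f x v) :=
  mfderiv_comp_apply x hg hf v

theorem mdifferentiableAt_mul_exp (w₀ : Circle) {a : M → ℝ} {x : M}
    (ha : MDifferentiableAt I 𝓘(ℝ, ℝ) a x) :
    MDifferentiableAt I (𝓡 1) (fun y => w₀ * Circle.exp (a y)) x := by
  have h1 : ContMDiff 𝓘(ℝ, ℝ) (𝓡 1) ∞ (fun t => w₀ * Circle.exp t) :=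
    contMDiff_const.mul contMDiff_circleExp
  exact (h1.mdifferentiableAt (by simp)).comp x ha

theorem circleForm_mfderiv_mul_exp (w₀ : Circle) {a : M → ℝ} {x : M}
    (ha : MDifferentiableAt I 𝓘(ℝ, ℝ) a x) (v : TangentSpace I x) :
    circleForm (w₀ * Circle.exp (a x)) (mfderiv I (𝓡 1) (fun y => w₀ * Circle.exp (a y)) x v) =
      mvfderiv I a x v := by
  have h1 := mvfderiv_comp_apply' (I := I) (J := 𝓡 1) x (g := fun u : Circle => (u : ℂ))
    (f := fun y => w₀ * Circle.exp (a y))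
    (contMDiff_coe_circle.mdifferentiableAt (by simp)) (mdifferentiableAt_mul_exp w₀ ha) v
  have hF : HasDerivAt (fun t : ℝ => (w₀ : ℂ) * Complex.exp (t * Complex.I))
      ((w₀ : ℂ) * (Complex.exp (a x * Complex.I) * Complex.I)) (a x) := by
    have h2 : HasDerivAt (fun t : ℝ => (t : ℂ) * Complex.I) Complex.I (a x) := by
      simpa using (Complex.ofRealCLM.hasDerivAt (x := a x)).mul_const Complex.I
    exact h2.cexp.const_mul _
  have h2 := mvfderiv_comp_apply' (I := I) (J := 𝓘(ℝ, ℝ)) x (f := a)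
    (g := fun t : ℝ => (w₀ : ℂ) * Complex.exp (t * Complex.I))
    hF.differentiableAt.mdifferentiableAt ha v
  have h3 : ((fun u : Circle => (u : ℂ)) ∘ fun y => w₀ * Circle.exp (a y)) =
      (fun t : ℝ => (w₀ : ℂ) * Complex.exp (t * Complex.I)) ∘ a := by
    ext y
    simp [Circle.coe_exp]
  rw [h3, h2] at h1
  have h4 : mvfderiv 𝓘(ℝ, ℝ) (fun t : ℝ => (w₀ : ℂ) * Complex.exp (t * Complex.I)) (a x) =
      fderiv ℝ (fun t : ℝ => (w₀ : ℂ) * Complex.exp (t * Complex.I)) (a x) := by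
    rw [mvfderiv_eq_fderiv]
  have h5 : mvfderiv (𝓡 1) (fun u : Circle => (u : ℂ)) (w₀ * Circle.exp (a x))
      (mfderiv I (𝓡 1) (fun y => w₀ * Circle.exp (a y)) x v) =
      (mvfderiv I a x v : ℝ) • ((w₀ : ℂ) * (Complex.exp (a x * Complex.I) * Complex.I)) := by
    rw [← h1, h4, hF.hasFDerivAt.fderiv]
    rfl
  have h6 : (starRingEnd ℂ ((w₀ * Circle.exp (a x) : Circle) : ℂ)) *
      ((w₀ : ℂ) * Complex.exp (a x * Complex.I)) = 1 := by
    rw [← Circle.coe_exp, ← Circle.coe_mul, ← Complex.normSq_eq_conj_mul_self,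
      Circle.normSq_coe, Complex.ofReal_one]
  change (starRingEnd ℂ ((w₀ * Circle.exp (a x) : Circle) : ℂ) *
    mvfderiv (𝓡 1) (fun u : Circle => (u : ℂ)) (w₀ * Circle.exp (a x))
      (mfderiv I (𝓡 1) (fun y => w₀ * Circle.exp (a y)) x v)).im = _
  rw [h5, mul_smul_comm, ← mul_assoc (w₀ : ℂ), ← mul_assoc, h6]
  simp

/-- A local angle function on the circle. -/
theorem exists_angle (w₀ : Circle) : ∃ (S : Circle → ℝ) (O : Set Circle), IsOpen O ∧ w₀ ∈ O ∧
    S w₀ = 0 ∧ ContMDiffOn (𝓡 1) 𝓘(ℝ, ℝ) ∞ S O ∧ (∀ w, w₀ * Circle.exp (S w) = w) ∧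
    ∀ w ∈ O, mvfderiv (𝓡 1) S w = circleForm w := by
  set S : Circle → ℝ := fun w => Complex.arg (w₀⁻¹ * w : Circle)
  set O : Set Circle := {w | ((w₀⁻¹ * w : Circle) : ℂ) ∈ Complex.slitPlane}
  have hO : IsOpen O := Complex.isOpen_slitPlane.preimage (by fun_prop)
  have hS : ∀ w, w₀ * Circle.exp (S w) = w := fun w => by
    simp only [S, Circle.exp_arg, mul_inv_cancel_left]
  have hsm : ContMDiffOn (𝓡 1) 𝓘(ℝ, ℝ) ∞ S O := fun w hw => by
    have h1 : ContMDiff (𝓡 1) 𝓘(ℝ, ℂ) ∞ (fun w : Circle => ((w₀⁻¹ * w : Circle) : ℂ)) :=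
      contMDiff_coe_circle.comp (contMDiff_const.mul contMDiff_id)
    have h2 : ContDiffAt ℝ ∞ (fun ζ : ℂ => (Complex.log ζ).im) ((w₀⁻¹ * w : Circle) : ℂ) :=
      Complex.imCLM.contDiff.contDiffAt.comp _ ((Complex.contDiffAt_log hw).restrict_scalars ℝ)
    simp only [Complex.log_im] at h2
    exact (h2.contMDiffAt.comp w h1.contMDiffAt).contMDiffWithinAt
  refine ⟨S, O, hO, ?_, ?_, hsm, hS, fun w hw => ?_⟩
  · simp [O]
  · simp [S]
  · ext v
    have h := circleForm_mfderiv_mul_exp w₀ (a := S)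
      ((hsm.contMDiffAt (hO.mem_nhds hw)).mdifferentiableAt (by simp)) v
    have h1 : (fun y => w₀ * Circle.exp (S y)) = id := funext hS
    rw [h1, mfderiv_id] at h
    exact h.symm.trans (circleForm_congr (hS w) v)

theorem circleForm_injective (w : Circle) : Function.Injective (circleForm w) := by
  rw [injective_iff_map_eq_zero]
  intro v hv
  obtain ⟨S, O, hO, hwO, -, hsm, hS, hd⟩ := exists_angle w
  rw [← hd w hwO] at hv
  have h1 : (fun t => w * Circle.exp t) ∘ S = id := funext hS
  have h2 := mfderiv_comp_apply (I := 𝓡 1) (I' := 𝓘(ℝ, ℝ)) (I'' := 𝓡 1) w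
    (g := fun t => w * Circle.exp t) (f := S)
    (mdifferentiableAt_mul_exp (I := 𝓘(ℝ, ℝ)) w mdifferentiableAt_id)
    ((hsm.contMDiffAt (hO.mem_nhds hwO)).mdifferentiableAt (by simp)) v
  rw [h1, mfderiv_id] at h2
  have h3 : mfderiv (𝓡 1) 𝓘(ℝ, ℝ) S w v = 0 := hv
  rw [h3, map_zero] at h2
  exact h2

theorem circleForm_surjective (w : Circle) : Function.Surjective (circleForm w) := by
  intro t
  have h := circleForm_mfderiv_mul_exp (I := 𝓘(ℝ, ℝ)) w (a := id) (x := (0 : ℝ))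
    mdifferentiableAt_id t
  have h0 : w * Circle.exp (id (0 : ℝ)) = w := by simp
  rw [h0] at h
  refine ⟨_, h.trans ?_⟩
  rw [mvfderiv_eq_fderiv, fderiv_id]
  rfl

theorem circleForm_mul (w u : Circle) (v : TangentSpace (𝓡 1) u) :
    circleForm (w * u) (mfderiv (𝓡 1) (𝓡 1) (fun y => w * y) u v) = circleForm u v := by
  obtain ⟨S, O, hO, hwO, h0, hsm, hS, hd⟩ := exists_angle u
  have h := circleForm_mfderiv_mul_exp (w * u) (a := S)
    ((hsm.contMDiffAt (hO.mem_nhds hwO)).mdifferentiableAt (by simp)) v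
  rw [hd u hwO] at h
  rw [← h]
  have h1 : (fun y => w * u * Circle.exp (S y)) = fun y => w * y := funext fun y => by
    rw [mul_assoc, hS]
  rw [h1]
  exact circleForm_congr (by rw [h0]; simp) (mfderiv (𝓡 1) (𝓡 1) (fun y => w * y) u v)

end CircleForm

section Product

variable {E : Type*} [NormedAddCommGroup E] [NormedSpace ℝ E]
  {H : Type*} [TopologicalSpace H] {I : ModelWithCorners ℝ E H}
  {M : Type*} [TopologicalSpace M] [ChartedSpace H M]

/-- The differential of the projection `M × S¹ → M`. -/
abbrev dproj (I : ModelWithCorners ℝ E H) (q : M × Circle) :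
    TangentSpace (I.prod (𝓡 1)) q →L[ℝ] TangentSpace I q.1 :=
  mfderiv (I.prod (𝓡 1)) I (Prod.fst : M × Circle → M) q

theorem dproj_dsForm_bijective (q : M × Circle) : Function.Bijective
    ((dproj I q).toLinearMap.prod (dsForm I q).toLinearMap) := by
  have h1 : ∀ v : TangentSpace (I.prod (𝓡 1)) q, dproj I q v = Prod.fst (α := E) v := fun v => by
    rw [dproj, mfderiv_fst]; rfl
  have h2 : ∀ v : TangentSpace (I.prod (𝓡 1)) q, dsForm I q v =
      circleForm q.2 (Prod.snd (α := E) v) := fun v => by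
    rw [dsForm, mfderiv_snd]; rfl
  constructor
  · intro v w h
    have h3 : dproj I q v = dproj I q w := congrArg Prod.fst h
    have h4 : dsForm I q v = dsForm I q w := congrArg Prod.snd h
    rw [h1, h1] at h3
    rw [h2, h2] at h4
    exact Prod.ext h3 (circleForm_injective _ h4)
  · rintro ⟨u, t⟩
    obtain ⟨e, he⟩ := circleForm_surjective q.2 t
    have h3 := h1 ((u, e) : E × EuclideanSpace ℝ (Fin 1))
    have h4 := h2 ((u, e) : E × EuclideanSpace ℝ (Fin 1))
    exact ⟨((u, e) : E × EuclideanSpace ℝ (Fin 1)), Prod.ext h3 (h4.trans he)⟩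

/-- The splitting of the tangent space of `M × S¹`. -/
def splitting (I : ModelWithCorners ℝ E H) (q : M × Circle) :
    TangentSpace (I.prod (𝓡 1)) q ≃ₗ[ℝ] TangentSpace I q.1 × ℝ :=
  LinearEquiv.ofBijective _ (dproj_dsForm_bijective q)

theorem dproj_splitting_symm (q : M × Circle) (u : TangentSpace I q.1) (t : ℝ) :
    dproj I q ((splitting I q).symm (u, t)) = u :=
  congrArg Prod.fst ((splitting I q).apply_symm_apply (u, t))

theorem dsForm_splitting_symm (q : M × Circle) (u : TangentSpace I q.1) (t : ℝ) :
    dsForm I q ((splitting I q).symm (u, t)) = t :=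
  congrArg Prod.snd ((splitting I q).apply_symm_apply (u, t))

theorem tangent_ext {q : M × Circle} {v w : TangentSpace (I.prod (𝓡 1)) q}
    (h1 : dproj I q v = dproj I q w) (h2 : dsForm I q v = dsForm I q w) : v = w :=
  (splitting I q).injective (Prod.ext h1 h2)

theorem mvfderiv_comp_fst {f : M → ℝ} {q : M × Circle} (hf : MDifferentiableAt I 𝓘(ℝ, ℝ) f q.1)
    (v : TangentSpace (I.prod (𝓡 1)) q) :
    mvfderiv (I.prod (𝓡 1)) (fun q : M × Circle => f q.1) q v = mvfderiv I f q.1 (dproj I q v) :=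
  mvfderiv_comp_apply (I' := I.prod (𝓡 1)) q (f := (Prod.fst : M × Circle → M)) (g := f) hf
    mdifferentiableAt_fst v

theorem mvfderiv_comp_snd {S : Circle → ℝ} {q : M × Circle}
    (hS : MDifferentiableAt (𝓡 1) 𝓘(ℝ, ℝ) S q.2) (hd : mvfderiv (𝓡 1) S q.2 = circleForm q.2)
    (v : TangentSpace (I.prod (𝓡 1)) q) :
    mvfderiv (I.prod (𝓡 1)) (fun q : M × Circle => S q.2) q v = dsForm I q v := by
  have h := mvfderiv_comp_apply (I' := I.prod (𝓡 1)) q (f := (Prod.snd : M × Circle → Circle))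
    (g := S) hS mdifferentiableAt_snd v
  rw [hd] at h
  exact h

theorem contMDiff_translate (w : Circle) :
    ContMDiff (I.prod (𝓡 1)) (I.prod (𝓡 1)) ∞ (translate w : M × Circle → M × Circle) :=
  contMDiff_fst.prodMk (contMDiff_const.mul contMDiff_snd)

theorem dproj_mfderiv_translate (w : Circle) (q : M × Circle)
    (v : TangentSpace (I.prod (𝓡 1)) q) :
    dproj I (translate w q) (mfderiv (I.prod (𝓡 1)) (I.prod (𝓡 1)) (translate w) q v) =
      dproj I q v :=
  (mfderiv_comp_apply (I := I.prod (𝓡 1)) (I' := I.prod (𝓡 1)) (I'' := I) q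
    (g := (Prod.fst : M × Circle → M)) (f := translate w) mdifferentiableAt_fst
    ((contMDiff_translate w).mdifferentiableAt (by simp)) v).symm

theorem dsForm_mfderiv_translate (w : Circle) (q : M × Circle)
    (v : TangentSpace (I.prod (𝓡 1)) q) :
    dsForm I (translate w q) (mfderiv (I.prod (𝓡 1)) (I.prod (𝓡 1)) (translate w) q v) =
      dsForm I q v := by
  have h1 := mfderiv_comp_apply (I := I.prod (𝓡 1)) (I' := I.prod (𝓡 1)) (I'' := 𝓡 1) q
    (g := (Prod.snd : M × Circle → Circle)) (f := translate w) mdifferentiableAt_snd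
    ((contMDiff_translate w).mdifferentiableAt (by simp)) v
  have h2 := mfderiv_comp_apply (I := I.prod (𝓡 1)) (I' := 𝓡 1) (I'' := 𝓡 1) q
    (g := fun y : Circle => w * y) (f := (Prod.snd : M × Circle → Circle))
    (((contMDiff_const.mul contMDiff_id : ContMDiff (𝓡 1) (𝓡 1) ∞
      (fun y : Circle => w * y))).mdifferentiableAt (by simp)) mdifferentiableAt_snd v
  have h3 := circleForm_mul w q.2 (mfderiv (I.prod (𝓡 1)) (𝓡 1)
    (Prod.snd : M × Circle → Circle) q v)
  change circleForm (w * q.2) (mfderiv (I.prod (𝓡 1)) (𝓡 1) (Prod.snd : M × Circle → Circle)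
    (translate w q) (mfderiv (I.prod (𝓡 1)) (I.prod (𝓡 1)) (translate w) q v)) = _
  exact (congrArg (circleForm (w * q.2)) (h1.symm.trans h2)).trans h3

end Product

section OneVariable

/-- A bump function that is `1` on `[-1/2, 1/2]` and vanishes outside `(-1, 1)`. -/
def cutoffBump : ContDiffBump (0 : ℝ) := ⟨1 / 2, 1, by norm_num, by norm_num⟩

/-- The cut-off function. -/
def cutoff (t : ℝ) : ℝ := cutoffBump t

theorem contDiff_cutoff : ContDiff ℝ ∞ cutoff := cutoffBump.contDiff

theorem cutoff_eq_one {t : ℝ} (h : |t| ≤ 1 / 2) : cutoff t = 1 :=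
  cutoffBump.one_of_mem_closedBall (by simpa [cutoffBump] using h)

theorem cutoff_eq_zero {t : ℝ} (h : 1 ≤ |t|) : cutoff t = 0 :=
  cutoffBump.zero_of_le_dist (by simpa [cutoffBump] using h)

/-- The primitive of `cutoff t / t ^ k` away from `0` that vanishes for `1 ≤ |t|`. -/
def primitive (k : ℕ) (t : ℝ) : ℝ :=
  if 0 < t then ∫ τ in (1 : ℝ)..t, cutoff τ / τ ^ k else ∫ τ in (-1 : ℝ)..t, cutoff τ / τ ^ k

theorem contDiffOn_cutoff_div (k : ℕ) :
    ContDiffOn ℝ ∞ (fun τ : ℝ => cutoff τ / τ ^ k) {0}ᶜ :=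
  contDiff_cutoff.contDiffOn.div (contDiff_id.pow k).contDiffOn fun _ h => pow_ne_zero k h

theorem hasDerivAt_integral_cutoff_div (k : ℕ) {a t : ℝ} (h : (0 : ℝ) ∉ uIcc a t) :
    HasDerivAt (fun t => ∫ τ in a..t, cutoff τ / τ ^ k) (cutoff t / t ^ k) t := by
  have ht : t ∈ ({0}ᶜ : Set ℝ) := fun h' => h (h' ▸ right_mem_uIcc)
  have hc := (contDiffOn_cutoff_div k).continuousOn
  refine intervalIntegral.integral_hasDerivAt_right ?_ ?_
    (hc.continuousAt (isOpen_compl_singleton.mem_nhds ht))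
  · exact (hc.mono fun x hx h' => h (h' ▸ hx)).intervalIntegrable
  · exact hc.stronglyMeasurableAtFilter isOpen_compl_singleton t ht

theorem hasDerivAt_primitive (k : ℕ) {t : ℝ} (ht : t ≠ 0) :
    HasDerivAt (primitive k) (cutoff t / t ^ k) t := by
  rcases ht.lt_or_gt with h | h
  · refine (hasDerivAt_integral_cutoff_div k (a := -1) (t := t) ?_).congr_of_eventuallyEq ?_
    · rw [mem_uIcc]; rintro (h' | h') <;> linarith
    · filter_upwards [Iio_mem_nhds h] with s hs
      rw [primitive, if_neg (not_lt.2 (le_of_lt hs))]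
  · refine (hasDerivAt_integral_cutoff_div k (a := 1) (t := t) ?_).congr_of_eventuallyEq ?_
    · rw [mem_uIcc]; rintro (h' | h') <;> linarith
    · filter_upwards [Ioi_mem_nhds h] with s hs
      rw [primitive, if_pos (mem_Ioi.1 hs)]

theorem contDiffOn_primitive (k : ℕ) : ContDiffOn ℝ ∞ (primitive k) {0}ᶜ := by
  rw [contDiffOn_infty_iff_deriv_of_isOpen isOpen_compl_singleton]
  refine ⟨fun t ht => (hasDerivAt_primitive k ht).differentiableAt.differentiableWithinAt, ?_⟩
  exact (contDiffOn_cutoff_div k).congr fun t ht => (hasDerivAt_primitive k ht).deriv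

theorem primitive_eq_zero (k : ℕ) {t : ℝ} (ht : 1 ≤ |t|) : primitive k t = 0 := by
  have key : ∀ a : ℝ, (∀ τ ∈ uIcc a t, 1 ≤ |τ|) → ∫ τ in a..t, cutoff τ / τ ^ k = 0 := by
    intro a h
    rw [intervalIntegral.integral_congr (g := fun _ => (0 : ℝ)) fun τ hτ => by
      simp [cutoff_eq_zero (h τ hτ)]]
    simp
  rw [primitive]
  split_ifs with h
  · rw [abs_of_pos h] at ht
    refine key 1 fun τ hτ => ?_
    rw [uIcc_of_le ht] at hτ
    exact hτ.1.trans (le_abs_self τ)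
  · rw [abs_of_nonpos (not_lt.1 h)] at ht
    refine key (-1) fun τ hτ => ?_
    rw [uIcc_of_ge (by linarith)] at hτ
    exact (by linarith [hτ.2] : 1 ≤ -τ).trans (neg_le_abs τ)

/-- A first integral of `dz + z ^ k ds` near the origin. -/
theorem exists_planar_firstIntegral {k : ℕ} (hk : 1 ≤ k) : ∃ (F : ℝ × ℝ → ℝ) (O : Set (ℝ × ℝ)),
    IsOpen O ∧ (0, 0) ∈ O ∧ ContDiffOn ℝ ∞ F O ∧ ∀ p ∈ O, (F p = 0 ↔ p.1 = 0) ∧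
      ∃ c : ℝ, c ≠ 0 ∧ ∀ v, fderiv ℝ F p v = c * (v.1 + p.1 ^ k * v.2) := by
  obtain ⟨m, rfl⟩ := Nat.exists_eq_add_of_le' hk
  rcases Nat.eq_zero_or_pos m with rfl | hm
  · refine ⟨fun p => p.1 * Real.exp p.2, univ, isOpen_univ, mem_univ _, by fun_prop, fun p _ => ?_⟩
    refine ⟨by simp [Real.exp_ne_zero], Real.exp p.2, Real.exp_ne_zero _, fun v => ?_⟩
    have h := (hasFDerivAt_fst (𝕜 := ℝ) (p := p)).mul (hasFDerivAt_snd (𝕜 := ℝ) (p := p)).exp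
    refine (congrArg (fun L => L v) h.fderiv).trans ?_
    simp
    ring
  · have hm0 : (m : ℝ) ≠ 0 := by positivity
    set B : ℝ × ℝ → ℝ := fun p => 1 - m * p.2 * p.1 ^ m
    have hB : ContDiff ℝ ∞ B := by fun_prop
    refine ⟨fun p => p.1 * B p ^ (-1 / m : ℝ), {p | 0 < B p},
      isOpen_lt continuous_const hB.continuous, ?_, ?_, fun p hp => ?_⟩
    · simp [B]
    · exact contDiff_fst.contDiffOn.mul fun p hp =>
        (hB.contDiffAt.rpow_const_of_ne (ne_of_gt hp)).contDiffWithinAt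
    · have hp : 0 < B p := hp
      refine ⟨by simp [(Real.rpow_pos_of_pos hp _).ne'], B p ^ (-1 / m - 1 : ℝ),
        (Real.rpow_pos_of_pos hp _).ne', fun v => ?_⟩
      have h1 := hasFDerivAt_fst (𝕜 := ℝ) (p := p)
      have h2 := hasFDerivAt_snd (𝕜 := ℝ) (p := p)
      have h3 : HasFDerivAt B _ p := (((h2.const_mul (m : ℝ)).mul (h1.pow m)).const_sub 1)
      have h4 := h1.mul (h3.rpow_const (p := (-1 / m : ℝ)) (Or.inl hp.ne'))
      have h5 : B p ^ (-1 / m : ℝ) = B p ^ (-1 / m - 1 : ℝ) * B p := by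
        rw [← Real.rpow_add_one hp.ne']; ring_nf
      rw [h5] at h4
      refine (congrArg (fun L => L v) h4.fderiv).trans ?_
      generalize B p ^ (-1 / m - 1 : ℝ) = R
      obtain ⟨l, rfl⟩ := Nat.exists_eq_add_of_le' hm
      simp only [B]
      push_cast at hm0 ⊢
      simp
      field_simp
      ring

end OneVariable

section Foliation

variable {E : Type} [NormedAddCommGroup E] [NormedSpace ℝ E] [FiniteDimensional ℝ E]
  {H : Type*} [TopologicalSpace H] {I : ModelWithCorners ℝ E H}
  {M : Type*} [TopologicalSpace M] [ChartedSpace H M] [IsManifold I ∞ M] {Z : Set M}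

namespace DefiningData

variable (D : DefiningData I Z) (k : ℕ)

open Classical in
/-- The function on `M ∖ Z` whose differential is `χ(z) z ^ (-k) dz`. -/
def potential (x : M) : ℝ := if x ∈ D.U then primitive k (D.z x) else 0

theorem potential_eventuallyEq {x : M} (hx : x ∈ D.U) :
    D.potential k =ᶠ[𝓝 x] fun y => primitive k (D.z y) := by
  filter_upwards [D.isOpen_U.mem_nhds hx] with y hy
  rw [potential, if_pos hy]

theorem potential_eventuallyEq_zero {x : M} (hx : x ∉ D.U) :
    D.potential k =ᶠ[𝓝 x] fun _ => 0 := by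
  have h1 : x ∉ closure {x ∈ D.U | |D.z x| < 1} := fun h => hx (D.closure_subset h)
  filter_upwards [isClosed_closure.isOpen_compl.mem_nhds h1] with y hy
  rw [potential]
  split_ifs with h
  · refine primitive_eq_zero k (not_lt.1 fun h' => hy (subset_closure ⟨h, h'⟩))
  · rfl

theorem contMDiffAt_potential {x : M} (hx : x ∉ Z) :
    ContMDiffAt I 𝓘(ℝ, ℝ) ∞ (D.potential k) x := by
  by_cases hU : x ∈ D.U
  · refine ContMDiffAt.congr_of_eventuallyEq ?_ (D.potential_eventuallyEq k hU)
    exact ((contDiffOn_primitive k).contDiffAt (isOpen_compl_singleton.mem_nhds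
      (D.z_ne_zero hU hx))).contMDiffAt.comp x D.z.contMDiff.contMDiffAt
  · exact contMDiffAt_const.congr_of_eventuallyEq (D.potential_eventuallyEq_zero k hU)

theorem mvfderiv_potential {x : M} (hx : x ∈ D.U) (hxZ : x ∉ Z) (v : TangentSpace I x) :
    mvfderiv I (D.potential k) x v = cutoff (D.z x) / D.z x ^ k * mvfderiv I D.z x v := by
  rw [mvfderiv_congr (D.potential_eventuallyEq k hx)]
  have hd := hasDerivAt_primitive k (D.z_ne_zero hx hxZ)
  have h := mvfderiv_comp_apply' (I := I) (J := 𝓘(ℝ, ℝ)) x (f := D.z) (g := primitive k)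
    hd.differentiableAt.mdifferentiableAt (D.z.mdifferentiableAt x) v
  rw [mvfderiv_eq_fderiv, hd.hasFDerivAt.fderiv] at h
  refine h.trans ?_
  rw [mul_comm]
  rfl

theorem mvfderiv_potential_of_notMem {x : M} (hx : x ∉ D.U) (v : TangentSpace I x) :
    mvfderiv I (D.potential k) x v = 0 := by
  rw [mvfderiv_congr (D.potential_eventuallyEq_zero k hx), mvfderiv_const]
  rfl

open Classical in
/-- The tangent spaces of the foliation. -/
def foliationTangent (q : M × Circle) : Submodule ℝ (TangentSpace (I.prod (𝓡 1)) q) :=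
  if q.1 ∈ D.U then LinearMap.ker (bkForm D.z cutoff k q).toLinearMap
  else LinearMap.ker (dsForm I q).toLinearMap

theorem mem_foliationTangent_of_mem_U {q : M × Circle} (hq : q.1 ∈ D.U)
    {v : TangentSpace (I.prod (𝓡 1)) q} : v ∈ D.foliationTangent k q ↔
      cutoff (D.z q.1) * mvfderiv I D.z q.1 (dproj I q v) + D.z q.1 ^ k * dsForm I q v = 0 := by
  rw [foliationTangent, if_pos hq, LinearMap.mem_ker]
  exact Iff.rfl

theorem mem_foliationTangent_of_notMem_U {q : M × Circle} (hq : q.1 ∉ D.U)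
    {v : TangentSpace (I.prod (𝓡 1)) q} : v ∈ D.foliationTangent k q ↔ dsForm I q v = 0 := by
  rw [foliationTangent, if_neg hq, LinearMap.mem_ker]
  exact Iff.rfl

theorem mem_foliationTangent_of_mem_U₁ {q : M × Circle} (hq : q.1 ∈ D.U₁)
    {v : TangentSpace (I.prod (𝓡 1)) q} : v ∈ D.foliationTangent k q ↔
      mvfderiv I D.z q.1 (dproj I q v) + D.z q.1 ^ k * dsForm I q v = 0 := by
  rw [D.mem_foliationTangent_of_mem_U k (D.U₁_subset hq),
    cutoff_eq_one (D.abs_lt _ hq).le, one_mul]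

theorem mem_foliationTangent_of_notMem {q : M × Circle} (hq : q.1 ∉ Z)
    {v : TangentSpace (I.prod (𝓡 1)) q} : v ∈ D.foliationTangent k q ↔
      mvfderiv I (D.potential k) q.1 (dproj I q v) + dsForm I q v = 0 := by
  by_cases hU : q.1 ∈ D.U
  · rw [D.mem_foliationTangent_of_mem_U k hU, D.mvfderiv_potential k hU hq]
    have h0 : D.z q.1 ^ k ≠ 0 := pow_ne_zero k (D.z_ne_zero hU hq)
    rw [div_mul_eq_mul_div, div_add' _ _ _ h0, div_eq_zero_iff, or_iff_left h0, mul_comm (dsForm I q v)]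
  · rw [D.mem_foliationTangent_of_notMem_U k hU, D.mvfderiv_potential_of_notMem k hU, zero_add]

/-- A first integral near a point of `Z × S¹`. -/
theorem exists_firstIntegral_of_mem (hk : 1 ≤ k) {q₀ : M × Circle} (hq₀ : q₀.1 ∈ Z) :
    ∃ (O : Set (M × Circle)) (h : M × Circle → ℝ), IsOpen O ∧ q₀ ∈ O ∧
      ContMDiffOn (I.prod (𝓡 1)) 𝓘(ℝ, ℝ) ∞ h O ∧ ∀ q ∈ O, q.1 ∈ D.U₁ ∧ (h q = 0 ↔ q.1 ∈ Z) ∧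
        ∃ c : ℝ, c ≠ 0 ∧ ∀ v, mvfderiv (I.prod (𝓡 1)) h q v =
          c * (mvfderiv I D.z q.1 (dproj I q v) + D.z q.1 ^ k * dsForm I q v) := by
  obtain ⟨S, O, hO, hqO, hS0, hS, -, hSd⟩ := exists_angle q₀.2
  obtain ⟨F, P, hP, h0P, hF, hFd⟩ := exists_planar_firstIntegral hk
  have hz : ContMDiff (I.prod (𝓡 1)) 𝓘(ℝ, ℝ) ∞ (fun q : M × Circle => D.z q.1) :=
    D.z.contMDiff.comp contMDiff_fst
  have hS' : ContMDiffOn (I.prod (𝓡 1)) 𝓘(ℝ, ℝ) ∞ (fun q : M × Circle => S q.2)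
      (Prod.snd ⁻¹' O) := hS.comp contMDiff_snd.contMDiffOn fun _ h => h
  have hpair : ContMDiffOn (I.prod (𝓡 1)) 𝓘(ℝ, ℝ × ℝ) ∞
      (fun q : M × Circle => (D.z q.1, S q.2)) (Prod.snd ⁻¹' O) :=
    hz.contMDiffOn.prodMk_space hS'
  set W : Set (M × Circle) := (D.U₁ ×ˢ O) ∩
    ((Prod.snd ⁻¹' O) ∩ (fun q : M × Circle => (D.z q.1, S q.2)) ⁻¹' P)
  have hW : IsOpen W := (D.isOpen_U₁.prod hO).inter
    (hpair.continuousOn.isOpen_inter_preimage (hO.preimage continuous_snd) hP)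
  have hz0 : D.z q₀.1 = 0 := (D.mem_iff q₀.1 (subset_closure (D.U₁_subset (D.subset_U₁ hq₀)))).1 hq₀
  refine ⟨W, fun q => F (D.z q.1, S q.2), hW, ⟨⟨D.subset_U₁ hq₀, hqO⟩, hqO, ?_⟩, ?_, fun q hq => ?_⟩
  · change (D.z q₀.1, S q₀.2) ∈ P
    rwa [hz0, hS0]
  · exact hF.contMDiffOn.comp (hpair.mono fun q hq => hq.2.1) fun q hq => hq.2.2
  · obtain ⟨h1, c, hc, h2⟩ := hFd _ hq.2.2
    refine ⟨hq.1.1, h1.trans (D.mem_iff q.1 (subset_closure (D.U₁_subset hq.1.1))).symm,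
      c, hc, fun v => ?_⟩
    have hOq := (hO.preimage continuous_snd).mem_nhds hq.2.1
    have hFq := (hF.contDiffAt (hP.mem_nhds hq.2.2)).differentiableAt (by simp)
    have h3 := mvfderiv_comp_apply' (I := I.prod (𝓡 1)) (J := 𝓘(ℝ, ℝ × ℝ)) q
      (f := fun q : M × Circle => (D.z q.1, S q.2)) (g := F) hFq.mdifferentiableAt
      ((hpair.contMDiffAt hOq).mdifferentiableAt (by simp)) v
    rw [mvfderiv_eq_fderiv] at h3
    have hdS := (hS.contMDiffAt (hO.mem_nhds hq.2.1)).mdifferentiableAt (n := ∞) (by simp)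
    have h4 : mfderiv (I.prod (𝓡 1)) 𝓘(ℝ, ℝ × ℝ) (fun q : M × Circle => (D.z q.1, S q.2)) q v =
        (mvfderiv I D.z q.1 (dproj I q v), dsForm I q v) := by
      rw [← mvfderiv_comp_fst (D.z.mdifferentiableAt q.1) v,
        ← mvfderiv_comp_snd hdS (hSd _ hq.2.1) v]
      have h5 := ((hz q).mdifferentiableAt (by simp)).hasMFDerivAt
      have h6 := ((hS'.contMDiffAt hOq).mdifferentiableAt (n := ∞) (by simp)).hasMFDerivAt
      have h7 : HasMFDerivAt (I.prod (𝓡 1)) 𝓘(ℝ, ℝ × ℝ)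
          (fun q : M × Circle => (D.z q.1, S q.2)) q _ := ⟨h5.1.prodMk h6.1, h5.2.prodMk h6.2⟩
      exact congrArg (fun L => L v) h7.mfderiv
    refine h3.trans ?_
    rw [h4]
    exact h2 _

/-- A first integral near a point outside `Z × S¹`. -/
theorem exists_firstIntegral_of_notMem {q₀ : M × Circle} (hq₀ : q₀.1 ∉ Z) :
    ∃ (O : Set (M × Circle)) (h : M × Circle → ℝ), IsOpen O ∧ q₀ ∈ O ∧
      ContMDiffOn (I.prod (𝓡 1)) 𝓘(ℝ, ℝ) ∞ h O ∧ ∀ q ∈ O, q.1 ∉ Z ∧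
        q₀.2 * Circle.exp (h q) = q.2 * Circle.exp (D.potential k q.1) ∧
        ∀ v, mvfderiv (I.prod (𝓡 1)) h q v =
          mvfderiv I (D.potential k) q.1 (dproj I q v) + dsForm I q v := by
  obtain ⟨S, O, hO, hqO, hS0, hS, hSe, hSd⟩ := exists_angle q₀.2
  have hg : ContMDiffOn (I.prod (𝓡 1)) 𝓘(ℝ, ℝ) ∞ (fun q : M × Circle => D.potential k q.1)
      (Zᶜ ×ˢ O) := fun q hq => ((D.contMDiffAt_potential k hq.1).comp q
        contMDiff_fst.contMDiffAt).contMDiffWithinAt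
  have hS' : ContMDiffOn (I.prod (𝓡 1)) 𝓘(ℝ, ℝ) ∞ (fun q : M × Circle => S q.2)
      (Zᶜ ×ˢ O) := hS.comp contMDiff_snd.contMDiffOn fun _ h => h.2
  have hO' : IsOpen (Zᶜ ×ˢ O) := D.isClosed.isOpen_compl.prod hO
  refine ⟨Zᶜ ×ˢ O, _, hO', ⟨hq₀, hqO⟩, hg.add hS', fun q hq => ⟨hq.1, ?_, fun v => ?_⟩⟩
  · change q₀.2 * Circle.exp (D.potential k q.1 + S q.2) = _
    rw [add_comm, Circle.exp_add, ← mul_assoc, hSe]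
  have hdg := ((hg.contMDiffAt (hO'.mem_nhds hq)).mdifferentiableAt (n := ∞) (by simp))
  have hdS := ((hS'.contMDiffAt (hO'.mem_nhds hq)).mdifferentiableAt (n := ∞) (by simp))
  have h := mvfderiv_add hdg hdS
  rw [← mvfderiv_comp_fst ((D.contMDiffAt_potential k hq.1).mdifferentiableAt (by simp)) v,
    ← mvfderiv_comp_snd ((hS.contMDiffAt (hO.mem_nhds hq.2)).mdifferentiableAt (by simp))
      (hSd _ hq.2) v]
  exact congrArg (fun L => L v) h

theorem exists_submersion (hk : 1 ≤ k) (q₀ : M × Circle) :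
    ∃ U : Set (M × Circle), IsOpen U ∧ q₀ ∈ U ∧ ∃ h : M × Circle → ℝ,
      ContMDiffOn (I.prod (𝓡 1)) 𝓘(ℝ, ℝ) ∞ h U ∧
      ∀ q ∈ U, mvfderiv (I.prod (𝓡 1)) h q ≠ 0 ∧
        D.foliationTangent k q = LinearMap.ker (mvfderiv (I.prod (𝓡 1)) h q).toLinearMap := by
  by_cases hq₀ : q₀.1 ∈ Z
  · obtain ⟨O, h, hO, hqO, hh, H⟩ := D.exists_firstIntegral_of_mem k hk hq₀
    refine ⟨O, hO, hqO, h, hh, fun q hq => ?_⟩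
    obtain ⟨h1, -, c, hc, h2⟩ := H q hq
    constructor
    · intro h0
      have h3 := h2 ((splitting I q).symm (D.Y q.1, 0))
      rw [h0, dproj_splitting_symm, dsForm_splitting_symm, D.mvfderiv_z_Y h1] at h3
      simp at h3
      exact hc h3.symm
    · ext v
      rw [D.mem_foliationTangent_of_mem_U₁ k h1, LinearMap.mem_ker]
      have h3 := h2 v
      constructor
      · intro h4
        rw [h4, mul_zero] at h3
        exact h3
      · intro h4
        exact (mul_eq_zero.1 (h3.symm.trans h4)).resolve_left hc
  · obtain ⟨O, h, hO, hqO, hh, H⟩ := D.exists_firstIntegral_of_notMem k hq₀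
    refine ⟨O, hO, hqO, h, hh, fun q hq => ?_⟩
    obtain ⟨h1, -, h2⟩ := H q hq
    constructor
    · intro h0
      have h3 := h2 ((splitting I q).symm (0, 1))
      rw [h0, dproj_splitting_symm, dsForm_splitting_symm] at h3
      simp at h3
    · ext v
      rw [D.mem_foliationTangent_of_notMem k h1, LinearMap.mem_ker, ← h2]
      exact Iff.rfl

end DefiningData

/-- A distribution that is locally the kernel of an exact form is involutive. -/
theorem mlieBracket_mem_of_exists_submersion [I.Boundaryless] [CompleteSpace E] [T2Space M]
    [SigmaCompactSpace M]
    {T : ∀ q : M, Submodule ℝ (TangentSpace I q)} (hT : ∀ q₀ : M, ∃ U : Set M, IsOpen U ∧ q₀ ∈ U ∧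
      ∃ h : M → ℝ, ContMDiffOn I 𝓘(ℝ, ℝ) ∞ h U ∧ ∀ q ∈ U, mvfderiv I h q ≠ 0 ∧
        T q = LinearMap.ker (mvfderiv I h q).toLinearMap)
    (X Y : SmoothVF I M) (hX : ∀ q, X q ∈ T q) (hY : ∀ q, Y q ∈ T q) (q : M) :
    VectorField.mlieBracket I X Y q ∈ T q := by
  obtain ⟨U, hU, hq, h, hh, H⟩ := hT q
  obtain ⟨f, hf⟩ := exists_smoothFn_eventuallyEq (hU.mem_nhds hq) hh
  have key : ∀ W : SmoothVF I M, (∀ q, W q ∈ T q) →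
      lieDeriv W f =ᶠ[𝓝 q] fun _ => (0 : ℝ) := fun W hW => by
    filter_upwards [hf.eventuallyEq_nhds, hU.mem_nhds hq] with x hx hxU
    rw [lieDeriv_apply, mvfderiv_congr hx]
    have := hW x
    rw [(H x hxU).2, LinearMap.mem_ker] at this
    exact this
  have h1 := congrArg (fun g : SmoothFn I M => g q) (lieDeriv_bracketVF X Y f)
  have h2 : lieDeriv X (lieDeriv Y f) q = 0 := by
    rw [lieDeriv_apply, mvfderiv_congr (key Y hY), mvfderiv_const]; rfl
  have h3 : lieDeriv Y (lieDeriv X f) q = 0 := by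
    rw [lieDeriv_apply, mvfderiv_congr (key X hX), mvfderiv_const]; rfl
  have h4 : mvfderiv I f q (bracketVF X Y q) = 0 := by
    refine h1.trans ?_
    change lieDeriv X (lieDeriv Y f) q - lieDeriv Y (lieDeriv X f) q = 0
    rw [h2, h3, sub_zero]
  rw [(H q hq).2, LinearMap.mem_ker]
  rw [mvfderiv_congr hf] at h4
  exact h4

namespace DefiningData

variable (D : DefiningData I Z) (k : ℕ)
variable [I.Boundaryless] [T2Space M] [SigmaCompactSpace M] [CompleteSpace E]

/-- The foliation of `M × S¹`. -/
def foliation (hk : 1 ≤ k) : CodimOneFoliation (I.prod (𝓡 1)) (M × Circle) where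
  tangent := D.foliationTangent k
  exists_submersion := D.exists_submersion k hk
  involutive := mlieBracket_mem_of_exists_submersion (D.exists_submersion k hk)

theorem isBuiltFromForm (hk : 1 ≤ k) :
    IsBuiltFromForm (jetOf I Z k D.z) (D.foliation k hk) := by
  refine ⟨D.U, D.z, cutoff, D.isOpen_U, D.subset_U, fun x hx => D.mem_iff' hx,
    fun p hp => D.mvfderiv_z_ne_zero (D.subset_U₁ hp), rfl, contDiff_cutoff, ?_, ?_, fun q => ?_⟩
  · filter_upwards [Metric.closedBall_mem_nhds (0 : ℝ) (by norm_num : (0 : ℝ) < 1 / 2)] with t ht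
    exact cutoff_eq_one (by simpa using ht)
  · refine (closure_mono ?_).trans D.closure_subset
    exact fun x hx => ⟨hx.1, not_le.1 fun h => hx.2 (cutoff_eq_zero h)⟩
  · exact ⟨fun h => if_pos h, fun h => if_neg h⟩

theorem isCircleInvariant (hk : 1 ≤ k) : IsCircleInvariant (D.foliation k hk) := by
  have h1 : ∀ (w : Circle) (q : M × Circle) (v : TangentSpace (I.prod (𝓡 1)) q),
      mfderiv (I.prod (𝓡 1)) (I.prod (𝓡 1)) (translate w) q v ∈
        D.foliationTangent k (translate w q) ↔ v ∈ D.foliationTangent k q := by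
    intro w q v
    by_cases hU : q.1 ∈ D.U
    · rw [D.mem_foliationTangent_of_mem_U k hU,
        D.mem_foliationTangent_of_mem_U k (q := translate w q) hU, dproj_mfderiv_translate,
        dsForm_mfderiv_translate]
      rfl
    · rw [D.mem_foliationTangent_of_notMem_U k hU,
        D.mem_foliationTangent_of_notMem_U k (q := translate w q) hU, dsForm_mfderiv_translate]
  intro w q
  ext v
  constructor
  · rintro ⟨u, hu, rfl⟩
    exact (h1 w q u).2 hu
  · intro hv
    obtain ⟨u, hu⟩ : ∃ u, mfderiv (I.prod (𝓡 1)) (I.prod (𝓡 1)) (translate w) q u = v := by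
      refine ⟨(splitting I q).symm (dproj I (translate w q) v, dsForm I (translate w q) v), ?_⟩
      refine tangent_ext ?_ ?_
      · rw [dproj_mfderiv_translate]
        exact dproj_splitting_symm _ _ _
      · rw [dsForm_mfderiv_translate]
        exact dsForm_splitting_symm _ _ _
    refine ⟨u, (h1 w q u).1 ?_, hu⟩
    rw [hu]
    exact hv

theorem tangent_inf_ker_dproj (hk : 1 ≤ k) {q : M × Circle} (hq : q.1 ∉ Z) :
    (D.foliation k hk).tangent q ⊓ LinearMap.ker (dproj I q).toLinearMap = ⊥ := by
  rw [eq_bot_iff]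
  rintro v ⟨h1, h2⟩
  have h2 : dproj I q v = 0 := h2
  have h3 := (D.mem_foliationTangent_of_notMem k hq).1 h1
  rw [h2, map_zero, zero_add] at h3
  exact tangent_ext (h2.trans (map_zero _).symm) (h3.trans (map_zero _).symm)

end DefiningData

end Foliation

section Leaves

variable {E : Type} [NormedAddCommGroup E] [NormedSpace ℝ E] [FiniteDimensional ℝ E]
  {H : Type*} [TopologicalSpace H] {I : ModelWithCorners ℝ E H}
  {M : Type*} [TopologicalSpace M] [ChartedSpace H M] [IsManifold I ∞ M] {Z : Set M}

theorem dproj_mfderiv_curve {γ : ℝ → M × Circle} {t : ℝ}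
    (hγ : MDifferentiableAt 𝓘(ℝ, ℝ) (I.prod (𝓡 1)) γ t) (v : ℝ) :
    dproj I (γ t) (mfderiv 𝓘(ℝ, ℝ) (I.prod (𝓡 1)) γ t v) =
      mfderiv 𝓘(ℝ, ℝ) I (fun s => (γ s).1) t v :=
  (mfderiv_comp_apply (I := 𝓘(ℝ, ℝ)) (I' := I.prod (𝓡 1)) (I'' := I) t
    (g := (Prod.fst : M × Circle → M)) (f := γ) mdifferentiableAt_fst hγ v).symm

theorem dsForm_mfderiv_curve {γ : ℝ → M × Circle} {t : ℝ}
    (hγ : MDifferentiableAt 𝓘(ℝ, ℝ) (I.prod (𝓡 1)) γ t) (v : ℝ) :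
    dsForm I (γ t) (mfderiv 𝓘(ℝ, ℝ) (I.prod (𝓡 1)) γ t v) =
      circleForm (γ t).2 (mfderiv 𝓘(ℝ, ℝ) (𝓡 1) (fun s => (γ s).2) t v) :=
  congrArg (circleForm (γ t).2) (mfderiv_comp_apply (I := 𝓘(ℝ, ℝ)) (I' := I.prod (𝓡 1))
    (I'' := 𝓡 1) t (g := (Prod.snd : M × Circle → Circle)) (f := γ) mdifferentiableAt_snd hγ v).symm

/-- The smooth path from `y₁` (for `t ≤ 0`) to `y₂` (for `1 ≤ t`) along the segment. -/
def smoothSegment (y₁ y₂ : E) (t : ℝ) : E := y₁ + Real.smoothTransition t • (y₂ - y₁)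

theorem contDiff_smoothSegment (y₁ y₂ : E) : ContDiff ℝ ∞ (smoothSegment y₁ y₂) :=
  contDiff_const.add (Real.smoothTransition.contDiff.smul contDiff_const)

theorem smoothSegment_zero (y₁ y₂ : E) : smoothSegment y₁ y₂ 0 = y₁ := by simp [smoothSegment]

theorem smoothSegment_one (y₁ y₂ : E) : smoothSegment y₁ y₂ 1 = y₂ := by simp [smoothSegment]

theorem smoothSegment_mem {y₁ y₂ : E} {S : Set E} (hS : Convex ℝ S) (h₁ : y₁ ∈ S) (h₂ : y₂ ∈ S)
    (t : ℝ) : smoothSegment y₁ y₂ t ∈ S :=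
  hS.add_smul_sub_mem h₁ h₂ ⟨Real.smoothTransition.nonneg t, Real.smoothTransition.le_one t⟩

/-- A curve along which a function has vanishing differential keeps its values locally. -/
theorem eventually_eq_of_mvfderiv_eq_zero {E' : Type*} [NormedAddCommGroup E'] [NormedSpace ℝ E']
    {H' : Type*} [TopologicalSpace H'] {J : ModelWithCorners ℝ E' H'}
    {N : Type*} [TopologicalSpace N] [ChartedSpace H' N] {γ : ℝ → N}
    (hγ : ContMDiff 𝓘(ℝ, ℝ) J ∞ γ) {h : N → ℝ} {O : Set N} (hO : IsOpen O)
    (hh : ContMDiffOn J 𝓘(ℝ, ℝ) ∞ h O)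
    (hd : ∀ t, γ t ∈ O → mvfderiv J h (γ t) (mfderiv 𝓘(ℝ, ℝ) J γ t (1 : ℝ)) = 0) {t₀ : ℝ}
    (ht₀ : γ t₀ ∈ O) : ∀ᶠ t in 𝓝 t₀, γ t ∈ O ∧ h (γ t) = h (γ t₀) := by
  obtain ⟨r, hr, hball⟩ := Metric.mem_nhds_iff.1
    (hγ.continuous.continuousAt.preimage_mem_nhds (hO.mem_nhds ht₀))
  have hdiff : ∀ t ∈ Metric.ball t₀ r, DifferentiableAt ℝ (h ∘ γ) t := fun t ht =>
    (((hh.contMDiffAt (hO.mem_nhds (hball ht))).comp t hγ.contMDiffAt).mdifferentiableAt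
      (by simp)).differentiableAt
  have hzero : ∀ t ∈ Metric.ball t₀ r, fderiv ℝ (h ∘ γ) t = 0 := fun t ht => by
    have h1 := mvfderiv_comp_apply' (I := 𝓘(ℝ, ℝ)) (J := J) t (f := γ) (g := h)
      ((hh.contMDiffAt (hO.mem_nhds (hball ht))).mdifferentiableAt (by simp))
      (hγ.mdifferentiableAt (by simp)) (1 : ℝ)
    rw [hd t (hball ht), mvfderiv_eq_fderiv] at h1
    ext
    exact h1
  filter_upwards [Metric.ball_mem_nhds t₀ hr] with t ht
  refine ⟨hball ht, ?_⟩
  exact Metric.isOpen_ball.is_const_of_fderiv_eq_zero (convex_ball t₀ r).isPreconnected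
    (fun t ht => (hdiff t ht).differentiableWithinAt) hzero ht (Metric.mem_ball_self hr)

namespace DefiningData

variable (D : DefiningData I Z) (k : ℕ)

/-- Smooth curves tangent to the foliation stay inside or outside `Z × S¹`. -/
theorem curve_mem_iff (hk : 1 ≤ k) {γ : ℝ → M × Circle}
    (hγ : ContMDiff 𝓘(ℝ, ℝ) (I.prod (𝓡 1)) ∞ γ)
    (ht : ∀ t : ℝ, mfderiv 𝓘(ℝ, ℝ) (I.prod (𝓡 1)) γ t (1 : ℝ) ∈ D.foliationTangent k (γ t))
    (s t : ℝ) : (γ s).1 ∈ Z ↔ (γ t).1 ∈ Z := by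
  set T : Set ℝ := {t | (γ t).1 ∈ Z}
  have hcl : IsClosed T := D.isClosed.preimage (continuous_fst.comp hγ.continuous)
  have hop : IsOpen T := by
    refine isOpen_iff_mem_nhds.2 fun t₀ ht₀ => ?_
    obtain ⟨O, h, hO, hqO, hh, H⟩ := D.exists_firstIntegral_of_mem k hk ht₀
    have h1 := eventually_eq_of_mvfderiv_eq_zero hγ hO hh (fun t htO => by
      obtain ⟨h1, -, c, -, h2⟩ := H _ htO
      refine (h2 _).trans ?_
      rw [(D.mem_foliationTangent_of_mem_U₁ k h1).1 (ht t), mul_zero]) hqO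
    filter_upwards [h1] with t h2
    exact (H _ h2.1).2.1.1 (h2.2.trans ((H _ hqO).2.1.2 ht₀))
  rcases isClopen_iff.1 ⟨hcl, hop⟩ with h | h
  · have : ∀ t, (γ t).1 ∉ Z := fun t ht => (h ▸ ht : t ∈ (∅ : Set ℝ))
    simp [this]
  · have : ∀ t, (γ t).1 ∈ Z := fun t => (h ▸ mem_univ t : t ∈ T)
    simp [this]

theorem curve_mul_exp_eq {γ : ℝ → M × Circle}
    (hγ : ContMDiff 𝓘(ℝ, ℝ) (I.prod (𝓡 1)) ∞ γ)
    (ht : ∀ t : ℝ, mfderiv 𝓘(ℝ, ℝ) (I.prod (𝓡 1)) γ t (1 : ℝ) ∈ D.foliationTangent k (γ t))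
    (hZ : ∀ t, (γ t).1 ∉ Z) (s t : ℝ) :
    (γ s).2 * Circle.exp (D.potential k (γ s).1) =
      (γ t).2 * Circle.exp (D.potential k (γ t).1) := by
  have hloc : IsLocallyConstant fun t => (γ t).2 * Circle.exp (D.potential k (γ t).1) := by
    refine IsLocallyConstant.iff_eventually_eq _ |>.2 fun t₀ => ?_
    obtain ⟨O, h, hO, hqO, hh, H⟩ := D.exists_firstIntegral_of_notMem k (hZ t₀)
    have h1 := eventually_eq_of_mvfderiv_eq_zero hγ hO hh (fun t htO => by
      refine ((H _ htO).2.2 _).trans ?_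
      exact (D.mem_foliationTangent_of_notMem k (hZ t)).1 (ht t)) hqO
    filter_upwards [h1] with t h2
    rw [← (H _ h2.1).2.1, ← (H _ hqO).2.1, h2.2]
  exact hloc.apply_eq_of_isPreconnected isPreconnected_univ (mem_univ s) (mem_univ t)

variable [I.Boundaryless] [T2Space M] [SigmaCompactSpace M] [CompleteSpace E]

theorem exists_nhds_mem_leaf_of_mem (hk : 1 ≤ k) {p : M} (hp : p ∈ Z) :
    ∃ O : Set M, IsOpen O ∧ p ∈ O ∧ ∀ p₁ ∈ O ∩ Z, ∀ p₂ ∈ O ∩ Z, ∀ w₁ w₂ : Circle,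
      (p₂, w₂) ∈ (D.foliation k hk).leaf (p₁, w₁) := by
  obtain ⟨l, θ, σ, r, O, hl, hr, hO, hpO, hθ, hσ, h1, h2⟩ :=
    exists_straightening D.z (D.mvfderiv_z_ne_zero (D.subset_U₁ hp)) (D.U₁_mem_nhds hp)
  have hl0 : ∀ x ∈ O ∩ Z, l (θ x) = 0 := fun x hx => by
    rw [← (h2 _ (h1 x hx.1).1).2, (h1 x hx.1).2]
    exact D.z_eq_zero hx.2
  refine ⟨O, hO, hpO, fun p₁ hp₁ p₂ hp₂ w₁ w₂ => Relation.ReflTransGen.single ?_⟩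
  set y : ℝ → E := smoothSegment (θ p₁) (θ p₂)
  have hy : ∀ t, y t ∈ Metric.ball (θ p) r :=
    smoothSegment_mem (convex_ball _ _) (h1 _ hp₁.1).1 (h1 _ hp₂.1).1
  have hyl : ∀ t, l (y t) = 0 := fun t => by
    simp [y, smoothSegment, hl0 _ hp₁, hl0 _ hp₂]
  have hx : ContMDiff 𝓘(ℝ, ℝ) I ∞ (fun t => σ (y t)) :=
    hσ.comp_contMDiff (contDiff_smoothSegment _ _).contMDiff hy
  have hz : ∀ t, D.z (σ (y t)) = 0 := fun t => by rw [(h2 _ (hy t)).2, hyl]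
  set a : ℝ → ℝ := smoothSegment 0 (Complex.arg (w₁⁻¹ * w₂ : Circle))
  have hw : ContMDiff 𝓘(ℝ, ℝ) (𝓡 1) ∞ (fun t => w₁ * Circle.exp (a t)) :=
    contMDiff_const.mul (contMDiff_circleExp.comp (contDiff_smoothSegment _ _).contMDiff)
  have hγ : ContMDiff 𝓘(ℝ, ℝ) (I.prod (𝓡 1)) ∞ (fun t => (σ (y t), w₁ * Circle.exp (a t))) :=
    hx.prodMk hw
  refine ⟨_, hγ, ?_, ?_, fun t => ?_⟩
  · simp only [y, a, smoothSegment_zero, Circle.exp_zero, mul_one, (h1 _ hp₁.1).2]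
  · simp only [y, a, smoothSegment_one, Circle.exp_arg, mul_inv_cancel_left, (h1 _ hp₂.1).2]
  · refine (D.mem_foliationTangent_of_mem_U₁ k (h2 _ (hy t)).1).2 ?_
    have e1 := dproj_mfderiv_curve (hγ.mdifferentiableAt (x := t) (by simp)) (1 : ℝ)
    have e2 := mvfderiv_comp_apply' (I := 𝓘(ℝ, ℝ)) (J := I) t (f := fun t => σ (y t)) (g := D.z)
      (D.z.mdifferentiableAt _) (hx.mdifferentiableAt (by simp)) (1 : ℝ)
    have e3 : (D.z ∘ fun t => σ (y t)) = fun _ => (0 : ℝ) := funext hz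
    rw [e3, mvfderiv_const] at e2
    rw [e1]
    change mvfderiv I D.z (σ (y t)) _ + D.z (σ (y t)) ^ k * _ = 0
    rw [hz t, zero_pow (by omega), zero_mul, add_zero]
    exact e2.symm

theorem exists_nhds_mem_leaf_of_notMem (hk : 1 ≤ k) {p : M} (hp : p ∉ Z) :
    ∃ O : Set M, IsOpen O ∧ p ∈ O ∧ ∀ p₁ ∈ O, ∀ p₂ ∈ O, ∀ w : Circle,
      (p₂, w * Circle.exp (D.potential k p₁ - D.potential k p₂)) ∈
        (D.foliation k hk).leaf (p₁, w) := by
  set e := extChartAt I p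
  have hT : e.target ∩ e.symm ⁻¹' Zᶜ ∈ 𝓝 (e p) :=
    ((continuousOn_extChartAt_symm p).isOpen_inter_preimage (isOpen_extChartAt_target p)
      D.isClosed.isOpen_compl).mem_nhds ⟨mem_extChartAt_target p, by
        simpa [e, extChartAt_to_inv] using hp⟩
  obtain ⟨r, hr, hball⟩ := Metric.mem_nhds_iff.1 hT
  refine ⟨e.source ∩ e ⁻¹' Metric.ball (e p) r, (continuousOn_extChartAt p).isOpen_inter_preimage
    (isOpen_extChartAt_source p) Metric.isOpen_ball, ⟨mem_extChartAt_source p,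
    Metric.mem_ball_self hr⟩, fun p₁ hp₁ p₂ hp₂ w => Relation.ReflTransGen.single ?_⟩
  set y : ℝ → E := smoothSegment (e p₁) (e p₂)
  have hy : ∀ t, y t ∈ Metric.ball (e p) r :=
    smoothSegment_mem (convex_ball _ _) hp₁.2 hp₂.2
  have hx : ContMDiff 𝓘(ℝ, ℝ) I ∞ (fun t => e.symm (y t)) :=
    (contMDiffOn_extChartAt_symm p).comp_contMDiff (contDiff_smoothSegment _ _).contMDiff
      fun t => (hball (hy t)).1
  have hxZ : ∀ t, e.symm (y t) ∉ Z := fun t => (hball (hy t)).2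
  set a : ℝ → ℝ := fun t => D.potential k p₁ - D.potential k (e.symm (y t))
  have hp : ContMDiff 𝓘(ℝ, ℝ) 𝓘(ℝ, ℝ) ∞ fun t => D.potential k (e.symm (y t)) := fun t =>
    (D.contMDiffAt_potential k (hxZ t)).comp t (hx t)
  have ha : ContMDiff 𝓘(ℝ, ℝ) 𝓘(ℝ, ℝ) ∞ a := contMDiff_const.sub hp
  have hw : ContMDiff 𝓘(ℝ, ℝ) (𝓡 1) ∞ (fun t => w * Circle.exp (a t)) :=
    contMDiff_const.mul (contMDiff_circleExp.comp ha)
  have hγ : ContMDiff 𝓘(ℝ, ℝ) (I.prod (𝓡 1)) ∞ (fun t => (e.symm (y t), w * Circle.exp (a t))) :=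
    hx.prodMk hw
  have e₁ : e.symm (e p₁) = p₁ := e.left_inv hp₁.1
  have e₂ : e.symm (e p₂) = p₂ := e.left_inv hp₂.1
  refine ⟨_, hγ, ?_, ?_, fun t => ?_⟩
  · simp only [y, a, smoothSegment_zero, e₁, sub_self, Circle.exp_zero, mul_one]
  · simp only [y, a, smoothSegment_one, e₂]
  · refine (D.mem_foliationTangent_of_notMem k (hxZ t)).2 ?_
    have c1 := dproj_mfderiv_curve (hγ.mdifferentiableAt (x := t) (by simp)) (1 : ℝ)
    have c2 := dsForm_mfderiv_curve (hγ.mdifferentiableAt (x := t) (by simp)) (1 : ℝ)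
    have c3 := circleForm_mfderiv_mul_exp (I := 𝓘(ℝ, ℝ)) w (ha.mdifferentiableAt (by simp)) (1 : ℝ)
      (x := t)
    have c4 := mvfderiv_comp_apply' (I := 𝓘(ℝ, ℝ)) (J := I) t (f := fun t => e.symm (y t))
      (g := D.potential k) ((D.contMDiffAt_potential k (hxZ t)).mdifferentiableAt (by simp))
      (hx.mdifferentiableAt (by simp)) (1 : ℝ)
    have c5 : mvfderiv 𝓘(ℝ, ℝ) a t = - mvfderiv 𝓘(ℝ, ℝ) (D.potential k ∘ fun t => e.symm (y t)) t := by
      rw [mvfderiv_eq_fderiv, mvfderiv_eq_fderiv]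
      exact fderiv_const_sub _
    rw [c1, c2]
    change mvfderiv I (D.potential k) (e.symm (y t)) _ + _ = 0
    refine (congrArg₂ (· + ·) c4.symm (c3.trans (congrArg (fun L => L (1 : ℝ)) c5))).trans ?_
    exact add_neg_cancel _

theorem hasCentralLeaves (hk : 1 ≤ k) : HasCentralLeaves Z (D.foliation k hk) := by
  intro q hq
  have hqS : q ∈ Z ×ˢ (univ : Set Circle) := ⟨hq, mem_univ _⟩
  refine Subset.antisymm (fun q' hq' => ?_) (fun q' hq' => ?_)
  · have : q'.1 ∈ Z ∧ q' ∈ connectedComponentIn (Z ×ˢ univ) q := by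
      induction hq' with
      | refl => exact ⟨hq, mem_connectedComponentIn hqS⟩
      | tail _ h ih =>
        obtain ⟨γ, hγ, rfl, rfl, ht⟩ := h
        have hZ : ∀ t, (γ t).1 ∈ Z := fun t => (D.curve_mem_iff k hk hγ ht 0 t).1 ih.1
        refine ⟨hZ 1, ?_⟩
        rw [connectedComponentIn_eq ih.2]
        exact (isPreconnected_range hγ.continuous).subset_connectedComponentIn (mem_range_self 0)
          (by rintro _ ⟨t, rfl⟩; exact ⟨hZ t, mem_univ _⟩) (mem_range_self 1)
    exact this.2
  · refine isPreconnected_connectedComponentIn.induction₂'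
      (fun a b => b ∈ (D.foliation k hk).leaf a) (fun a ha => ?_)
      (fun a b c _ _ _ h1 h2 => Relation.ReflTransGen.trans h1 h2) (mem_connectedComponentIn hqS) hq'
    have haS := connectedComponentIn_subset _ _ ha
    obtain ⟨O, hO, haO, h⟩ := D.exists_nhds_mem_leaf_of_mem k hk haS.1
    filter_upwards [mem_nhdsWithin_of_mem_nhds ((hO.preimage continuous_fst).mem_nhds haO),
      self_mem_nhdsWithin] with b hb hbC
    have hbS := connectedComponentIn_subset _ _ hbC
    exact ⟨h _ ⟨haO, haS.1⟩ _ ⟨hb, hbS.1⟩ _ _, h _ ⟨hb, hbS.1⟩ _ ⟨haO, haS.1⟩ _ _⟩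

theorem hasGraphicalLeaves (hk : 1 ≤ k) : HasGraphicalLeaves Z (D.foliation k hk) := by
  intro q hq
  refine ⟨D.tangent_inf_ker_dproj k hk hq,
    fun x => q.2 * Circle.exp (D.potential k q.1 - D.potential k x), fun x hx => ?_, ?_⟩
  · have hx : x ∉ Z := connectedComponentIn_subset _ _ hx
    exact (contMDiffAt_const.mul (contMDiff_circleExp.contMDiffAt.comp x
      (contMDiffAt_const.sub (D.contMDiffAt_potential k hx)))).contMDiffWithinAt
  refine Subset.antisymm (fun q' hq' => ?_) ?_
  · have : q'.1 ∈ connectedComponentIn Zᶜ q.1 ∧ q'.2 * Circle.exp (D.potential k q'.1) =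
        q.2 * Circle.exp (D.potential k q.1) := by
      induction hq' with
      | refl => exact ⟨mem_connectedComponentIn hq, rfl⟩
      | tail _ h ih =>
        obtain ⟨γ, hγ, rfl, rfl, ht⟩ := h
        have h0 : (γ 0).1 ∉ Z := connectedComponentIn_subset _ _ ih.1
        have hZ : ∀ t, (γ t).1 ∉ Z := fun t h => h0 ((D.curve_mem_iff k hk hγ ht 0 t).2 h)
        refine ⟨?_, (D.curve_mul_exp_eq k hγ ht hZ 1 0).trans ih.2⟩
        rw [connectedComponentIn_eq ih.1]
        exact (isPreconnected_range (continuous_fst.comp hγ.continuous)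
          ).subset_connectedComponentIn (mem_range_self (0 : ℝ))
          (by rintro _ ⟨t, rfl⟩; exact hZ t) (mem_range_self (1 : ℝ))
    refine ⟨this.1, ?_⟩
    change q'.2 = q.2 * Circle.exp (D.potential k q.1 - D.potential k q'.1)
    rw [Circle.exp_sub, ← mul_div_assoc, ← this.2, mul_div_cancel_right]
  · rintro ⟨x, w⟩ ⟨hx, hw⟩
    have hx : x ∈ connectedComponentIn Zᶜ q.1 := hx
    have hw : w = q.2 * Circle.exp (D.potential k q.1 - D.potential k x) := hw
    subst hw
    refine isPreconnected_connectedComponentIn.induction₂' (s := connectedComponentIn Zᶜ q.1)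
      (fun a b => ∀ w : Circle, (b, w * Circle.exp (D.potential k a - D.potential k b)) ∈
        (D.foliation k hk).leaf (a, w)) (fun a ha => ?_)
      (fun a b c _ _ _ h1 h2 w => ?_) (mem_connectedComponentIn hq) hx q.2
    · obtain ⟨O, hO, haO, h⟩ := D.exists_nhds_mem_leaf_of_notMem k hk
        (connectedComponentIn_subset _ _ ha)
      filter_upwards [mem_nhdsWithin_of_mem_nhds (hO.mem_nhds haO)] with b hb
      exact ⟨h a haO b hb, h b hb a haO⟩
    · have h3 := h2 (w * Circle.exp (D.potential k a - D.potential k b))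
      rw [mul_assoc, ← Circle.exp_add, sub_add_sub_cancel] at h3
      exact Relation.ReflTransGen.trans (h1 w) h3

end DefiningData

end Leaves

section Sections

variable {E : Type*} [NormedAddCommGroup E] [NormedSpace ℝ E] [FiniteDimensional ℝ E]
  {H : Type*} [TopologicalSpace H] {I : ModelWithCorners ℝ E H}
  {M : Type*} [TopologicalSpace M] [ChartedSpace H M] [IsManifold I ∞ M]
  [T2Space M] [SigmaCompactSpace M]
  {F : Type*} [NormedAddCommGroup F] [NormedSpace ℝ F]
  {V : M → Type*} [TopologicalSpace (TotalSpace F V)] [∀ x, AddCommGroup (V x)]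
  [∀ x, Module ℝ (V x)] [∀ x, TopologicalSpace (V x)] [FiberBundle F V] [VectorBundle ℝ F V]
  [ContMDiffVectorBundle ∞ F V I]

theorem exists_section_eventuallyEq_symm (x : M) (u : F) :
    ∃ b : ContMDiffSection I F ∞ V, ∀ᶠ y in 𝓝 x, b y = (trivializationAt F V x).symm y u := by
  set e := trivializationAt F V x
  refine exists_section_eventuallyEq (I := I) (U := e.baseSet)
    (s := fun y => e.symm y u)
    (e.open_baseSet.mem_nhds (FiberBundle.mem_baseSet_trivializationAt' x)) ?_
  refine (e.contMDiffOn_section_baseSet_iff (IB := I) (n := ∞)).2 ?_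
  refine (contMDiffOn_const (c := u)).congr fun y hy => ?_
  rw [e.apply_mk_symm hy]

theorem exists_section_apply_eq (x : M) (v : V x) :
    ∃ b : ContMDiffSection I F ∞ V, b x = v := by
  obtain ⟨b, hb⟩ := exists_section_eventuallyEq_symm (I := I) (V := V) x
    ((trivializationAt F V x) ⟨x, v⟩).2
  refine ⟨b, hb.self_of_nhds.trans ?_⟩
  exact Trivialization.symm_proj_apply (trivializationAt F V x) ⟨x, v⟩
    (FiberBundle.mem_baseSet_trivializationAt' x)

/-- A section vanishing at `x` is near `x` a combination of sections with coefficients that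
vanish at `x`. -/
theorem exists_eventually_eq_sum_of_apply_eq_zero [FiniteDimensional ℝ F]
    (a : ContMDiffSection I F ∞ V) {x : M} (hx : a x = 0) :
    ∃ (n : ℕ) (b : Fin n → ContMDiffSection I F ∞ V) (h : Fin n → SmoothFn I M),
      (∀ i, h i x = 0) ∧ ∀ᶠ y in 𝓝 x, a y = ∑ i, h i y • b i y := by
  set e := trivializationAt F V x
  have hxe : x ∈ e.baseSet := FiberBundle.mem_baseSet_trivializationAt' x
  set B := Module.finBasis ℝ F
  choose b hb using fun i => exists_section_eventuallyEq_symm (I := I) (V := V) x (B i)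
  have hc : ∀ i, ContMDiffOn I 𝓘(ℝ, ℝ) ∞ (fun y => B.coord i (e ⟨y, a y⟩).2) e.baseSet :=
    fun i => (LinearMap.toContinuousLinearMap (B.coord i)).contMDiff.comp_contMDiffOn
      ((e.contMDiffOn_section_baseSet_iff (IB := I) (n := ∞)).1 a.contMDiff.contMDiffOn)
  choose h hh using fun i => exists_smoothFn_eventuallyEq (e.open_baseSet.mem_nhds hxe) (hc i)
  refine ⟨_, b, h, fun i => ?_, ?_⟩
  · have h1 : (e ⟨x, a x⟩).2 = 0 := by
      rw [hx]
      exact (e.linear ℝ hxe).map_zero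
    exact (hh i).self_of_nhds.trans ((congrArg _ h1).trans (map_zero _))
  · filter_upwards [e.open_baseSet.mem_nhds hxe, eventually_all.2 hb, eventually_all.2 hh]
      with y hy h1 h2
    have h3 : e.symm y (e ⟨y, a y⟩).2 = a y := e.symm_proj_apply ⟨y, a y⟩ hy
    rw [← h3, ← e.symmL_apply (R := ℝ) hy]
    conv_lhs => rw [← B.sum_repr (e ⟨y, a y⟩).2, map_sum]
    refine Finset.sum_congr rfl fun i _ => ?_
    rw [map_smul, e.symmL_apply (R := ℝ) hy, h1, h2]
    rfl

/-- Combinations of pulled back sections are smooth. -/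
theorem contMDiff_sum_smul_comp {E' : Type*} [NormedAddCommGroup E'] [NormedSpace ℝ E']
    {H' : Type*} [TopologicalSpace H'] {J : ModelWithCorners ℝ E' H'}
    {N : Type*} [TopologicalSpace N] [ChartedSpace H' N] {φ : N → M} (hφ : ContMDiff J I ∞ φ)
    {ι : Type*} [Fintype ι] (f : ι → SmoothFn J N) (a : ι → ContMDiffSection I F ∞ V) :
    ContMDiff J (I.prod 𝓘(ℝ, F)) ∞
      (fun q => (⟨φ q, ∑ i, f i q • a i (φ q)⟩ : TotalSpace F V)) := by
  intro q
  rw [contMDiffAt_totalSpace]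
  refine ⟨hφ q, ?_⟩
  set e := trivializationAt F V (φ q)
  have h1 : ∀ i, ContMDiffAt J 𝓘(ℝ, F) ∞ (fun y => (e ⟨φ y, a i (φ y)⟩).2) q := fun i =>
    ((contMDiffAt_section (φ q)).1 (a i).contMDiff.contMDiffAt).comp q (hφ q)
  have h2 : ContMDiffAt J 𝓘(ℝ, F) ∞ (fun y => ∑ i, f i y • (e ⟨φ y, a i (φ y)⟩).2) q :=
    contMDiffAt_finsetSum fun i _ => (f i).contMDiff.contMDiffAt.smul (h1 i)
  refine h2.congr_of_eventuallyEq ?_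
  filter_upwards [hφ.continuous.continuousAt.preimage_mem_nhds
    (e.open_baseSet.mem_nhds (FiberBundle.mem_baseSet_trivializationAt' (φ q)))] with y hy
  have h3 := fun v => e.continuousLinearMapAt_apply_of_mem ℝ hy v
  simp only [← h3, map_sum, map_smul]

end Sections

section Lift

variable {E : Type} [NormedAddCommGroup E] [NormedSpace ℝ E] [FiniteDimensional ℝ E]
  {H : Type*} [TopologicalSpace H] {I : ModelWithCorners ℝ E H} [I.Boundaryless]
  {M : Type*} [TopologicalSpace M] [ChartedSpace H M] [IsManifold I ∞ M]
  [T2Space M] [SigmaCompactSpace M] {Z : Set M}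

namespace DefiningData

variable (D : DefiningData I Z) (k : ℕ)

open Classical in
/-- The function `χ(z)` on `U`, extended by zero. -/
def cutoffFn : SmoothFn I M :=
  ⟨fun x => if x ∈ D.U then cutoff (D.z x) else 0, fun x => by
    by_cases hx : x ∈ D.U
    · refine ContMDiffAt.congr_of_eventuallyEq
        (contDiff_cutoff.contMDiff.comp D.z.contMDiff).contMDiffAt ?_
      filter_upwards [D.isOpen_U.mem_nhds hx] with y hy using if_pos hy
    · refine ContMDiffAt.congr_of_eventuallyEq (contMDiffAt_const (c := (0 : ℝ))) ?_
      have h1 : x ∉ closure {x ∈ D.U | |D.z x| < 1} := fun h => hx (D.closure_subset h)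
      filter_upwards [isClosed_closure.isOpen_compl.mem_nhds h1] with y hy
      split_ifs with h
      · exact cutoff_eq_zero (not_lt.1 fun h' => hy (subset_closure ⟨h, h'⟩))
      · rfl⟩

theorem cutoffFn_of_mem {x : M} (hx : x ∈ D.U) : D.cutoffFn x = cutoff (D.z x) := if_pos hx

theorem cutoffFn_of_notMem {x : M} (hx : x ∉ D.U) : D.cutoffFn x = 0 := if_neg hx

/-- The lift of a vector field to the foliation. -/
def lev (q : M × Circle) (X : SmoothVF I M) : TangentSpace (I.prod (𝓡 1)) q :=
  (splitting I q).symm (X q.1, -(D.cutoffFn q.1 * D.coeff k X q.1))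

theorem dproj_lev (q : M × Circle) (X : SmoothVF I M) : dproj I q (D.lev k q X) = X q.1 :=
  dproj_splitting_symm _ _ _

theorem dsForm_lev (q : M × Circle) (X : SmoothVF I M) :
    dsForm I q (D.lev k q X) = -(D.cutoffFn q.1 * D.coeff k X q.1) :=
  dsForm_splitting_symm _ _ _

theorem lev_mem (q : M × Circle) {X : SmoothVF I M} (hX : X ∈ D.fields k) :
    D.lev k q X ∈ D.foliationTangent k q := by
  by_cases hU : q.1 ∈ D.U
  · rw [D.mem_foliationTangent_of_mem_U k hU, dproj_lev, dsForm_lev, D.cutoffFn_of_mem hU,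
      ← lieDeriv_apply, D.lieDeriv_eq_coeff hX hU]
    ring
  · rw [D.mem_foliationTangent_of_notMem_U k hU, dsForm_lev, D.cutoffFn_of_notMem hU, zero_mul,
      neg_zero]

theorem lev_eq_sum (q : M × Circle) {n : ℕ} {X : SmoothVF I M} {W : Fin n → SmoothVF I M}
    (hX : X ∈ D.fields k) (hW : ∀ i, W i ∈ D.fields k) {h : Fin n → SmoothFn I M}
    (he : ∀ᶠ y in 𝓝 q.1, X y = ∑ i, h i y • W i y) :
    D.lev k q X = ∑ i, h i q.1 • D.lev k q (W i) := by
  refine tangent_ext ?_ ?_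
  · simp only [dproj_lev, map_sum, map_smul]
    exact he.self_of_nhds
  · simp only [dsForm_lev, map_sum, map_smul]
    by_cases hU : q.1 ∈ D.U
    · have h1 : D.coeff k X q.1 = (∑ i, h i * D.coeff k (W i) : SmoothFn I M) q.1 := by
        refine D.coeff_eq_of_eventually hX hU ?_
        filter_upwards [he, D.isOpen_U.mem_nhds hU] with y hy hyU
        rw [lieDeriv_apply, hy, map_sum, SmoothFn.sum_apply, Finset.mul_sum]
        refine Finset.sum_congr rfl fun i _ => ?_
        have h2 := D.lieDeriv_eq_coeff (hW i) hyU
        rw [lieDeriv_apply] at h2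
        rw [map_smul, h2]
        change h i y * _ = D.z y ^ k * (h i y * D.coeff k (W i) y)
        ring
      rw [h1, SmoothFn.sum_apply, Finset.mul_sum, ← Finset.sum_neg_distrib]
      refine Finset.sum_congr rfl fun i _ => ?_
      change -(D.cutoffFn q.1 * (h i q.1 * D.coeff k (W i) q.1)) =
        h i q.1 * -(D.cutoffFn q.1 * D.coeff k (W i) q.1)
      ring
    · simp [D.cutoffFn_of_notMem hU]

theorem mem_fields_of_local {X : SmoothVF I M}
    (h : ∀ p ∈ Z, ∀ᶠ x in 𝓝 p, mvfderiv I D.z x (X x) = 0) : X ∈ D.fields k := by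
  obtain ⟨g, hg⟩ := D.exists_eq_pow_mul_of_local k (f := lieDeriv X D.z) fun p hp =>
    ⟨fun _ => 0, _, h p hp, contMDiffOn_const, fun x hx => by rw [mul_zero]; exact hx⟩
  exact D.mem_vanishingIdeal_pow_of_eq hg

/-- Local generators of the tangent space of the foliation. -/
theorem exists_generators (x₀ : M) : ∃ (n : ℕ) (W : Fin n → SmoothVF I M)
    (c : Fin n → SmoothFn I M) (ε : Fin n → ℝ), (∀ i, W i ∈ D.fields k) ∧
      ∃ O ∈ 𝓝 x₀, ∀ q : M × Circle, q.1 ∈ O → ∀ v ∈ D.foliationTangent k q,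
        v = ∑ i, (mvfderiv I (c i) q.1 (dproj I q v) - ε i * dsForm I q v) •
          D.lev k q (W i) := by
  obtain ⟨c, e, hce⟩ := exists_coordinates (I := I) x₀
  by_cases hx₀ : x₀ ∈ Z
  · set X₀ : SmoothVF I M := smulSection (D.z ^ k) D.Y
    have hX₀ : X₀ ∈ D.fields k := by
      refine D.mem_vanishingIdeal_pow_of_eq (g := lieDeriv D.Y D.z) fun x hx => ?_
      rw [lieDeriv_smulSection]
      rfl
    set X : Fin (Module.finrank ℝ E) → SmoothVF I M := fun i =>
      e i - smulSection (lieDeriv (e i) D.z) D.Y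
    have hXz : ∀ i, ∀ x ∈ D.U₁, mvfderiv I D.z x (X i x) = 0 := fun i x hx => by
      change mvfderiv I D.z x (e i x - mvfderiv I D.z x (e i x) • D.Y x) = 0
      rw [map_sub, map_smul, D.mvfderiv_z_Y hx, smul_eq_mul, mul_one, sub_self]
    have hX : ∀ i, X i ∈ D.fields k := fun i => D.mem_fields_of_local k fun p hp => by
      filter_upwards [D.U₁_mem_nhds hp] with x hx using hXz i x hx
    refine ⟨_, Fin.cons X₀ X, Fin.cons 0 c, Fin.cons 1 fun _ => 0,
      Fin.cases hX₀ hX, _, hce.and (D.U₁_mem_nhds hx₀), fun q ⟨hx, hxU⟩ v hv => ?_⟩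
    have hxU' : q.1 ∈ D.U := D.U₁_subset hxU
    have hθ : D.cutoffFn q.1 = 1 := by
      rw [D.cutoffFn_of_mem hxU', cutoff_eq_one (D.abs_lt _ hxU).le]
    have hG₀ : D.coeff k X₀ q.1 = 1 := by
      refine D.coeff_eq_of_eventually (g := 1) hX₀ hxU' ?_
      filter_upwards [D.isOpen_U₁.mem_nhds hxU] with y hy
      change mvfderiv I D.z y (D.z y ^ k • D.Y y) = D.z y ^ k * 1
      rw [map_smul, D.mvfderiv_z_Y hy]
      rfl
    have hG : ∀ i, D.coeff k (X i) q.1 = 0 := fun i => by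
      refine D.coeff_eq_of_eventually (g := 0) (hX i) hxU' ?_
      filter_upwards [D.isOpen_U₁.mem_nhds hxU] with y hy
      rw [lieDeriv_apply, hXz i y hy]
      exact (mul_zero _).symm
    have hv' := (D.mem_foliationTangent_of_mem_U₁ k hxU).1 hv
    have hd0 : ∀ u, mvfderiv I (0 : SmoothFn I M) q.1 u = 0 := fun u =>
      congrArg (fun L : TangentSpace I q.1 →L[ℝ] ℝ => L u)
        (mvfderiv_const (I := I) (0 : ℝ) (x := q.1))
    rw [Fin.sum_univ_succ]
    simp only [Fin.cons_zero, Fin.cons_succ, zero_mul, sub_zero, one_mul]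
    refine tangent_ext ?_ ?_
    · simp only [map_add, map_sum, map_smul, dproj_lev]
      have h1 : ∀ i, X i q.1 = e i q.1 - mvfderiv I D.z q.1 (e i q.1) • D.Y q.1 := fun i => rfl
      have h2 : X₀ q.1 = D.z q.1 ^ k • D.Y q.1 := rfl
      simp only [h1, h2, hd0, smul_sub, Finset.sum_sub_distrib]
      have h0 : dproj I q v = ∑ i, mvfderiv I (c i) q.1 (dproj I q v) • e i q.1 := hx _
      rw [← h0]
      have h3 : mvfderiv I D.z q.1 (dproj I q v) =
          ∑ i, mvfderiv I (c i) q.1 (dproj I q v) * mvfderiv I D.z q.1 (e i q.1) := by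
        conv_lhs => rw [h0, map_sum]
        simp
      simp only [smul_smul, ← Finset.sum_smul]
      rw [← h3]
      have h4 : mvfderiv I D.z q.1 (dproj I q v) = - (D.z q.1 ^ k * dsForm I q v) :=
        eq_neg_of_add_eq_zero_left hv'
      rw [h4]
      simp [mul_comm]
    · simp only [map_add, map_sum, map_smul, dsForm_lev, hG, hG₀, hθ]
      simp
  · have := normalSpace_of_manifold I M
    obtain ⟨K, hK, hKcl, hKZ⟩ := exists_mem_nhds_isClosed_subset
      (D.isClosed.isOpen_compl.mem_nhds hx₀)
    obtain ⟨φ, hφ1, hφ0⟩ := exists_bump (I := I) hK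
    have hX : ∀ i, smulSection φ (e i) ∈ D.fields k := fun i =>
      D.mem_fields_of_local k fun p hp => by
        filter_upwards [hKcl.isOpen_compl.mem_nhds fun h => hKZ h hp] with x hx
        rw [smulSection_apply, hφ0 x hx, zero_smul, map_zero]
    refine ⟨_, fun i => smulSection φ (e i), c, fun _ => 0, hX, _,
      (hce.and hφ1).and (D.isClosed.isOpen_compl.mem_nhds hx₀), fun q ⟨⟨hx, h1⟩, hxZ⟩ v hv => ?_⟩
    have hφ : ∀ i, smulSection φ (e i) q.1 = e i q.1 := fun i => by
      rw [smulSection_apply, h1, one_smul]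
    have hmem : ∑ i, (mvfderiv I (c i) q.1 (dproj I q v) - 0 * dsForm I q v) •
          D.lev k q (smulSection φ (e i)) ∈ D.foliationTangent k q :=
      Submodule.sum_mem _ fun i _ => Submodule.smul_mem _ _ (D.lev_mem k _ (hX i))
    have h2 : dproj I q v = dproj I q (∑ i,
        (mvfderiv I (c i) q.1 (dproj I q v) - 0 * dsForm I q v) •
          D.lev k q (smulSection φ (e i))) := by
      simp only [map_sum, map_smul, dproj_lev, hφ, zero_mul, sub_zero]
      exact hx _
    refine tangent_ext h2 ?_
    have h3 := (D.mem_foliationTangent_of_notMem k hxZ).1 hv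
    have h4 := (D.mem_foliationTangent_of_notMem k hxZ).1 hmem
    rw [← h2] at h4
    exact add_left_cancel (h3.trans h4.symm)

end DefiningData

end Lift

section Morphism

variable {E : Type} [NormedAddCommGroup E] [NormedSpace ℝ E] [FiniteDimensional ℝ E]
  {H : Type*} [TopologicalSpace H] {I : ModelWithCorners ℝ E H} [I.Boundaryless]
  {M : Type*} [TopologicalSpace M] [ChartedSpace H M] [IsManifold I ∞ M]
  [T2Space M] [SigmaCompactSpace M] [CompleteSpace E] {Z : Set M}

theorem section_sum_apply {F : Type*} [NormedAddCommGroup F] [NormedSpace ℝ F]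
    {V : M → Type*} [TopologicalSpace (TotalSpace F V)] [∀ x, AddCommGroup (V x)]
    [∀ x, Module ℝ (V x)] [∀ x, TopologicalSpace (V x)] [FiberBundle F V] [VectorBundle ℝ F V]
    {ι : Type*} (t : Finset ι) (s : ι → ContMDiffSection I F ∞ V) (x : M) :
    (∑ i ∈ t, s i) x = ∑ i ∈ t, s i x := by
  classical
  induction t using Finset.induction_on with
  | empty => rfl
  | insert i t hi ih =>
    rw [Finset.sum_insert hi, Finset.sum_insert hi, ← ih]
    rfl

namespace LieAlgebroid

variable (A : LieAlgebroid.{w₁, w₂} I M)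

theorem anchorSec_apply (a : A.Sec) (x : M) : A.anchorSec a x = A.anchor x (a x) := rfl

theorem anchorSec_add (a b : A.Sec) : A.anchorSec (a + b) = A.anchorSec a + A.anchorSec b := by
  ext x
  exact map_add (A.anchor x) _ _

theorem anchorSec_smul (c : ℝ) (a : A.Sec) : A.anchorSec (c • a) = c • A.anchorSec a := by
  ext x
  exact map_smul (A.anchor x) _ _

theorem anchorSec_bracket (a b : A.Sec) :
    A.anchorSec (A.bracket a b) = bracketVF (A.anchorSec a) (A.anchorSec b) := by
  ext x
  exact A.anchor_bracket a b x

/-- If the anchor is injective on sections, then sections whose images agree near a point agree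
there. -/
theorem eq_of_anchorSec_eventuallyEq (hA : Function.Injective A.anchorSec) {a b : A.Sec} {x : M}
    (h : ∀ᶠ y in 𝓝 x, A.anchorSec a y = A.anchorSec b y) : a x = b x := by
  obtain ⟨φ, hφ1, hφ0⟩ := exists_bump (I := I) h
  have h1 : smulSection φ a = smulSection φ b := by
    refine hA ?_
    ext y
    change A.anchor y (φ y • a y) = A.anchor y (φ y • b y)
    rw [map_smul, map_smul]
    by_cases hy : A.anchorSec a y = A.anchorSec b y
    · exact congrArg (φ y • ·) hy
    · rw [hφ0 y hy, zero_smul, zero_smul]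
  have h2 : φ x • a x = φ x • b x := congrArg (fun s : A.Sec => s x) h1
  rwa [hφ1.self_of_nhds, one_smul, one_smul] at h2

end LieAlgebroid

namespace DefiningData

variable (D : DefiningData I Z) {k : ℕ} (hk : 1 ≤ k) {A : LieAlgebroid.{w₁, w₂} I M}
  (hA : IsBkTangentBundle (jetOf I Z k D.z) A)

theorem anchorSec_mem_fields (hk : 1 ≤ k) (hA : IsBkTangentBundle (jetOf I Z k D.z) A) (a : A.Sec) :
    A.anchorSec a ∈ D.fields k := by
  rw [← D.bkVectorFields_eq hk, ← hA.2]
  exact mem_range_self a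

theorem exists_anchorSec_eq (hk : 1 ≤ k) (hA : IsBkTangentBundle (jetOf I Z k D.z) A)
    {X : SmoothVF I M} (hX : X ∈ D.fields k) :
    ∃ a, A.anchorSec a = X := by
  rwa [← D.bkVectorFields_eq hk, ← hA.2] at hX

/-- The lift of sections to the foliation. -/
def levSec (q : M × Circle) : A.Sec →ₗ[ℝ] (D.foliation k hk).tangent q where
  toFun a := ⟨D.lev k q (A.anchorSec a), D.lev_mem k q (D.anchorSec_mem_fields hk hA a)⟩
  map_add' a b := by
    refine Subtype.ext ((D.lev_eq_sum k q (W := ![A.anchorSec a, A.anchorSec b]) (h := fun _ => 1)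
      (D.anchorSec_mem_fields hk hA _) (fun i => ?_) (Eventually.of_forall fun y => ?_)).trans ?_)
    · fin_cases i
      exacts [D.anchorSec_mem_fields hk hA a, D.anchorSec_mem_fields hk hA b]
    · rw [A.anchorSec_add, Fin.sum_univ_two]
      exact (congrArg₂ (· + ·) (one_smul ℝ (A.anchorSec a y)) (one_smul ℝ (A.anchorSec b y))).symm
    · rw [Fin.sum_univ_two]
      exact congrArg₂ (· + ·) (one_smul ℝ _) (one_smul ℝ _)
  map_smul' c a := by
    refine Subtype.ext ((D.lev_eq_sum k q (W := fun _ : Fin 1 => A.anchorSec a)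
      (h := fun _ => c • 1) (D.anchorSec_mem_fields hk hA _)
      (fun _ => D.anchorSec_mem_fields hk hA a) (Eventually.of_forall fun y => ?_)).trans ?_)
    · rw [A.anchorSec_smul, Fin.sum_univ_one]
      change c • A.anchorSec a y = (c * 1) • A.anchorSec a y
      rw [mul_one]
    · rw [Fin.sum_univ_one]
      change (c * 1) • _ = c • _
      rw [mul_one]

theorem levSec_coe (q : M × Circle) (a : A.Sec) :
    (D.levSec hk hA q a : TangentSpace (I.prod (𝓡 1)) q) = D.lev k q (A.anchorSec a) := rfl

theorem levSec_surjective (q : M × Circle) : Function.Surjective (D.levSec hk hA q) := by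
  rintro ⟨v, hv⟩
  obtain ⟨n, W, c, ε, hW, O, hO, h⟩ := D.exists_generators k q.1
  choose a ha using fun i => D.exists_anchorSec_eq hk hA (hW i)
  refine ⟨∑ i, (mvfderiv I (c i) q.1 (dproj I q v) - ε i * dsForm I q v) • a i, Subtype.ext ?_⟩
  rw [map_sum]
  simp only [map_smul, AddSubmonoidClass.coe_finsetSum, Submodule.coe_smul, levSec_coe, ha]
  exact (h q (mem_of_mem_nhds hO) v hv).symm

theorem levSec_eq_zero_of_apply_eq_zero (q : M × Circle) {a : A.Sec} (ha : a q.1 = 0) :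
    D.levSec hk hA q a = 0 := by
  obtain ⟨n, b, h, h0, hab⟩ := exists_eventually_eq_sum_of_apply_eq_zero a ha
  refine Subtype.ext ?_
  rw [levSec_coe, D.lev_eq_sum k q (W := fun i => A.anchorSec (b i)) (h := h)
    (D.anchorSec_mem_fields hk hA a) (fun i => D.anchorSec_mem_fields hk hA (b i))]
  · simp [h0]
  · filter_upwards [hab] with y hy
    rw [LieAlgebroid.anchorSec_apply, hy, map_sum]
    simp only [map_smul]
    rfl

theorem apply_eq_zero_of_levSec_eq_zero (q : M × Circle) {a : A.Sec}
    (ha : D.levSec hk hA q a = 0) : a q.1 = 0 := by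
  obtain ⟨n, W, c, ε, hW, O, hO, h⟩ := D.exists_generators k q.1
  choose b hb using fun i => D.exists_anchorSec_eq hk hA (hW i)
  set f : Fin n → SmoothFn I M := fun i =>
    lieDeriv (A.anchorSec a) (c i) + ε i • (D.cutoffFn * D.coeff k (A.anchorSec a))
  have hf : ∀ (q' : M × Circle) i, f i q'.1 =
      mvfderiv I (c i) q'.1 (dproj I q' (D.lev k q' (A.anchorSec a))) -
        ε i * dsForm I q' (D.lev k q' (A.anchorSec a)) := fun q' i => by
    rw [dproj_lev, dsForm_lev]
    change mvfderiv I (c i) q'.1 (A.anchorSec a q'.1) +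
      ε i * (D.cutoffFn q'.1 * D.coeff k (A.anchorSec a) q'.1) = _
    ring
  have h0 : D.lev k q (A.anchorSec a) = 0 := congrArg Subtype.val ha
  have h1 : a q.1 = (∑ i, smulSection (f i) (b i) : A.Sec) q.1 := by
    refine A.eq_of_anchorSec_eventuallyEq hA.1 ?_
    filter_upwards [hO] with y hy
    have h2 : A.anchorSec a y = dproj I (y, (1 : Circle)) _ :=
      (D.dproj_lev k (y, 1) _).symm.trans (congrArg (dproj I (y, (1 : Circle)))
        (h (y, 1) hy _ (D.lev_mem k _ (D.anchorSec_mem_fields hk hA a))))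
    have h3 : A.anchorSec (∑ i, smulSection (f i) (b i)) y = ∑ i, f i y • A.anchorSec (b i) y := by
      rw [LieAlgebroid.anchorSec_apply, section_sum_apply, map_sum]
      exact Finset.sum_congr rfl fun i _ => map_smul (A.anchor y) (f i y) (b i y)
    rw [h2, h3, map_sum]
    refine Finset.sum_congr rfl fun i _ => ?_
    rw [map_smul, ← hf (y, 1) i, D.dproj_lev k (y, 1) (W i), hb]
  rw [h1, section_sum_apply]
  refine Finset.sum_eq_zero fun i _ => ?_
  change f i q.1 • b i q.1 = 0
  rw [hf q i, h0, map_zero, map_zero, map_zero, mul_zero, sub_zero, zero_smul]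

/-- The fibrewise isomorphism from the tangent bundle of the foliation to the
`b^k`-tangent bundle. -/
def morphism (q : M × Circle) : (D.foliation k hk).tangent q →ₗ[ℝ] A.V q.1 where
  toFun v := (Function.surjInv (D.levSec_surjective hk hA q) v) q.1
  map_add' v w := by
    set R := Function.surjInv (D.levSec_surjective hk hA q)
    have hR := Function.surjInv_eq (D.levSec_surjective hk hA q)
    have h := D.apply_eq_zero_of_levSec_eq_zero hk hA q (a := R (v + w) - (R v + R w)) (by
      rw [map_sub, map_add]; simp only [R, hR, sub_self])
    exact sub_eq_zero.1 h
  map_smul' c v := by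
    set R := Function.surjInv (D.levSec_surjective hk hA q)
    have hR := Function.surjInv_eq (D.levSec_surjective hk hA q)
    have h := D.apply_eq_zero_of_levSec_eq_zero hk hA q (a := R (c • v) - c • R v) (by
      rw [map_sub, map_smul]; simp only [R, hR, sub_self])
    exact sub_eq_zero.1 h

theorem morphism_levSec (q : M × Circle) (a : A.Sec) :
    D.morphism hk hA q (D.levSec hk hA q a) = a q.1 := by
  have h := D.apply_eq_zero_of_levSec_eq_zero hk hA q
    (a := Function.surjInv (D.levSec_surjective hk hA q) (D.levSec hk hA q a) - a) (by
      rw [map_sub, Function.surjInv_eq (D.levSec_surjective hk hA q), sub_self])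
  exact sub_eq_zero.1 h

theorem morphism_bijective (q : M × Circle) : Function.Bijective (D.morphism hk hA q) := by
  constructor
  · rw [injective_iff_map_eq_zero]
    intro v hv
    obtain ⟨a, rfl⟩ := D.levSec_surjective hk hA q v
    rw [morphism_levSec] at hv
    exact D.levSec_eq_zero_of_apply_eq_zero hk hA q hv
  · intro u
    obtain ⟨a, ha⟩ := exists_section_apply_eq (I := I) (F := A.Fib) (V := A.V) q.1 u
    exact ⟨D.levSec hk hA q a, (D.morphism_levSec hk hA q a).trans ha⟩

theorem anchor_morphism (q : M × Circle) (v : (D.foliation k hk).tangent q) :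
    A.anchor q.1 (D.morphism hk hA q v) = dproj I q (v : TangentSpace (I.prod (𝓡 1)) q) := by
  obtain ⟨a, rfl⟩ := D.levSec_surjective hk hA q v
  rw [morphism_levSec, levSec_coe, dproj_lev]
  rfl

theorem anchor_injective_of_notMem (hk : 1 ≤ k)
    (hA : IsBkTangentBundle (jetOf I Z k D.z) A)
    {x : M} (hx : x ∉ Z) : Function.Injective (A.anchor x) := by
  rw [injective_iff_map_eq_zero]
  intro v hv
  obtain ⟨a, ha⟩ := exists_section_apply_eq (I := I) (F := A.Fib) (V := A.V) x v
  rw [← ha]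
  refine D.apply_eq_zero_of_levSec_eq_zero hk hA (x, 1) (Subtype.ext ?_)
  have h1 : dproj I (x, (1 : Circle)) (D.lev k (x, 1) (A.anchorSec a)) = 0 := by
    rw [dproj_lev, LieAlgebroid.anchorSec_apply, ha, hv]
  have h2 := (D.mem_foliationTangent_of_notMem k (q := (x, 1)) hx).1
    (D.lev_mem k (x, 1) (D.anchorSec_mem_fields hk hA a))
  rw [h1, map_zero, zero_add] at h2
  exact tangent_ext (h1.trans (map_zero _).symm) (h2.trans (map_zero _).symm)

/-- A smooth function, pulled back to `M × S¹`. -/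
def pullback (f : SmoothFn I M) : SmoothFn (I.prod (𝓡 1)) (M × Circle) :=
  ⟨fun q => f q.1, f.contMDiff.comp contMDiff_fst⟩

theorem lieDeriv_pullback (X : SmoothVF (I.prod (𝓡 1)) (M × Circle)) (f : SmoothFn I M)
    (q : M × Circle) : lieDeriv X (pullback f) q = mvfderiv I f q.1 (dproj I q (X q)) :=
  mvfderiv_comp_fst (f.mdifferentiableAt q.1) (X q)

/-- Near each point the morphism is a combination of pulled back sections with coefficients
the differentials of smooth functions. -/
theorem exists_morphism_eq_sum (q₀ : M × Circle) : ∃ (n : ℕ) (a : Fin n → A.Sec)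
    (c : Fin n → SmoothFn (I.prod (𝓡 1)) (M × Circle)), ∀ᶠ q in 𝓝 q₀,
      ∀ v : (D.foliation k hk).tangent q, D.morphism hk hA q v =
        ∑ i, mvfderiv (I.prod (𝓡 1)) (c i) q (v : TangentSpace (I.prod (𝓡 1)) q) • a i q.1 := by
  obtain ⟨n, W, c, ε, hW, O, hO, h⟩ := D.exists_generators k q₀.1
  choose a ha using fun i => D.exists_anchorSec_eq hk hA (hW i)
  obtain ⟨S, P, hP, hqP, -, hS, -, hSd⟩ := exists_angle q₀.2
  have hP' : Prod.snd ⁻¹' P ∈ 𝓝 q₀ := (hP.preimage continuous_snd).mem_nhds hqP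
  obtain ⟨s, hs⟩ := exists_smoothFn_eventuallyEq (I := I.prod (𝓡 1)) hP'
    (f := fun q : M × Circle => S q.2) (hS.comp contMDiff_snd.contMDiffOn fun _ h => h)
  refine ⟨n, a, fun i => pullback (c i) - ε i • s, ?_⟩
  filter_upwards [hs.eventuallyEq_nhds, hP', continuous_fst.continuousAt.preimage_mem_nhds hO]
    with q hsq hqP hqO v
  have h1 : v = ∑ i, (mvfderiv I (c i) q.1 (dproj I q v) -
      ε i * dsForm I q (v : TangentSpace (I.prod (𝓡 1)) q)) • D.levSec hk hA q (a i) := by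
    refine Subtype.ext ((h q hqO v v.2).trans ?_)
    simp only [AddSubmonoidClass.coe_finsetSum, Submodule.coe_smul, levSec_coe, ha]
  have h2 : ∀ i, mvfderiv (I.prod (𝓡 1)) (pullback (c i) - ε i • s : SmoothFn _ _) q
      (v : TangentSpace (I.prod (𝓡 1)) q) = mvfderiv I (c i) q.1 (dproj I q v) -
      ε i * dsForm I q (v : TangentSpace (I.prod (𝓡 1)) q) := fun i => by
    obtain ⟨X, hX⟩ := exists_section_apply_eq (I := I.prod (𝓡 1))
      (F := E × EuclideanSpace ℝ (Fin 1))
      (V := fun q : M × Circle => TangentSpace (I.prod (𝓡 1)) q) q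
      (v : TangentSpace (I.prod (𝓡 1)) q)
    have e1 := congrArg (fun f : SmoothFn (I.prod (𝓡 1)) (M × Circle) => f q)
      (lieDeriv_sub X (pullback (c i)) (ε i • s))
    rw [lieDeriv_smul] at e1
    have e2 : lieDeriv X (pullback (c i)) q = mvfderiv I (c i) q.1 (dproj I q (X q)) :=
      lieDeriv_pullback X (c i) q
    have e3 : lieDeriv X s q = dsForm I q (X q) := by
      rw [lieDeriv_apply, mvfderiv_congr hsq]
      exact mvfderiv_comp_snd ((hS.contMDiffAt (hP.mem_nhds hqP)).mdifferentiableAt (by simp))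
        (hSd _ hqP) _
    have e4 : lieDeriv X (pullback (c i) - ε i • s) q =
        lieDeriv X (pullback (c i)) q - ε i * lieDeriv X s q := e1
    rw [e2, e3, lieDeriv_apply, hX] at e4
    exact e4
  conv_lhs => rw [h1]
  simp only [map_sum, map_smul, morphism_levSec, h2]

theorem contMDiff_morphism (X : (D.foliation k hk).Sec) :
    ContMDiff (I.prod (𝓡 1)) (I.prod 𝓘(ℝ, A.Fib)) ∞
      (fun q => (⟨q.1, D.morphism hk hA q (X.val q)⟩ : TotalSpace A.Fib A.V)) := by
  intro q₀
  obtain ⟨n, a, c, h⟩ := D.exists_morphism_eq_sum hk hA q₀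
  refine ((contMDiff_sum_smul_comp (φ := (Prod.fst : M × Circle → M)) contMDiff_fst
    (fun i => lieDeriv X.1 (c i)) a) q₀).congr_of_eventuallyEq ?_
  filter_upwards [h] with q hq
  rw [hq]
  rfl

end DefiningData

end Morphism

section MorphismBracket

variable {E : Type} [NormedAddCommGroup E] [NormedSpace ℝ E] [FiniteDimensional ℝ E]
  {H : Type*} [TopologicalSpace H] {I : ModelWithCorners ℝ E H} [I.Boundaryless]
  {M : Type*} [TopologicalSpace M] [ChartedSpace H M] [IsManifold I ∞ M]
  [T2Space M] [SigmaCompactSpace M] [CompleteSpace E] {Z : Set M}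

theorem lieDeriv_sum (X : SmoothVF I M) {ι : Type*} (s : Finset ι) (f : ι → SmoothFn I M) :
    lieDeriv X (∑ i ∈ s, f i) = ∑ i ∈ s, lieDeriv X (f i) :=
  map_sum (AddMonoidHom.mk' (lieDeriv X) (lieDeriv_add X)) f s

namespace DefiningData

variable (D : DefiningData I Z) {k : ℕ} (hk : 1 ≤ k) {A : LieAlgebroid.{w₁, w₂} I M}
  (hA : IsBkTangentBundle (jetOf I Z k D.z) A)

theorem lieDeriv_pullback_eq_sum (X : (D.foliation k hk).Sec) {ι : Type*} [Fintype ι]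
    {f : ι → SmoothFn (I.prod (𝓡 1)) (M × Circle)} {a : ι → A.Sec}
    (hX : ∀ q, D.morphism hk hA q (X.val q) = ∑ i, f i q • a i q.1) (h : SmoothFn I M) :
    lieDeriv X.1 (pullback h) = ∑ i, f i * pullback (lieDeriv (A.anchorSec (a i)) h) := by
  ext q
  have h1 : dproj I q (X.1 q) = ∑ i, f i q • A.anchorSec (a i) q.1 := by
    refine (D.anchor_morphism hk hA q (X.val q)).symm.trans ?_
    rw [hX, map_sum]
    exact Finset.sum_congr rfl fun i _ => map_smul (A.anchor q.1) (f i q) (a i q.1)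
  rw [lieDeriv_pullback, h1, map_sum, SmoothFn.sum_apply]
  refine Finset.sum_congr rfl fun i _ => ?_
  rw [map_smul]
  rfl

theorem lieDeriv_bracketVF_pullback (X Y : (D.foliation k hk).Sec) {ι κ : Type*} [Fintype ι]
    [Fintype κ] {f : ι → SmoothFn (I.prod (𝓡 1)) (M × Circle)}
    {g : κ → SmoothFn (I.prod (𝓡 1)) (M × Circle)} {a : ι → A.Sec} {b : κ → A.Sec}
    (hX : ∀ q, D.morphism hk hA q (X.val q) = ∑ i, f i q • a i q.1)
    (hY : ∀ q, D.morphism hk hA q (Y.val q) = ∑ j, g j q • b j q.1) (h : SmoothFn I M) :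
    lieDeriv (bracketVF X.1 Y.1) (pullback h) =
      ∑ i, ∑ j, f i * g j * pullback (lieDeriv (A.anchorSec (A.bracket (a i) (b j))) h)
      + ∑ j, lieDeriv X.1 (g j) * pullback (lieDeriv (A.anchorSec (b j)) h)
      - ∑ i, lieDeriv Y.1 (f i) * pullback (lieDeriv (A.anchorSec (a i)) h) := by
  have hp : ∀ u v : SmoothFn I M, pullback (u - v) = pullback u - pullback v := fun _ _ => rfl
  rw [lieDeriv_bracketVF, D.lieDeriv_pullback_eq_sum hk hA X hX,
    D.lieDeriv_pullback_eq_sum hk hA Y hY, lieDeriv_sum, lieDeriv_sum]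
  simp only [lieDeriv_mul, D.lieDeriv_pullback_eq_sum hk hA X hX,
    D.lieDeriv_pullback_eq_sum hk hA Y hY, LieAlgebroid.anchorSec_bracket, lieDeriv_bracketVF,
    hp, mul_sub, Finset.sum_add_distrib, Finset.sum_sub_distrib, Finset.mul_sum]
  have e1 : ∑ j, ∑ i, g j * (f i * pullback
        (lieDeriv (A.anchorSec (a i)) (lieDeriv (A.anchorSec (b j)) h))) =
      ∑ i, ∑ j, f i * g j * pullback
        (lieDeriv (A.anchorSec (a i)) (lieDeriv (A.anchorSec (b j)) h)) := by
    rw [Finset.sum_comm]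
    exact Finset.sum_congr rfl fun i _ => Finset.sum_congr rfl fun j _ => by ring
  have e2 : ∑ j, pullback (lieDeriv (A.anchorSec (b j)) h) * lieDeriv X.1 (g j) =
      ∑ j, lieDeriv X.1 (g j) * pullback (lieDeriv (A.anchorSec (b j)) h) :=
    Finset.sum_congr rfl fun j _ => mul_comm _ _
  have e3 : ∑ i, pullback (lieDeriv (A.anchorSec (a i)) h) * lieDeriv Y.1 (f i) =
      ∑ i, lieDeriv Y.1 (f i) * pullback (lieDeriv (A.anchorSec (a i)) h) :=
    Finset.sum_congr rfl fun i _ => mul_comm _ _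
  rw [e1, e2, e3]
  simp only [← mul_assoc]
  abel

theorem morphism_bracket (X Y : (D.foliation k hk).Sec) {ι κ : Type*} [Fintype ι]
    [Fintype κ] {f : ι → SmoothFn (I.prod (𝓡 1)) (M × Circle)}
    {g : κ → SmoothFn (I.prod (𝓡 1)) (M × Circle)} {a : ι → A.Sec} {b : κ → A.Sec}
    (hX : ∀ q, D.morphism hk hA q (X.val q) = ∑ i, f i q • a i q.1)
    (hY : ∀ q, D.morphism hk hA q (Y.val q) = ∑ j, g j q • b j q.1) (q : M × Circle) :
    D.morphism hk hA q ((D.foliation k hk).bracket X Y q) =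
      ∑ i, ∑ j, (f i q * g j q) • A.bracket (a i) (b j) q.1
      + ∑ j, lieDeriv X.1 (g j) q • b j q.1
      - ∑ i, lieDeriv Y.1 (f i) q • a i q.1 := by
  set B : (D.foliation k hk).Sec :=
    ⟨bracketVF X.1 Y.1, (D.foliation k hk).involutive X.1 Y.1 X.2 Y.2⟩
  set p : (ι × κ) ⊕ κ ⊕ ι → SmoothFn (I.prod (𝓡 1)) (M × Circle) :=
    Sum.elim (fun ij => f ij.1 * g ij.2)
      (Sum.elim (fun j => lieDeriv X.1 (g j)) fun i => -lieDeriv Y.1 (f i))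
  set c : (ι × κ) ⊕ κ ⊕ ι → A.Sec :=
    Sum.elim (fun ij => A.bracket (a ij.1) (b ij.2)) (Sum.elim b a)
  have hsum : ∀ q : M × Circle, ∑ l, p l q • c l q.1 =
      ∑ i, ∑ j, (f i q * g j q) • A.bracket (a i) (b j) q.1
      + ∑ j, lieDeriv X.1 (g j) q • b j q.1
      - ∑ i, lieDeriv Y.1 (f i) q • a i q.1 := fun q => by
    rw [Fintype.sum_sum_type, Fintype.sum_sum_type, Fintype.sum_prod_type, sub_eq_add_neg,
      ← Finset.sum_neg_distrib, add_assoc]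
    refine congrArg₂ _ rfl (congrArg₂ _ rfl (Finset.sum_congr rfl fun i _ => ?_))
    exact neg_smul (lieDeriv Y.1 (f i) q) (a i q.1)
  rw [← hsum]
  refine lift_eq_of_dense (φ := (Prod.fst : M × Circle → M))
    (s := fun q => D.morphism hk hA q (B.val q)) (t := fun q => ∑ l, p l q • c l q.1)
    (D.contMDiff_morphism hk hA B).continuous
    (contMDiff_sum_smul_comp contMDiff_fst p c).continuous
    (D.dense_compl.preimage isOpenMap_fst) (fun q hq => ?_) q
  refine D.anchor_injective_of_notMem hk hA hq ?_
  refine eq_of_forall_mvfderiv_eq fun h => ?_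
  have h1 : A.anchor q.1 (D.morphism hk hA q (B.val q)) = dproj I q (B.1 q) :=
    D.anchor_morphism hk hA q (B.val q)
  rw [h1, ← lieDeriv_pullback, D.lieDeriv_bracketVF_pullback hk hA X Y hX hY, hsum]
  simp only [map_add, map_sub, map_sum, map_smul, smul_eq_mul]
  have hadd : ∀ u v w : SmoothFn (I.prod (𝓡 1)) (M × Circle), (u + v - w) q = u q + v q - w q :=
    fun _ _ _ => rfl
  rw [hadd]
  simp only [SmoothFn.sum_apply]
  rfl

theorem isLieAlgebroidMorphism :
    IsLieAlgebroidMorphism (D.foliation k hk) A Prod.fst (D.morphism hk hA) where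
  contMDiff_base := contMDiff_fst
  contMDiff := D.contMDiff_morphism hk hA
  anchor := D.anchor_morphism hk hA
  bracket X Y _ _ _ _ _ _ hX hY := D.morphism_bracket hk hA X Y hX hY

end DefiningData

end MorphismBracket

end BkRegularisation

end

theorem theorem1p1 {n : ℕ} {M : Type u} [TopologicalSpace M] [T2Space M]
    [SecondCountableTopology M] [ChartedSpace (EuclideanSpace ℝ (Fin n)) M]
    [IsManifold (𝓡 n) ∞ M]
    (k : ℕ) (hk : 1 ≤ k) (Z : Set M)
    (hZ : BkRegularisation.IsHypersurface (𝓡 n) Z)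
    (hco : BkRegularisation.IsCoorientable (𝓡 n) Z)
    (j : BkRegularisation.JetAlong (𝓡 n) Z k) (hj : BkRegularisation.IsAdmissibleJet j) :
    (∃ A : BkRegularisation.LieAlgebroid.{0, 0} (𝓡 n) M,
      BkRegularisation.IsBkTangentBundle j A) ∧
    ∃ F : BkRegularisation.CodimOneFoliation ((𝓡 n).prod (𝓡 1)) (M × Circle),
      BkRegularisation.IsCircleInvariant F ∧
      BkRegularisation.IsBuiltFromForm j F ∧
      BkRegularisation.HasCentralLeaves Z F ∧
      BkRegularisation.HasGraphicalLeaves Z F ∧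
      ∀ A : BkRegularisation.LieAlgebroid.{w₁, w₂} (𝓡 n) M,
        BkRegularisation.IsBkTangentBundle j A →
        ∃ Ψ : ∀ q : M × Circle, F.tangent q →ₗ[ℝ] A.V q.1,
          BkRegularisation.IsLieAlgebroidMorphism F A Prod.fst Ψ ∧
          ∀ q, Function.Bijective (Ψ q) := by
  have : LocallyCompactSpace M := Manifold.locallyCompact_of_finiteDimensional (𝓡 n)
  obtain ⟨D, rfl⟩ := BkRegularisation.exists_definingData hk hZ hco hj
  exact ⟨D.exists_isBkTangentBundle k hk, D.foliation k hk, D.isCircleInvariant k hk,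
    D.isBuiltFromForm k hk, D.hasCentralLeaves k hk, D.hasGraphicalLeaves k hk,
    fun A hA => ⟨D.morphism hk hA, D.isLieAlgebroidMorphism hk hA, D.morphism_bijective hk hA⟩⟩
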